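/- Let $d\ge 1$ and let $\Omega\subset\mathbb R^d$ be a bounded domain with $C^1$ boundary. Let $J\in C(\mathbb R^d)$ satisfy $J(0)>0$ and $0\le J(z)\le Ce^{-|z|^{1+\beta}}$ for all $z$, for some $C,\beta>0$; let $\kappa\in C(\mathbb T^d\times\mathbb T^d)$, $\kappa>0$, and $a\in C(\mathbb T^d)$, where $\mathbb T^d=\mathbb R^d/\mathbb Z^d$ and functions on $\mathbb T^d$ are identified with $\mathbb Z^d$-periodic functions on $\mathbb R^d$. All functions are real-valued. Put $m=\min a$ and, for $p\in\mathbb R^d$, $$H(p)=\sup\Bigl\{\lambda\in\mathbb R \,:\, \exists\,\varphi\in C(\mathbb T^d),\ \varphi>0,\ -\int_{\mathbb R^d}J(\xi-\eta)e^{p\cdot(\xi-\eta)}\kappa(\xi,\eta)\varphi(\eta)\,d\eta+a(\xi)\varphi(\xi)\ge\lambda\varphi(\xi)\ \text{ for all } \xi\Bigr\}.$$ Let $p_0$ be a maximum point of $H$ and assume $H(p_0)<m$. Then $H$ is $C^2$ near $p_0$, and there is a positive $\varphi\in C(\mathbb T^d)$ with $$-\int_{\mathbb R^d}J(\xi-\eta)e^{p_0\cdot(\xi-\eta)}\kappa(\xi,\eta)\varphi(\eta)\,d\eta+a(\xi)\varphi(\xi)=H(p_0)\varphi(\xi)\quad\text{for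 all }\xi .$$ For any such $\varphi$ set $A_{ij}=-\tfrac12\,\partial^2_{p_ip_j}H(p_0)$, $K(\xi,\eta)=\frac{1}{\varphi(\xi)}J(\xi-\eta)e^{p_0\cdot(\xi-\eta)}\kappa(\xi,\eta)\varphi(\eta)$ and, for $\varepsilon>0$, $$\tilde{\mathcal L}_\varepsilon v(x)=-\frac1{\varepsilon^{d+2}}\int_\Omega K\Bigl(\frac x\varepsilon,\frac y\varepsilon\Bigr)v(y)\,dy+\frac1{\varepsilon^{d+2}}\int_{\mathbb R^d}K\Bigl(\frac x\varepsilon,\frac y\varepsilon\Bigr)dy\;v(x).$$ Then the following hold. (i) For every $\varepsilon>0$ and $f_\varepsilon\in L^2(\Omega)$ there is a unique $v_\varepsilon\in L^2(\mathbb R^d)$ with $$\tilde{\mathcal L}_\varepsilon v_\varepsilon+v_\varepsilon=f_\varepsilon\ \text{ in }\Omega,\qquad v_\varepsilon=0\ \text{ in }\mathbb R^d\setminus\Omega .\tag{1}$$ (ii) If $\varepsilon\to0$ along a sequence and $\|f_\varepsilon\|_{L^2(\Omega)}\le C$ with $C$ independent of $\varepsilon$, then the sequence of solutions $v_\varepsilon$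 of (1) contains a subsequence converging strongly in $L^2(\mathbb R^d)$. (iii) For every $f\in L^2(\Omega)$ the problem $$-\sum_{i,j=1}^d A_{ij}\,\partial^2_{x_ix_j}v+v=f\ \text{ in }\Omega,\qquad v=0\ \text{ on }\partial\Omega,$$ has a unique solution $v\in H^1_0(\Omega)$ (the equation being understood in the sense of distributions). If $\varepsilon\to0$ along a sequence and $f_\varepsilon\to f$ strongly in $L^2(\Omega)$, then the whole sequence of solutions $v_\varepsilon$ of (1) converges strongly in $L^2(\mathbb R^d)$ to $v$, extended by $v=0$ in $\mathbb R^d\setminus\Omega$. -/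

import Mathlib

open MeasureTheory Filter Topology
open scoped ContDiff

namespace NonlocalHomogenization

noncomputable section

/-- `ℝ^d` with its Euclidean norm. -/
abbrev E (d : ℕ) : Type := EuclideanSpace ℝ (Fin d)

/-- Functions on the torus `ℝ^d / ℤ^d` are identified with `ℤ^d`-periodic functions on `ℝ^d`. -/
def IsPeriodic {d : ℕ} (g : E d → ℝ) : Prop :=
  ∀ (k : Fin d → ℤ) (x : E d), g (x + WithLp.toLp 2 (fun i => (k i : ℝ))) = g x

/-- The class of positive functions in `C(𝕋^d)`. -/
structure IsPositiveTorusFun {d : ℕ} (φ : E d → ℝ) : Prop where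
  continuous : Continuous φ
  periodic : IsPeriodic φ
  pos : ∀ ξ, 0 < φ ξ

/-- The dispersal kernel: `J ∈ C(ℝ^d)`, `J(0) > 0` and `0 ≤ J(z) ≤ C exp(-|z|^{1+β})`
for some `C, β > 0`. -/
structure IsDispersalKernel {d : ℕ} (J : E d → ℝ) : Prop where
  continuous : Continuous J
  pos_zero : 0 < J 0
  nonneg : ∀ z, 0 ≤ J z
  decay : ∃ C β : ℝ, 0 < C ∧ 0 < β ∧ ∀ z, J z ≤ C * Real.exp (-(‖z‖ ^ (1 + β)))

/-- `κ ∈ C(𝕋^d × 𝕋^d)`, `κ > 0`. -/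
structure IsPositiveCoefficient {d : ℕ} (κ : E d → E d → ℝ) : Prop where
  continuous : Continuous (fun q : E d × E d => κ q.1 q.2)
  periodic_left : ∀ η, IsPeriodic (fun ξ => κ ξ η)
  periodic_right : ∀ ξ, IsPeriodic (κ ξ)
  pos : ∀ ξ η, 0 < κ ξ η

/-- The cell operator
`φ ↦ -∫ J(ξ-η) e^{p·(ξ-η)} κ(ξ,η) φ(η) dη + a(ξ) φ(ξ)`. -/
def cellOp {d : ℕ} (J : E d → ℝ) (κ : E d → E d → ℝ) (a : E d → ℝ) (p : E d)
    (φ : E d → ℝ) (ξ : E d) : ℝ :=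
  -(∫ η, J (ξ - η) * Real.exp (inner ℝ p (ξ - η)) * κ ξ η * φ η) + a ξ * φ ξ

/-- The effective Hamiltonian `H(p)`. -/
def hamiltonian {d : ℕ} (J : E d → ℝ) (κ : E d → E d → ℝ) (a : E d → ℝ) (p : E d) : ℝ :=
  sSup {l : ℝ | ∃ φ : E d → ℝ, IsPositiveTorusFun φ ∧ ∀ ξ, l * φ ξ ≤ cellOp J κ a p φ ξ}

/-- `φ ∈ C(𝕋^d)`, `φ > 0`, is an eigenfunction of the cell operator with eigenvalue `H(p)`. -/
def IsPrincipalEigenfunction {d : ℕ} (J : E d → ℝ) (κ : E d → E d → ℝ) (a : E d → ℝ)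
    (p : E d) (φ : E d → ℝ) : Prop :=
  IsPositiveTorusFun φ ∧ ∀ ξ, cellOp J κ a p φ ξ = hamiltonian J κ a p * φ ξ

/-- `K(ξ,η) = φ(ξ)⁻¹ J(ξ-η) e^{p·(ξ-η)} κ(ξ,η) φ(η)`. -/
def kernelK {d : ℕ} (J : E d → ℝ) (κ : E d → E d → ℝ) (p : E d) (φ : E d → ℝ)
    (ξ η : E d) : ℝ :=
  (φ ξ)⁻¹ * J (ξ - η) * Real.exp (inner ℝ p (ξ - η)) * κ ξ η * φ η

/-- The transformed operator `L̃_ε`. -/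
def transformedOp {d : ℕ} (J : E d → ℝ) (κ : E d → E d → ℝ) (p : E d) (φ : E d → ℝ)
    (Ω : Set (E d)) (ε : ℝ) (v : E d → ℝ) (x : E d) : ℝ :=
  -(1 / ε ^ (d + 2)) * (∫ y in Ω, kernelK J κ p φ (ε⁻¹ • x) (ε⁻¹ • y) * v y)
    + (1 / ε ^ (d + 2)) * (∫ y, kernelK J κ p φ (ε⁻¹ • x) (ε⁻¹ • y)) * v x

/-- `v ∈ L²(ℝ^d)` solves `L̃_ε v + v = f` in `Ω`, `v = 0` in `ℝ^d \ Ω`. -/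
def IsResolventSolution {d : ℕ} (J : E d → ℝ) (κ : E d → E d → ℝ) (p : E d) (φ : E d → ℝ)
    (Ω : Set (E d)) (ε : ℝ) (f : Lp ℝ 2 (volume.restrict Ω))
    (v : Lp ℝ 2 (volume : Measure (E d))) : Prop :=
  (∀ᵐ x ∂(volume.restrict Ω), transformedOp J κ p φ Ω ε v x + v x = f x) ∧
  (∀ᵐ x ∂(volume : Measure (E d)), x ∉ Ω → v x = 0)

/-- The boundary is of class `C¹`: near each boundary point, `Ω` is the sublevel set `{g < 0}`
of a `C¹` function `g` without critical points. -/
def HasC1Boundary {d : ℕ} (Ω : Set (E d)) : Prop :=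
  ∀ x ∈ frontier Ω, ∃ U : Set (E d), IsOpen U ∧ x ∈ U ∧ ∃ g : E d → ℝ,
    ContDiffOn ℝ 1 g U ∧ (∀ y ∈ U, fderiv ℝ g y ≠ 0) ∧ Ω ∩ U = {y ∈ U | g y < 0}

/-- Bounded `C¹` domain. -/
structure IsBoundedC1Domain {d : ℕ} (Ω : Set (E d)) : Prop where
  isOpen : IsOpen Ω
  isConnected : IsConnected Ω
  isBounded : Bornology.IsBounded Ω
  boundary : HasC1Boundary Ω

/-- `∂²g / ∂x_i ∂x_j`. -/
def secondPartial {d : ℕ} (g : E d → ℝ) (i j : Fin d) (x : E d) : ℝ :=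
  fderiv ℝ (fun y => fderiv ℝ g y (EuclideanSpace.single i 1)) x (EuclideanSpace.single j 1)

/-- The effective matrix `A_{ij} = -½ ∂²H/∂p_i∂p_j (p)`. -/
def effectiveMatrix {d : ℕ} (J : E d → ℝ) (κ : E d → E d → ℝ) (a : E d → ℝ) (p : E d) :
    Matrix (Fin d) (Fin d) ℝ :=
  fun i j => -(1 / 2) * secondPartial (hamiltonian J κ a) i j p

/-- `C_c^∞(Ω)`. -/
def IsTestFunction {d : ℕ} (Ω : Set (E d)) (ψ : E d → ℝ) : Prop :=
  ContDiff ℝ ∞ ψ ∧ HasCompactSupport ψ ∧ tsupport ψ ⊆ Ω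

/-- `v ∈ H¹₀(Ω)` (extended by zero): `v` lies in the closure of `C_c^∞(Ω)` in the `H¹` norm. -/
def MemH10 {d : ℕ} (Ω : Set (E d)) (v : E d → ℝ) : Prop :=
  ∃ (ψ : ℕ → E d → ℝ) (G : E d → E d), (∀ n, IsTestFunction Ω (ψ n)) ∧
    MemLp G 2 volume ∧
    Tendsto (fun n => eLpNorm (fun x => ψ n x - v x) 2 volume) atTop (𝓝 0) ∧
    Tendsto (fun n => eLpNorm (fun x => gradient (ψ n) x - G x) 2 volume) atTop (𝓝 0)

/-- `v` is the zero extension of a solution in `H¹₀(Ω)` of `-A_{ij} ∂²_{ij} v + v = f` in `Ω`,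
`v = 0` on `∂Ω`; the equation holds in the sense of distributions. -/
def IsLimitSolution {d : ℕ} (A : Matrix (Fin d) (Fin d) ℝ) (Ω : Set (E d))
    (f : Lp ℝ 2 (volume.restrict Ω)) (v : Lp ℝ 2 (volume : Measure (E d))) : Prop :=
  MemH10 Ω v ∧
  (∀ᵐ x ∂(volume : Measure (E d)), x ∉ Ω → v x = 0) ∧
  ∀ ψ : E d → ℝ, IsTestFunction Ω ψ →
    (∫ x in Ω, v x * (-(∑ i, ∑ j, A i j * secondPartial ψ i j x) + ψ x)) = ∫ x in Ω, f x * ψ x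

end

end NonlocalHomogenization

/-! Let `T` be the integral operator on `C(𝕋^d)` tilted by `p₀` (`tiltOp`) and `c = a - H(p₀)`, a
positive function because `H(p₀) < min a`. Then `c - T` is an invertible multiplication minus a
positive compact operator, and the Fredholm alternative together with a maximum principle replaces
the Krein–Rutman theorem. Solutions of the resolvent equation with right-hand side `1` blow up as
the level rises to `H(p₀)`, and their normalized limit is a positive eigenfunction
(`exists_eigenfunction`), unique up to multiples (`eq_smul_of_sub_eq_smul`). The adjoint is treated
in the same way; pairing over the unit cell (`le_of_dual`) shows that it has the same principal
value, with a positive eigenfunction `Φ`.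

Multiplying the resolvent equation by `(Φφ)(x/ε)` produces a kernel `M` (`symKernel`) whose row and
column integrals coincide, precisely because `φ` and `Φ` are eigenfunctions. Such a kernel need not
be symmetric, but its quadratic form is half the energy `∬ M(x,y)(u(x)-u(y))²` (`energy_eq`).
Coercivity follows, hence (i) by Lax–Milgram. The same identity bounds the energy of a solution by
`C ε^(d+2) ‖f‖²`. Since `M` is bounded below for `|x-y| < rε`, averaging and chaining turn this into
`‖v(·+z) - v‖ ≤ C‖f‖(|z| + ε)` for all `z` (`exists_uniform_bound`). As the supports stay in a
bounded set, this gives strong compactness (`exists_convergent_subseq`), which is (ii). A strong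
limit has modulus `C|z|` and vanishes off `Ω`; for a bounded `C¹` domain this puts it in `H¹₀`
(`memH10_of_shiftNorm`).

The limit equation comes from testing with `oscTest` divided by `Φ(x/ε)`. The implicit function
theorem gives a `C²` branch of adjoint eigenfunctions near the tilt `-p₀` (`exists_eigen_branch`),
and with it the `C²` regularity of `H`. Its first and second derivatives are the correctors:
differentiating the eigenvalue equation twice, at a point where the gradient of `H` vanishes, yields
the corrector equations, with the Hessian of `H` as the effective coefficient (`IsCorrector`,
`exists_corrector`). They cancel the singular orders in `ε` and leave `(Φφ)(x/ε)` times the limit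
operator up to `O(ε)` (`exists_weak_form`). The oscillating factor converges weakly to its mean, the
same nonzero constant on both sides, and drops out.

At a maximum of `H` the matrix `A` is nonnegative. Together with the zeroth-order term this gives
uniqueness of the limit in `H¹₀` without any use of ellipticity (`IsLimitSolution.unique`), while
existence is supplied by the compactness. Uniqueness upgrades subsequential convergence to
convergence of the whole sequence. -/

namespace NonlocalHomogenization

noncomputable section

/-! ### The torus -/

/-- The inclusion of `ℤ^d` into `ℝ^d`. -/
def latticeHom (d : ℕ) : (Fin d → ℤ) →+ E d where
  toFun k := WithLp.toLp 2 (fun i => (k i : ℝ))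
  map_zero' := by ext i; simp
  map_add' k l := by ext i; simp

/-- The torus `ℝ^d / ℤ^d`. -/
abbrev Torus (d : ℕ) : Type := E d ⧸ (latticeHom d).range

/-- The quotient map `ℝ^d → 𝕋^d`. -/
def toTorus {d : ℕ} (x : E d) : Torus d := QuotientAddGroup.mk x

variable {d : ℕ}

lemma continuous_toTorus : Continuous (toTorus : E d → Torus d) := continuous_quotient_mk'

lemma toTorus_surjective : Function.Surjective (toTorus : E d → Torus d) :=
  QuotientAddGroup.mk_surjective

lemma toTorus_add_lattice (k : Fin d → ℤ) (x : E d) :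
    toTorus (x + WithLp.toLp 2 (fun i => (k i : ℝ))) = toTorus x := by
  refine QuotientAddGroup.eq.2 ⟨-k, ?_⟩
  rw [map_neg]
  change -(WithLp.toLp 2 (fun i => (k i : ℝ))) = _
  abel

/-- The closed unit cube. -/
def closedCube (d : ℕ) : Set (E d) := {x | ∀ i, x i ∈ Set.Icc (0 : ℝ) 1}

lemma isCompact_closedCube : IsCompact (closedCube d) := by
  have h : closedCube d = WithLp.toLp 2 '' (Set.univ.pi fun _ : Fin d => Set.Icc (0 : ℝ) 1) := by
    ext x
    constructor
    · intro hx
      exact ⟨WithLp.ofLp x, fun i _ => hx i, rfl⟩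
    · rintro ⟨y, hy, rfl⟩ i
      exact hy i trivial
  rw [h]
  exact (isCompact_univ_pi fun _ => isCompact_Icc).image (PiLp.continuous_toLp 2 _)

lemma exists_add_mem_closedCube (x : E d) :
    ∃ k : Fin d → ℤ, x + WithLp.toLp 2 (fun i => (k i : ℝ)) ∈ closedCube d := by
  refine ⟨fun i => -⌊x i⌋, fun i => ?_⟩
  simp only [PiLp.add_apply, Int.cast_neg, Set.mem_Icc]
  constructor
  · linarith [Int.floor_le (x i)]
  · linarith [Int.lt_floor_add_one (x i)]

instance : CompactSpace (Torus d) := by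
  refine ⟨?_⟩
  have h : (toTorus : E d → Torus d) '' closedCube d = Set.univ := by
    refine Set.eq_univ_of_forall fun t => ?_
    obtain ⟨x, rfl⟩ := toTorus_surjective t
    obtain ⟨k, hk⟩ := exists_add_mem_closedCube x
    exact ⟨_, hk, toTorus_add_lattice k x⟩
  rw [← h]
  exact isCompact_closedCube.image continuous_toTorus

instance : Nonempty (Torus d) := ⟨toTorus 0⟩

lemma isPeriodic_comp_toTorus (φ : Torus d → ℝ) : IsPeriodic (fun x => φ (toTorus x)) :=
  fun k x => by simp only [toTorus_add_lattice]

lemma IsPeriodic.mul {f g : E d → ℝ} (hf : IsPeriodic f) (hg : IsPeriodic g) :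
    IsPeriodic (fun x => f x * g x) :=
  fun k x => by simp only [hf k x, hg k x]

/-- The Banach space `C(𝕋^d)`; its elements are regarded as periodic functions on `ℝ^d`. -/
def CT (d : ℕ) : Type := BoundedContinuousFunction (Torus d) ℝ

namespace CT

instance : NormedAddCommGroup (CT d) :=
  inferInstanceAs (NormedAddCommGroup (BoundedContinuousFunction (Torus d) ℝ))

instance : NormedSpace ℝ (CT d) :=
  inferInstanceAs (NormedSpace ℝ (BoundedContinuousFunction (Torus d) ℝ))

instance : CompleteSpace (CT d) :=
  inferInstanceAs (CompleteSpace (BoundedContinuousFunction (Torus d) ℝ))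

/-- The underlying function on the torus. -/
def toBCF : CT d ≃ₗᵢ[ℝ] BoundedContinuousFunction (Torus d) ℝ where
  toFun f := f
  invFun f := f
  map_add' _ _ := rfl
  map_smul' _ _ := rfl
  left_inv _ := rfl
  right_inv _ := rfl
  norm_map' _ := rfl

/-- Elements are evaluated at points of `ℝ^d`, not of the torus, so integrals and kernels never
mention the quotient. This is why `CT` is a `def`: bounded continuous functions already carry a
coercion to functions on the torus. -/
instance : FunLike (CT d) (E d) ℝ where
  coe f x := toBCF f (toTorus x)
  coe_injective f g h := by
    refine BoundedContinuousFunction.ext fun t => ?_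
    obtain ⟨x, rfl⟩ := toTorus_surjective t
    exact congrFun h x

/-- A continuous periodic function as an element of `C(𝕋^d)`. -/
def mk (f : E d → ℝ) (hc : Continuous f) (hp : IsPeriodic f) : CT d :=
  toBCF.symm <| BoundedContinuousFunction.mkOfCompact
  { toFun := Quotient.lift f (by
      intro x y h
      obtain ⟨k, hk⟩ := QuotientAddGroup.leftRel_apply.1 h
      have hy : y = x + WithLp.toLp 2 (fun i => (k i : ℝ)) := by
        have hk' : WithLp.toLp 2 (fun i => (k i : ℝ)) = -x + y := hk
        rw [hk']; abel
      rw [hy, hp])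
    continuous_toFun := hc.quotient_lift _ }

@[simp] lemma mk_apply (f : E d → ℝ) (hc : Continuous f) (hp : IsPeriodic f) (x : E d) :
    mk f hc hp x = f x := rfl

lemma continuous (f : CT d) : Continuous fun x => f x :=
  (toBCF f).continuous.comp continuous_toTorus

lemma periodic (f : CT d) : IsPeriodic fun x => f x :=
  isPeriodic_comp_toTorus (toBCF f)

@[simp] lemma add_apply (f g : CT d) (x : E d) : (f + g) x = f x + g x := rfl
@[simp] lemma sub_apply (f g : CT d) (x : E d) : (f - g) x = f x - g x := rfl
@[simp] lemma neg_apply (f : CT d) (x : E d) : (-f) x = -f x := rfl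
@[simp] lemma zero_apply (x : E d) : (0 : CT d) x = 0 := rfl
@[simp] lemma smul_apply (c : ℝ) (f : CT d) (x : E d) : (c • f) x = c * f x := rfl

lemma ext {f g : CT d} (h : ∀ x, f x = g x) : f = g := DFunLike.ext f g h

lemma abs_apply_le (f : CT d) (x : E d) : |f x| ≤ ‖f‖ := (toBCF f).norm_coe_le_norm _

lemma norm_le {f : CT d} {C : ℝ} (hC : 0 ≤ C) (h : ∀ x, |f x| ≤ C) : ‖f‖ ≤ C := by
  refine (BoundedContinuousFunction.norm_le (f := toBCF f) hC).2 fun t => ?_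
  obtain ⟨x, rfl⟩ := toTorus_surjective t
  exact h x

/-- Evaluation at a point. -/
def eval (x : E d) : CT d →L[ℝ] ℝ :=
  LinearMap.mkContinuous
    { toFun := fun f => f x, map_add' := fun _ _ => rfl, map_smul' := fun _ _ => rfl } 1
    fun f => by rw [one_mul]; exact f.abs_apply_le x

@[simp] lemma eval_apply (x : E d) (f : CT d) : eval x f = f x := rfl

lemma sum_apply {ι : Type*} (s : Finset ι) (f : ι → CT d) (x : E d) :
    (∑ i ∈ s, f i) x = ∑ i ∈ s, f i x := map_sum (eval x) f s

/-- The pointwise product. -/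
def mul : CT d →L[ℝ] CT d →L[ℝ] CT d :=
  LinearMap.mkContinuous₂
    (LinearMap.mk₂ ℝ (fun f g => mk (fun x => f x * g x) (f.continuous.mul g.continuous)
        (f.periodic.mul g.periodic))
      (fun f f' g => ext fun x => by simp [add_mul])
      (fun c f g => ext fun x => by simp [mul_assoc])
      (fun f g g' => ext fun x => by simp [mul_add])
      (fun c f g => ext fun x => by simp [mul_left_comm])) 1
    fun f g => norm_le (by positivity) fun x => by
      simp only [LinearMap.mk₂_apply, mk_apply, abs_mul, one_mul]
      exact mul_le_mul (f.abs_apply_le x) (g.abs_apply_le x) (abs_nonneg _) (norm_nonneg _)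

@[simp] lemma mul_apply (f g : CT d) (x : E d) : mul f g x = f x * g x := rfl

lemma exists_forall_le (f : CT d) : ∃ x, ∀ y, f x ≤ f y := by
  obtain ⟨t, -, ht⟩ := isCompact_univ.exists_isMinOn Set.univ_nonempty
    (toBCF f).continuous.continuousOn
  obtain ⟨x, rfl⟩ := toTorus_surjective t
  exact ⟨x, fun y => ht (Set.mem_univ _)⟩

end CT

/-! ### The coefficient -/

/-- Periodicity holds in each variable separately, so two independent lattice shifts move the pair
into a compact set; both uniform bounds on `κ` rest on this. -/
lemma IsPositiveCoefficient.exists_reduce {κ : E d → E d → ℝ} (hκ : IsPositiveCoefficient κ)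
    (ξ η : E d) : ∃ q ∈ closedCube d ×ˢ closedCube d, κ ξ η = κ q.1 q.2 := by
  obtain ⟨k, hk⟩ := exists_add_mem_closedCube ξ
  obtain ⟨l, hl⟩ := exists_add_mem_closedCube η
  refine ⟨(_, _), ⟨hk, hl⟩, ?_⟩
  have h1 := hκ.periodic_left η k ξ
  have h2 := hκ.periodic_right (ξ + WithLp.toLp 2 (fun i => (k i : ℝ))) l η
  simp only at h1 h2 ⊢
  rw [h2, h1]

lemma IsPositiveCoefficient.exists_le {κ : E d → E d → ℝ} (hκ : IsPositiveCoefficient κ) :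
    ∃ M, 0 < M ∧ ∀ ξ η, κ ξ η ≤ M := by
  obtain ⟨M, hM⟩ := ((isCompact_closedCube (d := d)).prod isCompact_closedCube).exists_bound_of_continuousOn
    hκ.continuous.continuousOn
  have h : ∀ ξ η, κ ξ η ≤ M := fun ξ η => by
    obtain ⟨q, hq, h⟩ := hκ.exists_reduce ξ η
    rw [h]
    exact (le_abs_self _).trans (hM q hq)
  exact ⟨M, (hκ.pos 0 0).trans_le (h 0 0), h⟩

lemma IsPositiveCoefficient.exists_ge {κ : E d → E d → ℝ} (hκ : IsPositiveCoefficient κ) :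
    ∃ m, 0 < m ∧ ∀ ξ η, m ≤ κ ξ η := by
  have hne : ((closedCube d) ×ˢ (closedCube d)).Nonempty := by
    obtain ⟨q, hq, -⟩ := hκ.exists_reduce 0 0
    exact ⟨q, hq⟩
  obtain ⟨q, -, hq⟩ := ((isCompact_closedCube (d := d)).prod isCompact_closedCube).exists_isMinOn hne
    hκ.continuous.continuousOn
  refine ⟨κ q.1 q.2, hκ.pos _ _, fun ξ η => ?_⟩
  obtain ⟨q', hq', h⟩ := hκ.exists_reduce ξ η
  rw [h]
  exact hq hq'

lemma IsPositiveCoefficient.swap {κ : E d → E d → ℝ} (hκ : IsPositiveCoefficient κ) :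
    IsPositiveCoefficient (fun ξ η => κ η ξ) where
  continuous := hκ.continuous.comp continuous_swap
  periodic_left := hκ.periodic_right
  periodic_right := hκ.periodic_left
  pos ξ η := hκ.pos η ξ

/-! ### Weights of superexponential decay -/

/-- Continuous functions decaying faster than every exponential. -/
structure IsWeight (w : E d → ℝ) : Prop where
  continuous : Continuous w
  decay : ∀ R : ℝ, ∃ C : ℝ, ∀ z, |w z| ≤ C * Real.exp (-(R * ‖z‖))

/-- Comparison with `(1 + ‖z‖)^(-(d+1))`, integrable in dimension `d`, by keeping one term of the
exponential series at `1 + ‖z‖`. -/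
lemma integrable_exp_neg_norm : Integrable (fun z : E d => Real.exp (-‖z‖)) := by
  have h := integrable_one_add_norm (E := E d) (μ := volume) (r := (d : ℝ) + 1) (by simp)
  have hb : ∃ C, ∀ z : E d, Real.exp (-‖z‖) ≤ C * (1 + ‖z‖) ^ (-((d : ℝ) + 1)) := by
    refine ⟨Real.exp 1 * (d + 1).factorial, fun z => ?_⟩
    have h0 : 0 < 1 + ‖z‖ := by positivity
    have h1 : (1 + ‖z‖) ^ (-((d : ℝ) + 1)) = ((1 + ‖z‖) ^ (d + 1))⁻¹ := by
      rw [Real.rpow_neg h0.le]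
      congr 1
      exact_mod_cast Real.rpow_natCast (1 + ‖z‖) (d + 1)
    have h2 := Real.pow_div_factorial_le_exp (1 + ‖z‖) h0.le (d + 1)
    rw [h1]
    have h3 : (0 : ℝ) < (d + 1).factorial := by positivity
    rw [div_le_iff₀ h3] at h2
    have h4 : Real.exp (-‖z‖) = Real.exp 1 * (Real.exp (1 + ‖z‖))⁻¹ := by
      rw [← Real.exp_neg, ← Real.exp_add]; congr 1; ring
    rw [h4, mul_assoc]
    gcongr
    rw [← div_eq_mul_inv, inv_eq_one_div, div_le_div_iff₀ (Real.exp_pos _) (by positivity)]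
    linarith
  obtain ⟨C, hC⟩ := hb
  refine (h.const_mul C).mono' (by fun_prop) (Eventually.of_forall fun z => ?_)
  rw [Real.norm_of_nonneg (Real.exp_pos _).le]
  exact hC z

namespace IsWeight

variable {w : E d → ℝ}

lemma exists_bound (hw : IsWeight w) (R : ℝ) :
    ∃ C, 0 < C ∧ ∀ z, |w z| ≤ C * Real.exp (-(R * ‖z‖)) := by
  obtain ⟨C, hC⟩ := hw.decay R
  refine ⟨max C 1, by positivity, fun z => (hC z).trans ?_⟩
  gcongr
  exact le_max_left _ _

lemma integrable (hw : IsWeight w) : Integrable w := by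
  obtain ⟨C, hC⟩ := hw.decay 1
  refine (integrable_exp_neg_norm.const_mul C).mono' hw.continuous.aestronglyMeasurable
    (Eventually.of_forall fun z => ?_)
  simpa using hC z

/-- Decay at every rate absorbs a factor of at most exponential growth: rate `S` for the product
uses rate `S + R` for `w`. Tilts, coordinates and moments therefore stay in the class, so
differentiating in the tilt never leaves it. -/
lemma mul_of_le (hw : IsWeight w) {g : E d → ℝ} (hg : Continuous g) {C R : ℝ}
    (h : ∀ z, |g z| ≤ C * Real.exp (R * ‖z‖)) : IsWeight (fun z => w z * g z) where
  continuous := hw.continuous.mul hg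
  decay S := by
    obtain ⟨D, hD, hw'⟩ := hw.exists_bound (S + R)
    refine ⟨D * C, fun z => ?_⟩
    rw [abs_mul]
    calc |w z| * |g z| ≤ (D * Real.exp (-((S + R) * ‖z‖))) * (C * Real.exp (R * ‖z‖)) := by
          gcongr
          · exact hw' z
          · exact h z
      _ = D * C * Real.exp (-(S * ‖z‖)) := by
          have : -(S * ‖z‖) = -((S + R) * ‖z‖) + R * ‖z‖ := by ring
          rw [this, Real.exp_add]; ring

lemma tilt (hw : IsWeight w) (p : E d) : IsWeight (fun z => w z * Real.exp (inner ℝ p z)) :=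
  hw.mul_of_le (by fun_prop) (C := 1) (R := ‖p‖) fun z => by
    rw [Real.abs_exp, one_mul]
    exact Real.exp_le_exp.2 (real_inner_le_norm p z)

lemma coord (hw : IsWeight w) (i : Fin d) : IsWeight (fun z => w z * z i) :=
  hw.mul_of_le (by fun_prop) (C := 1) (R := 1) fun z => by
    have h1 : |z i| ≤ ‖z‖ := by simpa using PiLp.norm_apply_le z i
    have h2 := Real.add_one_le_exp ‖z‖
    rw [one_mul, one_mul]
    linarith

lemma mul_norm_pow_exp (hw : IsWeight w) (n : ℕ) (R : ℝ) :
    IsWeight (fun z => w z * (‖z‖ ^ n * Real.exp (R * ‖z‖))) :=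
  hw.mul_of_le (by fun_prop) (C := n.factorial) (R := 1 + R) fun z => by
    rw [abs_of_nonneg (by positivity)]
    have h := Real.pow_div_factorial_le_exp ‖z‖ (norm_nonneg _) n
    rw [div_le_iff₀ (by positivity)] at h
    rw [add_mul, Real.exp_add, one_mul]
    calc _ ≤ (Real.exp ‖z‖ * n.factorial) * Real.exp (R * ‖z‖) := by gcongr
      _ = _ := by ring

lemma neg_arg (hw : IsWeight w) : IsWeight (fun z => w (-z)) where
  continuous := hw.continuous.comp continuous_neg
  decay R := by
    obtain ⟨C, hC⟩ := hw.decay R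
    exact ⟨C, fun z => by simpa using hC (-z)⟩

end IsWeight

lemma IsDispersalKernel.isWeight {J : E d → ℝ} (hJ : IsDispersalKernel J) : IsWeight J where
  continuous := hJ.continuous
  decay R := by
    obtain ⟨C, β, hC, hβ, h⟩ := hJ.decay
    obtain ⟨N, hN⟩ : ∃ N : ℝ, ∀ t : ℝ, 0 ≤ t → R * t - t ^ (1 + β) ≤ N := by
      -- The threshold is `t = S ^ β⁻¹`. Below it `S * t` is at most the claimed bound; above it `t
      -- ^ β ≥ S`, so `t ^ (1 + β)` dominates the linear term.
      set S := max R 1 with hS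
      have hS1 : 1 ≤ S := le_max_right _ _
      refine ⟨S * S ^ β⁻¹, fun t ht => ?_⟩
      have hRS : R * t ≤ S * t := by gcongr; exact le_max_left _ _
      rcases ht.eq_or_lt with rfl | ht0
      · rw [Real.zero_rpow (by linarith)]
        have : 0 ≤ S * S ^ β⁻¹ := by positivity
        linarith
      have hpow : t ^ (1 + β) = t * t ^ β := by
        rw [Real.rpow_add ht0, Real.rpow_one]
      rcases le_total t (S ^ β⁻¹) with hle | hge
      · have h1 : S * t ≤ S * S ^ β⁻¹ := by gcongr
        have h2 : 0 ≤ t ^ (1 + β) := by positivity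
        linarith
      · have h1 : S ≤ t ^ β := by
          calc S = (S ^ β⁻¹) ^ β := by
                rw [← Real.rpow_mul (by linarith), inv_mul_cancel₀ hβ.ne', Real.rpow_one]
            _ ≤ t ^ β := by gcongr
        have h2 : t * S ≤ t * t ^ β := by gcongr
        have h3 : 0 ≤ S * S ^ β⁻¹ := by positivity
        rw [hpow]
        nlinarith
    refine ⟨C * Real.exp N, fun z => ?_⟩
    rw [abs_of_nonneg (hJ.nonneg z), mul_assoc, ← Real.exp_add]
    refine (h z).trans ?_
    gcongr
    have := hN ‖z‖ (norm_nonneg z)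
    linarith

lemma IsDispersalKernel.neg_arg {J : E d → ℝ} (hJ : IsDispersalKernel J) :
    IsDispersalKernel (fun z => J (-z)) where
  continuous := hJ.continuous.comp continuous_neg
  pos_zero := by simpa using hJ.pos_zero
  nonneg z := hJ.nonneg (-z)
  decay := by
    obtain ⟨C, β, hC, hβ, h⟩ := hJ.decay
    exact ⟨C, β, hC, hβ, fun z => by simpa using h (-z)⟩

/-! ### Convolution-type operators on the torus -/

section ConvOp

variable {κ : E d → E d → ℝ} {W : E d → ℝ}

lemma norm_convOp_integrand_le (hκ : IsPositiveCoefficient κ) {M : ℝ} (hM : ∀ ξ η, κ ξ η ≤ M)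
    (V : E d → ℝ) (φ : CT d) (ξ z : E d) :
    ‖V z * κ ξ (ξ - z) * φ (ξ - z)‖ ≤ M * ‖φ‖ * ‖V z‖ := by
  rw [norm_mul, norm_mul, Real.norm_of_nonneg (hκ.pos _ _).le]
  have h1 : ‖φ (ξ - z)‖ ≤ ‖φ‖ := φ.abs_apply_le _
  have h2 := hM ξ (ξ - z)
  have h3 := (hκ.pos ξ (ξ - z)).le
  have h4 : 0 ≤ M := h3.trans h2
  calc ‖V z‖ * κ ξ (ξ - z) * ‖φ (ξ - z)‖ ≤ ‖V z‖ * M * ‖φ‖ := by gcongr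
    _ = M * ‖φ‖ * ‖V z‖ := by ring

lemma integrable_convOp (hκ : IsPositiveCoefficient κ) (hW : IsWeight W) (φ : CT d)
    (ξ : E d) : Integrable (fun z => W z * κ ξ (ξ - z) * φ (ξ - z)) := by
  obtain ⟨M, hM0, hM⟩ := hκ.exists_le
  have hc : Continuous fun z => κ ξ (ξ - z) :=
    hκ.continuous.comp (continuous_const.prodMk (by fun_prop))
  have hc2 : Continuous fun z => φ (ξ - z) :=
    φ.continuous.comp (by fun_prop)
  refine (hW.integrable.norm.const_mul (M * ‖φ‖)).mono'
    ((hW.continuous.mul hc).mul hc2).aestronglyMeasurable (Eventually.of_forall fun z => norm_convOp_integrand_le hκ hM W φ ξ z)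

lemma continuous_convFun (hκ : IsPositiveCoefficient κ) (hW : IsWeight W) (φ : CT d) :
    Continuous (fun ξ => ∫ z, W z * κ ξ (ξ - z) * φ (ξ - z)) := by
  obtain ⟨M, hM0, hM⟩ := hκ.exists_le
  refine continuous_of_dominated (fun ξ => (integrable_convOp hκ hW φ ξ).aestronglyMeasurable)
    (bound := fun z => M * ‖φ‖ * ‖W z‖) (fun ξ => Eventually.of_forall fun z => ?_)
    (hW.integrable.norm.const_mul _) (Eventually.of_forall fun z => ?_)
  · exact norm_convOp_integrand_le hκ hM W φ ξ z
  · have hc : Continuous fun ξ => κ ξ (ξ - z) :=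
      hκ.continuous.comp (continuous_id.prodMk (by fun_prop))
    have hc2 : Continuous fun ξ => φ (ξ - z) :=
      φ.continuous.comp (by fun_prop)
    exact (continuous_const.mul hc).mul hc2

lemma isPeriodic_convFun (hκ : IsPositiveCoefficient κ) (W : E d → ℝ) (φ : CT d) :
    IsPeriodic (fun ξ => ∫ z, W z * κ ξ (ξ - z) * φ (ξ - z)) := by
  intro k ξ
  refine integral_congr_ae (Eventually.of_forall fun z => ?_)
  have h1 : ξ + WithLp.toLp 2 (fun i => (k i : ℝ)) - z
      = (ξ - z) + WithLp.toLp 2 (fun i => (k i : ℝ)) := by abel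
  have h2 := hκ.periodic_right (ξ + WithLp.toLp 2 (fun i => (k i : ℝ))) k (ξ - z)
  have h3 := hκ.periodic_left (ξ - z) k ξ
  have h4 := φ.periodic k (ξ - z)
  simp only at h3 h4 ⊢
  rw [h1, h4, h2, h3]

/-- The function `ξ ↦ ∫ W(z) κ(ξ, ξ-z) φ(ξ-z) dz` on the torus. -/
def convFun (hκ : IsPositiveCoefficient κ) (hW : IsWeight W) (φ : CT d) : CT d :=
  CT.mk _ (continuous_convFun hκ hW φ) (isPeriodic_convFun hκ W φ)

/-- The operator `φ ↦ ∫ W(z) κ(ξ, ξ-z) φ(ξ-z) dz` on `C(𝕋^d)`. -/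
def convOp (hκ : IsPositiveCoefficient κ) (hW : IsWeight W) : CT d →L[ℝ] CT d :=
  LinearMap.mkContinuousOfExistsBound
    { toFun := convFun hκ hW
      map_add' := fun φ ψ => CT.ext fun ξ => by
        simp only [convFun, CT.mk_apply, CT.add_apply, mul_add]
        exact integral_add (integrable_convOp hκ hW φ ξ) (integrable_convOp hκ hW ψ ξ)
      map_smul' := fun c φ => CT.ext fun ξ => by
        change (∫ z, W z * κ ξ (ξ - z) * (c * φ (ξ - z)))
          = c * ∫ z, W z * κ ξ (ξ - z) * φ (ξ - z)
        rw [← integral_const_mul]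
        congr 1
        ext z
        ring }
    (by
      obtain ⟨M, hM0, hM⟩ := hκ.exists_le
      refine ⟨M * ∫ z, ‖W z‖, fun φ => CT.norm_le (by positivity) fun ξ => ?_⟩
      change |∫ z, W z * κ ξ (ξ - z) * φ (ξ - z)| ≤ _
      rw [← Real.norm_eq_abs]
      refine (norm_integral_le_integral_norm _).trans ?_
      have : M * (∫ z, ‖W z‖) * ‖φ‖ = ∫ z, M * ‖φ‖ * ‖W z‖ := by
        rw [integral_const_mul]; ring
      rw [this]
      refine integral_mono (integrable_convOp hκ hW φ ξ).norm
        (hW.integrable.norm.const_mul _) fun z => ?_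
      exact norm_convOp_integrand_le hκ hM W φ ξ z)

lemma convOp_apply (hκ : IsPositiveCoefficient κ) (hW : IsWeight W) (φ : CT d)
    (ξ : E d) : convOp hκ hW φ ξ = ∫ z, W z * κ ξ (ξ - z) * φ (ξ - z) := rfl

lemma convOp_apply' (hκ : IsPositiveCoefficient κ) (hW : IsWeight W) (φ : CT d)
    (ξ : E d) : convOp hκ hW φ ξ = ∫ η, W (ξ - η) * κ ξ η * φ η := by
  rw [convOp_apply, ← integral_sub_left_eq_self _ volume ξ]
  simp

/-- Formulated for any operator with a convolution formula and a merely integrable kernel, so that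
it applies to the Taylor remainder of `tiltOp` without making that kernel a weight. -/
lemma norm_convOp_le (hκ : IsPositiveCoefficient κ) {M : ℝ} (hM0 : 0 ≤ M)
    (hM : ∀ ξ η, κ ξ η ≤ M) (T : CT d →L[ℝ] CT d) (V : E d → ℝ)
    (hV : Integrable V)
    (hT : ∀ φ ξ, T φ ξ = ∫ z, V z * κ ξ (ξ - z) * φ (ξ - z)) :
    ‖T‖ ≤ M * ∫ z, |V z| := by
  refine T.opNorm_le_bound (by positivity) fun φ => CT.norm_le (by positivity) fun ξ => ?_
  rw [hT, ← Real.norm_eq_abs]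
  have : M * (∫ z, |V z|) * ‖φ‖ = ∫ z, M * ‖φ‖ * |V z| := by
    rw [integral_const_mul]; ring
  rw [this]
  refine norm_integral_le_of_norm_le (hV.norm.const_mul _) (Eventually.of_forall fun z => ?_)
  exact norm_convOp_integrand_le hκ hM V φ ξ z

end ConvOp

/-! ### Dependence on the tilt -/

section Tilt

variable {κ : E d → E d → ℝ} {w : E d → ℝ}

/-- The operator with kernel `w(ξ-η) e^{p·(ξ-η)} κ(ξ,η)`. -/
def tiltOp (hκ : IsPositiveCoefficient κ) (hw : IsWeight w) (p : E d) :
    CT d →L[ℝ] CT d :=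
  convOp hκ (hw.tilt p)

/-- The derivative of `tiltOp` in the tilt. -/
def tiltOpDeriv (hκ : IsPositiveCoefficient κ) (hw : IsWeight w) (p : E d) :
    E d →L[ℝ] CT d →L[ℝ] CT d :=
  ∑ i, (EuclideanSpace.proj i : E d →L[ℝ] ℝ).smulRight (tiltOp hκ (hw.coord i) p)

lemma abs_exp_sub_one_sub_le (s : ℝ) : |Real.exp s - 1 - s| ≤ |s| ^ 2 * Real.exp |s| := by
  have h := Complex.norm_exp_sub_sum_le_norm_mul_exp (s : ℂ) 2
  simp only [Finset.sum_range_succ, Finset.sum_range_zero, Nat.factorial] at h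
  norm_num at h
  rw [← Complex.ofReal_exp, ← Complex.ofReal_one, ← Complex.ofReal_add, ← Complex.ofReal_sub,
    Complex.norm_real, Real.norm_eq_abs] at h
  rw [sq_abs, sub_sub]
  exact h

/-- The remainder of the operator is again of convolution type, with the scalar exponential's Taylor
remainder in its kernel; its norm can then be read off from an `L¹` bound. -/
lemma tiltOp_taylor (hκ : IsPositiveCoefficient κ) (hw : IsWeight w) (p q : E d)
    (φ : CT d) (ξ : E d) :
    (tiltOp hκ hw (p + q) - tiltOp hκ hw p - tiltOpDeriv hκ hw p q) φ ξ
      = ∫ z, (w z * Real.exp (inner ℝ p z) * (Real.exp (inner ℝ q z) - 1 - inner ℝ q z))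
          * κ ξ (ξ - z) * φ (ξ - z) := by
  have hsum : (tiltOpDeriv hκ hw p q) φ ξ
      = ∫ z, ∑ i, q i * ((w z * z i * Real.exp (inner ℝ p z)) * κ ξ (ξ - z)
          * φ (ξ - z)) := by
    rw [integral_finsetSum]
    · simp only [tiltOpDeriv, sum_apply,
        ContinuousLinearMap.smulRight_apply, CT.sum_apply,
        smul_apply, CT.smul_apply,
        integral_const_mul]
      rfl
    · exact fun i _ => (integrable_convOp hκ ((hw.coord i).tilt p) φ ξ).const_mul _
  have i1 := integrable_convOp hκ (hw.tilt (p + q)) φ ξ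
  have i2 := integrable_convOp hκ (hw.tilt p) φ ξ
  have i3 : Integrable fun z => ∑ i, q i * ((w z * z i * Real.exp (inner ℝ p z)) * κ ξ (ξ - z)
          * φ (ξ - z)) :=
    integrable_finsetSum _ fun i _ =>
      (integrable_convOp hκ ((hw.coord i).tilt p) φ ξ).const_mul _
  change tiltOp hκ hw (p + q) φ ξ - tiltOp hκ hw p φ ξ
    - (tiltOpDeriv hκ hw p q) φ ξ = _
  rw [hsum, tiltOp, tiltOp, convOp_apply, convOp_apply, ← integral_sub i1 i2,
    ← integral_sub (by exact i1.sub i2) i3]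
  congr 1
  ext z
  have hin : inner ℝ q z = ∑ i, q i * z i := by
    simp [PiLp.inner_apply, mul_comm]
  have : ∑ i, q i * ((w z * z i * Real.exp (inner ℝ p z)) * κ ξ (ξ - z) * φ (ξ - z))
      = w z * Real.exp (inner ℝ p z) * inner ℝ q z * κ ξ (ξ - z) * φ (ξ - z) := by
    rw [hin, Finset.mul_sum, Finset.sum_mul, Finset.sum_mul]
    exact Finset.sum_congr rfl fun i _ => by ring
  simp only
  rw [this, inner_add_left, Real.exp_add]
  ring

/-- For `‖q‖ ≤ 1` the remainder kernel is at most `‖q‖²` times `|w(z)| ‖z‖² e^((‖p‖+1)‖z‖)`, which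
is integrable by the superexponential decay. The remainder is thus quadratic in operator norm. -/
lemma hasFDerivAt_tiltOp (hκ : IsPositiveCoefficient κ) (hw : IsWeight w) (p : E d) :
    HasFDerivAt (tiltOp hκ hw) (tiltOpDeriv hκ hw p) p := by
  rw [hasFDerivAt_iff_isLittleO_nhds_zero]
  obtain ⟨M, hM0, hM⟩ := hκ.exists_le
  have hw2 := hw.mul_norm_pow_exp 2 (‖p‖ + 1)
  have hO : (fun q => tiltOp hκ hw (p + q) - tiltOp hκ hw p - tiltOpDeriv hκ hw p q)
      =O[𝓝 0] fun q => ‖q‖ ^ 2 := by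
    refine Asymptotics.IsBigO.of_bound
      (M * ∫ z, |w z * (‖z‖ ^ 2 * Real.exp ((‖p‖ + 1) * ‖z‖))|) ?_
    filter_upwards [Metric.ball_mem_nhds (0 : E d) one_pos] with q hq
    have hq1 : ‖q‖ ≤ 1 := by simpa using (Metric.mem_ball.1 hq).le
    have hV : ∀ z, |w z * Real.exp (inner ℝ p z) * (Real.exp (inner ℝ q z) - 1 - inner ℝ q z)|
        ≤ ‖q‖ ^ 2 * |w z * (‖z‖ ^ 2 * Real.exp ((‖p‖ + 1) * ‖z‖))| := by
      intro z
      have h1 := abs_exp_sub_one_sub_le (inner ℝ q z)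
      have h2 : |inner ℝ q z| ≤ ‖q‖ * ‖z‖ := abs_real_inner_le_norm q z
      have h3 : |inner ℝ q z| ≤ ‖z‖ := h2.trans (mul_le_of_le_one_left (norm_nonneg _) hq1)
      have h4 : inner ℝ p z ≤ ‖p‖ * ‖z‖ := real_inner_le_norm p z
      rw [abs_mul, abs_mul, abs_mul, Real.abs_exp, abs_of_nonneg (a := ‖z‖ ^ 2 * _)
        (by positivity), add_mul, one_mul, Real.exp_add]
      calc |w z| * Real.exp (inner ℝ p z) * |Real.exp (inner ℝ q z) - 1 - inner ℝ q z|
          ≤ |w z| * Real.exp (‖p‖ * ‖z‖) * ((‖q‖ * ‖z‖) ^ 2 * Real.exp ‖z‖) := by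
            gcongr
            refine h1.trans ?_
            gcongr
        _ = _ := by ring
    have hInt : Integrable fun z =>
        w z * Real.exp (inner ℝ p z) * (Real.exp (inner ℝ q z) - 1 - inner ℝ q z) := by
      refine (hw2.integrable.norm.const_mul (‖q‖ ^ 2)).mono' ?_ (Eventually.of_forall hV)
      have := hw.continuous
      exact Continuous.aestronglyMeasurable (by fun_prop)
    refine (norm_convOp_le hκ hM0.le hM _ _ hInt
      (fun φ ξ => tiltOp_taylor hκ hw p q φ ξ)).trans ?_
    rw [norm_pow, norm_norm, mul_assoc, mul_comm (∫ z, _) (‖q‖ ^ 2)]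
    refine mul_le_mul_of_nonneg_left ?_ hM0.le
    rw [← integral_const_mul]
    exact integral_mono hInt.abs (hw2.integrable.abs.const_mul _) hV
  refine hO.trans_isLittleO ?_
  exact Asymptotics.isLittleO_norm_pow_id one_lt_two

/-- The derivative is built from the operators of the weights `w(z) z_i`, so the induction on the
order must run over all weights at once. -/
lemma contDiff_tiltOp_nat (hκ : IsPositiveCoefficient κ) (n : ℕ) :
    ∀ {w : E d → ℝ} (hw : IsWeight w), ContDiff ℝ n (tiltOp hκ hw) := by
  induction n with
  | zero =>
    intro w hw
    simp only [Nat.cast_zero]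
    rw [contDiff_zero]
    exact continuous_iff_continuousAt.2 fun p => (hasFDerivAt_tiltOp hκ hw p).continuousAt
  | succ n ih =>
    intro w hw
    push_cast
    rw [contDiff_succ_iff_hasFDerivAt]
    refine ⟨tiltOpDeriv hκ hw, ?_, fun p => hasFDerivAt_tiltOp hκ hw p⟩
    unfold tiltOpDeriv
    refine ContDiff.sum fun i _ => ?_
    exact contDiff_const.smulRight (ih (hw.coord i))

lemma fderiv_tiltOp_single (hκ : IsPositiveCoefficient κ) (hw : IsWeight w) (p : E d)
    (i : Fin d) :
    fderiv ℝ (tiltOp hκ hw) p (EuclideanSpace.single i 1) = tiltOp hκ (hw.coord i) p := by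
  rw [(hasFDerivAt_tiltOp hκ hw p).fderiv, tiltOpDeriv, sum_apply,
    Finset.sum_eq_single i]
  · simp
  · intro j _ hj
    simp [hj]
  · simp

end Tilt

/-! ### Compactness -/

/-- A norm-continuous family of functionals on a compact space defines a compact operator. -/
lemma isCompactOperator_of_continuous_family {X F : Type*} [TopologicalSpace X] [CompactSpace X]
    [NormedAddCommGroup F] [NormedSpace ℝ F] (T : F →L[ℝ] BoundedContinuousFunction X ℝ) (N : X → F →L[ℝ] ℝ)
    (hN : Continuous N) (hT : ∀ f x, T f x = N x f) : IsCompactOperator T := by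
  refine (isCompactOperator_iff_image_closedBall_subset_compact
    (T : F →ₗ[ℝ] BoundedContinuousFunction X ℝ) one_pos).2 ?_
  refine ⟨closure (T '' Metric.closedBall 0 1), ?_, subset_closure⟩
  -- The image of the unit ball is bounded by `‖T‖`, and equicontinuous because `N` is continuous in
  -- operator norm.
  refine BoundedContinuousFunction.arzela_ascoli (Set.Icc (-‖T‖) ‖T‖) isCompact_Icc _ ?_ ?_
  · rintro _ x ⟨f, hf, rfl⟩
    have h1 : |T f x| ≤ ‖T‖ := by
      have h2 := (T f).norm_coe_le_norm x
      have h3 := T.le_opNorm f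
      have h4 : ‖f‖ ≤ 1 := by simpa using hf
      rw [Real.norm_eq_abs] at h2
      nlinarith [norm_nonneg T]
    exact abs_le.1 h1
  · intro x
    rw [Metric.equicontinuousAt_iff_right]
    intro ε hε
    filter_upwards [Metric.continuousAt_iff'.1 (hN.continuousAt (x := x)) ε hε] with y hy
    rintro ⟨_, ⟨f, hf, rfl⟩⟩
    change dist (T f x) (T f y) < ε
    rw [hT, hT, Real.dist_eq, ← sub_apply, ← Real.norm_eq_abs]
    have h4 : ‖f‖ ≤ 1 := by simpa using hf
    rw [dist_comm, dist_eq_norm] at hy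
    calc ‖(N x - N y) f‖ ≤ ‖N x - N y‖ * ‖f‖ := (N x - N y).le_opNorm f
      _ ≤ ‖N x - N y‖ * 1 := by gcongr
      _ < ε := by rwa [mul_one]

/-- The functional `φ ↦ (convOp φ)(ξ)` has the kernel `W(ξ-η) κ(ξ,η)`, which varies continuously in
`L¹(dη)` with `ξ` by dominated convergence. Norm-continuity of this family, checked upstairs on
`ℝ^d` and passed to the quotient, gives compactness. -/
lemma isCompactOperator_convOp {κ : E d → E d → ℝ} {W : E d → ℝ} (hκ : IsPositiveCoefficient κ)
    (hW : IsWeight W) : IsCompactOperator (convOp hκ hW) := by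
  let N : Torus d → CT d →L[ℝ] ℝ :=
    fun t => (BoundedContinuousFunction.evalCLM ℝ t).comp
      ((CT.toBCF (d := d)).toContinuousLinearEquiv.toContinuousLinearMap.comp (convOp hκ hW))
  suffices h : Continuous (N ∘ toTorus) by
    have h1 := isCompactOperator_of_continuous_family
      ((CT.toBCF (d := d)).toContinuousLinearEquiv.toContinuousLinearMap.comp (convOp hκ hW)) N
      (isQuotientMap_quotient_mk'.continuous_iff.2 h) fun f x => rfl
    exact h1.continuous_comp (CT.toBCF (d := d)).symm.continuous
  refine continuous_iff_continuousAt.2 fun ξ => ?_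
  obtain ⟨M, hM0, hM⟩ := hκ.exists_le
  obtain ⟨C, hC0, hC⟩ := hW.exists_bound 1
  -- A majorant common to all `ξ'` within distance `1`: moving the centre by at most `1` costs a
  -- factor `e`.
  have hbd : ∀ ξ' : E d, ‖ξ' - ξ‖ ≤ 1 → ∀ η, |W (ξ' - η) * κ ξ' η|
      ≤ C * Real.exp 1 * M * Real.exp (-‖ξ - η‖) := by
    intro ξ' hξ' η
    rw [abs_mul, abs_of_pos (hκ.pos _ _)]
    have h1 : ‖ξ - η‖ ≤ ‖ξ' - η‖ + 1 := by
      have : ξ - η = (ξ' - η) - (ξ' - ξ) := by abel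
      rw [this]
      exact (norm_sub_le _ _).trans (by linarith)
    calc |W (ξ' - η)| * κ ξ' η ≤ (C * Real.exp (-(1 * ‖ξ' - η‖))) * M := by
          have h2 := (hκ.pos ξ' η).le
          gcongr
          · exact hC _
          · exact hM _ _
      _ ≤ (C * (Real.exp 1 * Real.exp (-‖ξ - η‖))) * M := by
          rw [← Real.exp_add]
          gcongr
          linarith
      _ = _ := by ring
  have hI : Integrable fun η => C * Real.exp 1 * M * Real.exp (-‖ξ - η‖) :=
    (integrable_exp_neg_norm.comp_sub_left ξ).const_mul _
  have hcont : ∀ ξ' : E d, Continuous fun η => W (ξ' - η) * κ ξ' η := fun ξ' =>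
    (hW.continuous.comp (by fun_prop)).mul
      (hκ.continuous.comp (continuous_const.prodMk continuous_id))
  have hcont' : ∀ η : E d, Continuous fun ξ' => W (ξ' - η) * κ ξ' η := fun η =>
    (hW.continuous.comp (by fun_prop)).mul
      (hκ.continuous.comp (continuous_id.prodMk continuous_const))
  have hlim : Tendsto (fun ξ' => ∫ η, |W (ξ' - η) * κ ξ' η - W (ξ - η) * κ ξ η|) (𝓝 ξ)
      (𝓝 (∫ η : E d, (0 : ℝ))) := by
    refine tendsto_integral_filter_of_dominated_convergence
      (fun η => 2 * (C * Real.exp 1 * M * Real.exp (-‖ξ - η‖))) ?_ ?_ (hI.const_mul 2) ?_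
    · exact Eventually.of_forall fun ξ' => ((hcont ξ').sub (hcont ξ)).abs.aestronglyMeasurable
    · filter_upwards [Metric.ball_mem_nhds ξ one_pos] with ξ' hξ'
      refine Eventually.of_forall fun η => ?_
      rw [Real.norm_eq_abs, abs_abs]
      have h1 := hbd ξ' (by rw [← dist_eq_norm]; exact (Metric.mem_ball.1 hξ').le) η
      have h2 := hbd ξ (by simp) η
      exact (abs_sub _ _).trans (by linarith)
    · refine Eventually.of_forall fun η => ?_
      have := ((hcont' η).sub (continuous_const (y := W (ξ - η) * κ ξ η))).abs.tendsto ξ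
      simpa using this
  rw [integral_zero] at hlim
  rw [ContinuousAt, tendsto_iff_norm_sub_tendsto_zero]
  refine squeeze_zero' (Eventually.of_forall fun _ => norm_nonneg _) ?_ hlim
  filter_upwards [Metric.ball_mem_nhds ξ one_pos] with ξ' hξ'
  refine ContinuousLinearMap.opNorm_le_bound _ (by positivity) fun φ => ?_
  change ‖convOp hκ hW φ ξ' - convOp hκ hW φ ξ‖ ≤ _
  have hInt : ∀ ξ' : E d, ‖ξ' - ξ‖ ≤ 1 → Integrable fun η => W (ξ' - η) * κ ξ' η := fun ξ' h =>
    hI.mono' (hcont ξ').aestronglyMeasurable (Eventually.of_forall fun η => hbd ξ' h η)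
  have hφ : Continuous fun η => φ η := φ.continuous
  have hint2 : ∀ ξ' : E d, ‖ξ' - ξ‖ ≤ 1 →
      Integrable fun η => W (ξ' - η) * κ ξ' η * φ η := fun ξ' h =>
    (hInt ξ' h).mul_bdd (c := ‖φ‖) hφ.aestronglyMeasurable
      (Eventually.of_forall fun η => φ.abs_apply_le _)
  have h1 : ‖ξ' - ξ‖ ≤ 1 := by rw [← dist_eq_norm]; exact (Metric.mem_ball.1 hξ').le
  rw [convOp_apply', convOp_apply', ← integral_sub (hint2 ξ' h1) (hint2 ξ (by simp)),
    ← integral_mul_const]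
  refine norm_integral_le_of_norm_le (((hInt ξ' h1).sub (hInt ξ (by simp))).abs.mul_const _)
    (Eventually.of_forall fun η => ?_)
  rw [← sub_mul, norm_mul, Real.norm_eq_abs]
  gcongr
  exact φ.abs_apply_le _

/-! ### Constants, inverses and touching points in `C(𝕋^d)` -/

namespace CT

/-- The constant function `1`. -/
def one : CT d := mk (fun _ => 1) continuous_const (fun _ _ => rfl)

@[simp] lemma one_apply (x : E d) : (one : CT d) x = 1 := rfl

lemma isPeriodic_inv (c : CT d) : IsPeriodic (fun x => (c x)⁻¹) := fun k x => by
  have h := c.periodic k x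
  simp only at h ⊢
  rw [h]

/-- The inverse of a positive function. -/
def inv (c : CT d) (hc : ∀ x, 0 < c x) : CT d :=
  mk (fun x => (c x)⁻¹) (c.continuous.inv₀ fun x => (hc x).ne') c.isPeriodic_inv

@[simp] lemma inv_apply (c : CT d) (hc : ∀ x, 0 < c x) (x : E d) : inv c hc x = (c x)⁻¹ := rfl

lemma exists_pos_le (c : CT d) (hc : ∀ x, 0 < c x) : ∃ m, 0 < m ∧ ∀ x, m ≤ c x := by
  obtain ⟨x, hx⟩ := c.exists_forall_le
  exact ⟨c x, hc x, hx⟩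

/-- The largest multiple of `ψ > 0` below `φ` touches `φ`. -/
lemma exists_touching (φ ψ : CT d) (hψ : ∀ x, 0 < ψ x) :
    ∃ t x₀, (∀ x, t * ψ x ≤ φ x) ∧ t * ψ x₀ = φ x₀ := by
  obtain ⟨x₀, h⟩ := (mul φ (inv ψ hψ)).exists_forall_le
  refine ⟨φ x₀ * (ψ x₀)⁻¹, x₀, fun x => ?_, ?_⟩
  · have h1 := h x
    simp only [mul_apply, inv_apply] at h1
    have h2 := mul_le_mul_of_nonneg_right h1 (hψ x).le
    rwa [inv_mul_cancel_right₀ (hψ x).ne'] at h2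
  · rw [inv_mul_cancel_right₀ (hψ x₀).ne']

end CT

/-! ### Positive compact operators -/

/-- A positive compact operator whose kernel is positive near the diagonal. -/
structure IsPosOp (T : CT d →L[ℝ] CT d) : Prop where
  nonneg : ∀ φ : CT d, (∀ x, 0 ≤ φ x) → ∀ x, 0 ≤ T φ x
  compact : IsCompactOperator T
  spread : ∃ r, 0 < r ∧ ∀ φ : CT d, (∀ x, 0 ≤ φ x) → ∀ x, T φ x = 0 →
    ∀ y ∈ Metric.ball x r, φ y = 0

/-- The admissible values in the definition of the principal eigenvalue of `-T + a`. -/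
def admissible (T : CT d →L[ℝ] CT d) (a : CT d) : Set ℝ :=
  {l | ∃ φ : CT d, (∀ x, 0 < φ x) ∧ ∀ x, T φ x ≤ (a x - l) * φ x}

namespace IsPosOp

variable {T : CT d →L[ℝ] CT d} {a : CT d}

lemma mono (hT : IsPosOp T) {φ ψ : CT d} (h : ∀ x, φ x ≤ ψ x) (x : E d) : T φ x ≤ T ψ x := by
  have := hT.nonneg (ψ - φ) (fun y => by simpa using h y) x
  rw [map_sub, CT.sub_apply] at this
  linarith

/-- Strong maximum principle. -/
lemma eq_zero_of_touch (hT : IsPosOp T) {u : CT d} (hu : ∀ x, 0 ≤ u x)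
    (h : ∀ x, u x = 0 → T u x = 0) {x₀ : E d} (h0 : u x₀ = 0) : u = 0 := by
  obtain ⟨r, hr, hs⟩ := hT.spread
  -- The zero set is closed by continuity and open by the spreading property; connectedness of `ℝ^d`
  -- makes it everything once it is nonempty.
  have hclopen : IsClopen {x | u x = 0} := by
    refine ⟨isClosed_eq u.continuous continuous_const, ?_⟩
    rw [Metric.isOpen_iff]
    intro x hx
    exact ⟨r, hr, fun y hy => hs u hu x (h x hx) y hy⟩
  have huniv := hclopen.eq_univ ⟨x₀, h0⟩
  refine CT.ext fun x => ?_
  have : x ∈ {x | u x = 0} := by rw [huniv]; trivial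
  exact this

/-- Positivity alone forces this: `0 ≤ Tφ ≤ (a - l)φ` with `φ > 0`. -/
lemma le_of_mem_admissible (hT : IsPosOp T) {l : ℝ} (hl : l ∈ admissible T a) (x : E d) :
    l ≤ a x := by
  obtain ⟨φ, hφ, h⟩ := hl
  have h1 := (hT.nonneg φ (fun y => (hφ y).le) x).trans (h x)
  by_contra hlt
  have : (a x - l) * φ x < 0 := mul_neg_of_neg_of_pos (by linarith) (hφ x)
  linarith

lemma bddAbove_admissible (hT : IsPosOp T) : BddAbove (admissible T a) :=
  ⟨a 0, fun _ hl => hT.le_of_mem_admissible hl 0⟩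

lemma nonempty_admissible (T : CT d →L[ℝ] CT d) (a : CT d) : (admissible T a).Nonempty := by
  refine ⟨-(‖a‖ + ‖T CT.one‖), CT.one, fun x => by simp, fun x => ?_⟩
  have h1 := (T CT.one).abs_apply_le x
  have h2 := a.abs_apply_le x
  simp only [CT.one_apply, mul_one]
  have := neg_abs_le (a x)
  have := le_abs_self (T CT.one x)
  linarith

end IsPosOp

/-- Fredholm alternative for `c - R`, `c` a positive function and `R` compact. -/
lemma bijective_mul_sub {R : CT d →L[ℝ] CT d} (hR : IsCompactOperator R) (c : CT d)
    (hc : ∀ x, 0 < c x) (hinj : ∀ ψ : CT d, (∀ x, c x * ψ x = R ψ x) → ψ = 0) :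
    Function.Bijective (CT.mul c - R) := by
  -- Factor `c - R = c (1 - c⁻¹R)`: the second factor is a compact perturbation of the identity, the
  -- first is invertible.
  set B : CT d →L[ℝ] CT d := (CT.mul (CT.inv c hc)).comp R with hB
  have hBc : IsCompactOperator B := hR.clm_comp (CT.mul (CT.inv c hc))
  have hres : (1 : ℝ) ∈ resolventSet ℝ B := by
    refine (hBc.hasEigenvalue_or_mem_resolventSet one_ne_zero).resolve_left fun hev => ?_
    obtain ⟨ψ, hψ⟩ := hev.exists_hasEigenvector
    refine hψ.2 (hinj ψ fun x => ?_)
    have h1 : B ψ = ψ := by simpa using hψ.apply_eq_smul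
    have h2 : (c x)⁻¹ * R ψ x = ψ x := congrArg (fun g : CT d => g x) h1
    rw [← h2, mul_inv_cancel_left₀ (hc x).ne']
  have hbij : Function.Bijective (1 - B : CT d →L[ℝ] CT d) := by
    rw [← ContinuousLinearMap.isUnit_iff_bijective]
    simpa [resolventSet] using hres
  have hmul : Function.Bijective (CT.mul c) := by
    refine Function.bijective_iff_has_inverse.2 ⟨CT.mul (CT.inv c hc), fun ψ => ?_, fun ψ => ?_⟩
    · exact CT.ext fun x => by simp [inv_mul_cancel_left₀ (hc x).ne']
    · exact CT.ext fun x => by simp [mul_inv_cancel_left₀ (hc x).ne']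
  have heq : (CT.mul c - R : CT d →L[ℝ] CT d) = (CT.mul c).comp (1 - B) := by
    refine ContinuousLinearMap.ext fun ψ => CT.ext fun x => ?_
    simp [hB, mul_inv_cancel_left₀ (hc x).ne']
  rw [heq]
  exact hmul.comp hbij

namespace IsPosOp

variable {T : CT d →L[ℝ] CT d} {a : CT d}

/-- An admissible `φ` at a level above `lam` is a strict supersolution of `a - lam - T`. It gives a
comparison principle, hence injectivity, hence bijectivity by the Fredholm alternative, and
positivity of the solution. -/
lemma exists_resolvent_one (hT : IsPosOp T) {lam l : ℝ} (hl : l ∈ admissible T a)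
    (hlam : lam < l) :
    ∃ u : CT d, (∀ x, 0 < u x) ∧ ∀ x, (a x - lam) * u x - T u x = 1 := by
  have hc : ∀ x, 0 < (a - lam • CT.one : CT d) x := fun x => by
    have := hT.le_of_mem_admissible hl x
    simp only [CT.sub_apply, CT.smul_apply, CT.one_apply, mul_one]
    linarith
  obtain ⟨φ, hφ, hφl⟩ := hl
  have hstrict : ∀ x, 0 < (a x - lam) * φ x - T φ x := fun x => by
    have := mul_pos (sub_pos.2 hlam) (hφ x)
    linarith [hφl x]
  -- a function with `(c - T) ψ ≥ 0` is nonnegative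
  have hpos : ∀ ψ : CT d, (∀ x, 0 ≤ (a x - lam) * ψ x - T ψ x) → ∀ x, 0 ≤ ψ x := by
    intro ψ hψ
    -- If `t < 0`, then at the touching point `(a - lam - T)ψ ≤ t (a - lam - T)φ < 0`, a
    -- contradiction.
    obtain ⟨t, x₀, ht, h0⟩ := CT.exists_touching ψ φ hφ
    have ht0 : 0 ≤ t := by
      by_contra hneg
      have hneg : t < 0 := not_le.1 hneg
      have h1 := hT.mono (φ := t • φ) (ψ := ψ) (fun x => by simpa using ht x) x₀
      rw [map_smul, CT.smul_apply] at h1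
      have h2 := hψ x₀
      rw [← h0] at h2
      have h3 := mul_neg_of_neg_of_pos hneg (hstrict x₀)
      nlinarith
    exact fun x => (mul_nonneg ht0 (hφ x).le).trans (ht x)
  have hb := bijective_mul_sub hT.compact (a - lam • CT.one) hc fun ψ hψ => by
    have h1 : ∀ x, (a x - lam) * ψ x = T ψ x := fun x => by simpa using hψ x
    refine CT.ext fun x => le_antisymm ?_ (hpos ψ (fun x => by rw [h1, sub_self]) x)
    have h2 := hpos (-ψ) (fun x => by
      rw [map_neg, CT.neg_apply, CT.neg_apply]
      linarith [h1 x]) x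
    simpa using h2
  obtain ⟨u, hu⟩ := hb.2 CT.one
  have hu' : ∀ x, (a x - lam) * u x - T u x = 1 := fun x => by
    have : (a x - lam * 1) * u x - T u x = 1 := congrArg (fun g : CT d => g x) hu
    rwa [mul_one] at this
  have hu0 := hpos u fun x => by rw [hu' x]; exact zero_le_one
  refine ⟨u, fun x => ?_, hu'⟩
  have h1 := hT.nonneg u hu0 x
  have h2 := hu' x
  have h3 : 0 < (a x - lam) * u x := by linarith
  exact (pos_iff_pos_of_mul_pos h3).1 (by simpa using hc x)

/-- Existence of a principal eigenfunction below `min a`. -/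
lemma exists_eigenfunction (hT : IsPosOp T) (hH : ∀ x, sSup (admissible T a) < a x) :
    ∃ φ : CT d, (∀ x, 0 < φ x) ∧ ∀ x, T φ x = (a x - sSup (admissible T a)) * φ x := by
  set H := sSup (admissible T a) with hHdef
  have hstep : ∀ n : ℕ, ∃ u : CT d, (∀ x, 0 < u x) ∧
      (∀ x, (a x - (H - 1 / ((n : ℝ) + 1))) * u x - T u x = 1) ∧ (n : ℝ) + 1 ≤ ‖u‖ := by
    intro n
    have hn : (0 : ℝ) < 1 / ((n : ℝ) + 1) := by positivity
    obtain ⟨l, hl, hlt⟩ := exists_lt_of_lt_csSup (nonempty_admissible T a)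
      (show H - 1 / ((n : ℝ) + 1) < sSup (admissible T a) by rw [← hHdef]; linarith)
    obtain ⟨u, hu0, hu⟩ := hT.exists_resolvent_one hl hlt
    refine ⟨u, hu0, hu, ?_⟩
    have hnorm : 0 < ‖u‖ := (abs_pos.2 (hu0 0).ne').trans_le (u.abs_apply_le 0)
    -- Since `1 ≥ u/‖u‖`, the right-hand side `1` lets the level rise by `1/‖u‖`. The level cannot
    -- exceed the supremum `H`, so `‖u‖ ≥ n + 1`.
    have hmem : H - 1 / ((n : ℝ) + 1) + 1 / ‖u‖ ∈ admissible T a := by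
      refine ⟨u, hu0, fun x => ?_⟩
      have h1 : 1 / ‖u‖ * u x ≤ 1 := by
        rw [one_div, inv_mul_le_one₀ hnorm]
        exact (le_abs_self _).trans (u.abs_apply_le x)
      have h2 := hu x
      nlinarith
    have h1 := le_csSup hT.bddAbove_admissible hmem
    rw [← hHdef] at h1
    have h2 : 1 / ‖u‖ ≤ 1 / ((n : ℝ) + 1) := by linarith
    exact (one_div_le_one_div hnorm (by positivity)).1 h2
  choose u hu0 hu hun using hstep
  have hnorm : ∀ n, 0 < ‖u n‖ := fun n => lt_of_lt_of_le (by positivity) (hun n)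
  set w : ℕ → CT d := fun n => ‖u n‖⁻¹ • u n with hw
  have hw1 : ∀ n, ‖w n‖ = 1 := fun n => by
    rw [hw]; simp only [norm_smul, norm_inv, norm_norm]
    exact inv_mul_cancel₀ (hnorm n).ne'
  have hcompact := hT.compact.isCompact_closure_image_closedBall (f := (T : CT d →ₗ[ℝ] CT d)) 1
  obtain ⟨g, -, s, hs, hsg⟩ := hcompact.tendsto_subseq (x := fun n => T (w n)) fun n =>
    subset_closure ⟨w n, by simp [hw1], rfl⟩
  have hc : ∀ x, 0 < (a - H • CT.one : CT d) x := fun x => by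
    simpa using hH x
  -- Compactness makes `T (w n)` converge along a subsequence; `w n` itself is recovered by dividing
  -- by `a - H`, which is where `H < a` is essential.
  have hweq : ∀ n, w n = CT.mul (CT.inv _ hc)
      (T (w n) + ‖u n‖⁻¹ • CT.one - (1 / ((n : ℝ) + 1)) • w n) := by
    intro n
    refine CT.ext fun x => ?_
    have h1 := hu n x
    have h2 : (a x - H) * w n x = T (w n) x + ‖u n‖⁻¹ - 1 / ((n : ℝ) + 1) * w n x := by
      simp only [hw, map_smul, CT.smul_apply]
      linear_combination ‖u n‖⁻¹ * h1
    have h3 : a x - H ≠ 0 := by simpa using (hc x).ne'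
    simp only [CT.mul_apply, CT.inv_apply, CT.sub_apply, CT.add_apply, CT.smul_apply,
      CT.one_apply, mul_one]
    rw [← h2, inv_mul_cancel_left₀ h3]
  have hlim : Tendsto (fun n => w (s n)) atTop (𝓝 (CT.mul (CT.inv _ hc) g)) := by
    have hdiv : Tendsto (fun n : ℕ => 1 / ((n : ℝ) + 1)) atTop (𝓝 0) :=
      tendsto_one_div_add_atTop_nhds_zero_nat
    have h1 : Tendsto (fun n => ‖u n‖⁻¹ • (CT.one : CT d)) atTop (𝓝 0) := by
      have : Tendsto (fun n => ‖u n‖⁻¹) atTop (𝓝 0) := by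
        refine squeeze_zero (fun n => by positivity) (fun n => ?_) hdiv
        rw [one_div]
        exact inv_anti₀ (by positivity) (hun n)
      simpa using this.smul_const (CT.one : CT d)
    have h2 : Tendsto (fun n : ℕ => (1 / ((n : ℝ) + 1)) • w n) atTop (𝓝 0) := by
      rw [tendsto_zero_iff_norm_tendsto_zero]
      refine hdiv.congr fun n => ?_
      rw [norm_smul, hw1, mul_one, Real.norm_of_nonneg (by positivity)]
    have h3 := (hsg.add (h1.comp hs.tendsto_atTop)).sub (h2.comp hs.tendsto_atTop)
    rw [add_zero, sub_zero] at h3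
    have h4 := ((CT.mul (CT.inv _ hc)).continuous.tendsto g).comp h3
    refine h4.congr fun n => ?_
    exact (hweq (s n)).symm
  set φ := CT.mul (CT.inv _ hc) g with hφ
  have hTφ : T φ = g := tendsto_nhds_unique ((T.continuous.tendsto φ).comp hlim) hsg
  have heq : ∀ x, T φ x = (a x - H) * φ x := by
    intro x
    have h3 : a x - H ≠ 0 := by simpa using (hc x).ne'
    rw [hTφ, hφ]
    simp only [CT.mul_apply, CT.inv_apply, CT.sub_apply, CT.smul_apply, CT.one_apply, mul_one]
    rw [mul_inv_cancel_left₀ h3]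
  have hφ0 : ∀ x, 0 ≤ φ x := fun x => by
    refine ge_of_tendsto' (((CT.eval x).continuous.tendsto φ).comp hlim) fun n => ?_
    simp only [Function.comp_apply, CT.eval_apply, hw, CT.smul_apply]
    exact mul_nonneg (by positivity) (hu0 _ x).le
  have hφ1 : ‖φ‖ = 1 := tendsto_nhds_unique hlim.norm (by simp [hw1])
  refine ⟨φ, fun x => lt_of_le_of_ne (hφ0 x) fun h0 => ?_, heq⟩
  -- A single zero would make `φ` vanish identically, against `‖φ‖ = 1`.
  have := hT.eq_zero_of_touch hφ0 (fun y hy => by rw [heq, hy, mul_zero]) h0.symm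
  rw [this, norm_zero] at hφ1
  exact zero_ne_one hφ1

/-- Simplicity of the principal eigenvalue. -/
lemma eq_smul_of_sub_eq_smul (hT : IsPosOp T) {φ ψ : CT d} {lam μ : ℝ} (hφ : ∀ x, 0 < φ x)
    (h : ∀ x, T φ x = (a x - lam) * φ x)
    (hψ : ∀ x, (a x - lam) * ψ x - T ψ x = μ * φ x) : μ = 0 ∧ ∃ t : ℝ, ψ = t • φ := by
  -- after a change of sign `μ ≥ 0`
  have key : ∀ (ψ : CT d) (μ : ℝ), 0 ≤ μ → (∀ x, (a x - lam) * ψ x - T ψ x = μ * φ x) →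
      μ = 0 ∧ ∃ t : ℝ, ψ = t • φ := by
    intro ψ μ hμ hψ
    -- Subtract the largest multiple of `φ` below `ψ`. Where the difference `v` vanishes, `0 ≤ Tv =
    -- -μφ` forces `μ = 0`, and then the strong maximum principle gives `v = 0`.
    obtain ⟨t, x₀, ht, h0⟩ := CT.exists_touching ψ φ hφ
    set v := ψ - t • φ with hv
    have hv0 : ∀ x, 0 ≤ v x := fun x => by simpa [hv] using ht x
    have hTv : ∀ x, T v x = (a x - lam) * v x - μ * φ x := fun x => by
      rw [hv, map_sub, map_smul]
      simp only [CT.sub_apply, CT.smul_apply, h x]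
      linear_combination -(hψ x)
    have hvx : v x₀ = 0 := by simp [hv, h0]
    have hμ0 : μ = 0 := by
      have h1 := hT.nonneg v hv0 x₀
      rw [hTv, hvx] at h1
      have h2 := hφ x₀
      nlinarith
    refine ⟨hμ0, t, ?_⟩
    have := hT.eq_zero_of_touch hv0 (fun x hx => by rw [hTv, hx, hμ0]; ring) hvx
    exact sub_eq_zero.1 this
  rcases le_total 0 μ with hμ | hμ
  · exact key ψ μ hμ hψ
  · obtain ⟨h1, t, ht⟩ := key (-ψ) (-μ) (by linarith) fun x => by
      rw [map_neg, CT.neg_apply, CT.neg_apply]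
      linarith [hψ x]
    exact ⟨by linarith, -t, by rw [neg_smul, ← ht, neg_neg]⟩

end IsPosOp

/-! ### Smooth dependence of the principal eigenpair -/

/-- The equation for the normalized eigenfunction; the eigenvalue is eliminated by evaluation
at `0`. -/
def eigenEq (T : E d → CT d →L[ℝ] CT d) (a : CT d) (q : E d × CT d) : CT d :=
  CT.mul (a - a 0 • CT.one) q.2 + (CT.eval 0 (T q.1 q.2)) • q.2 - T q.1 q.2

/-- Implicit function theorem for `eigenEq`. Its derivative in the function variable is `c` minus a
compact operator, so invertibility reduces to injectivity, which is simplicity of the eigenvalue. -/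
lemma exists_eigen_branch {T : E d → CT d →L[ℝ] CT d} {a : CT d} (hTd : ContDiff ℝ 2 T)
    (hT : ∀ p, IsPosOp (T p)) {p₀ : E d} {φ₀ : CT d} {lam : ℝ} (hφ₀ : ∀ x, 0 < φ₀ x)
    (h1 : φ₀ 0 = 1) (hlam : ∀ x, lam < a x) (h : ∀ x, T p₀ φ₀ x = (a x - lam) * φ₀ x) :
    ∃ Φ : E d → CT d, ContDiffAt ℝ 2 Φ p₀ ∧ Φ p₀ = φ₀ ∧
      ∀ᶠ p in 𝓝 p₀, (∀ x, 0 < Φ p x) ∧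
        ∀ x, T p (Φ p) x = (a x - (a 0 - T p (Φ p) 0)) * Φ p x := by
  have hG : ContDiff ℝ 2 (eigenEq T a) := by
    unfold eigenEq
    have hT1 : ContDiff ℝ 2 fun q : E d × CT d => T q.1 q.2 :=
      (hTd.comp contDiff_fst).clm_apply contDiff_snd
    exact (((CT.mul (a - a 0 • CT.one)).contDiff.comp contDiff_snd).add
      (((CT.eval 0).contDiff.comp hT1).smul contDiff_snd)).sub hT1
  set D := fderiv ℝ (eigenEq T a) (p₀, φ₀) with hD
  have hGd : HasFDerivAt (eigenEq T a) D (p₀, φ₀) :=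
    (hG.differentiable (by norm_num) _).hasFDerivAt
  set c : CT d := a - lam • CT.one with hc
  have hT0 : T p₀ φ₀ 0 = a 0 - lam := by rw [h, h1, mul_one]
  -- The rank-one term comes from differentiating the eigenvalue, expressed as `a 0 - T p φ 0`; it
  -- removes the kernel spanned by `φ₀` and keeps `R` compact.
  set R : CT d →L[ℝ] CT d := T p₀ - ((CT.eval 0).comp (T p₀)).smulRight φ₀ with hR
  have hDR : ∀ ψ, D (0, ψ) = (CT.mul c - R) ψ := by
    intro ψ
    have hA : HasFDerivAt (fun φ : CT d => eigenEq T a (p₀, φ)) (CT.mul c - R) φ₀ := by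
      have e1 := (CT.mul (a - a 0 • CT.one)).hasFDerivAt (x := φ₀)
      have e2 := ((CT.eval 0).comp (T p₀)).hasFDerivAt (x := φ₀)
      have e3 := e2.smul (hasFDerivAt_id φ₀)
      have e4 := (T p₀).hasFDerivAt (x := φ₀)
      refine ((e1.add e3).sub e4).congr_fderiv ?_
      refine ContinuousLinearMap.ext fun ψ => CT.ext fun x => ?_
      simp [hR, hc, hT0]
      ring
    have hB : HasFDerivAt (fun φ : CT d => eigenEq T a (p₀, φ))
        (D.comp (ContinuousLinearMap.inr ℝ (E d) (CT d))) φ₀ :=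
      hGd.comp φ₀ (hasFDerivAt_prodMk_right p₀ φ₀)
    have := hB.unique hA
    rw [← this]; rfl
  have hbij : Function.Bijective (CT.mul c - R) := by
    refine bijective_mul_sub ?_ c (fun x => by simpa [hc] using hlam x) fun ψ hψ => ?_
    · have : R = (ContinuousLinearMap.id ℝ (CT d) - (CT.eval 0).smulRight φ₀).comp (T p₀) := by
        refine ContinuousLinearMap.ext fun ψ => CT.ext fun x => ?_
        simp [hR]
      rw [this]
      exact (hT p₀).compact.clm_comp
        (ContinuousLinearMap.id ℝ (CT d) - (CT.eval 0).smulRight φ₀)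
    -- A kernel element satisfies `(c - T)ψ = -(Tψ)(0) φ₀`. Hence `(Tψ)(0) = 0` and `ψ = tφ₀`; as
    -- `(Tφ₀)(0) = a 0 - lam > 0`, also `t = 0`.
    · obtain ⟨hμ, t, rfl⟩ := (hT p₀).eq_smul_of_sub_eq_smul (μ := -(T p₀ ψ 0)) (ψ := ψ) hφ₀ h
        fun x => by
          have := hψ x
          simp only [hc, hR, CT.sub_apply, CT.smul_apply, CT.one_apply, mul_one, sub_apply,
            ContinuousLinearMap.smulRight_apply, ContinuousLinearMap.comp_apply,
            CT.eval_apply] at this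
          rw [this]; ring
      have ht : t = 0 := by
        rw [map_smul, CT.smul_apply, hT0] at hμ
        have h3 : 0 < a 0 - lam := sub_pos.2 (hlam 0)
        have h4 : t * (a 0 - lam) = 0 := by linarith
        exact (mul_eq_zero.1 h4).resolve_right h3.ne'
      rw [ht, zero_smul]
  -- The parameter is carried along as a first component, which turns the implicit problem into one
  -- for the inverse function theorem.
  let f' : E d × CT d →L[ℝ] E d × CT d := (ContinuousLinearMap.fst ℝ (E d) (CT d)).prod D
  have hDadd : ∀ q ψ, D (q, ψ) = D (q, 0) + D (0, ψ) := fun q ψ => by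
    rw [← map_add]; simp
  have hker : f'.ker = ⊥ := by
    refine (LinearMap.ker_eq_bot' (f := (f' : E d × CT d →ₗ[ℝ] E d × CT d))).2 ?_
    intro ⟨q, ψ⟩ hq
    have hq1 : q = 0 := congrArg Prod.fst hq
    have hq2 : D (q, ψ) = 0 := congrArg Prod.snd hq
    subst hq1
    rw [hDR] at hq2
    have : ψ = 0 := hbij.1 (by rw [hq2, map_zero])
    rw [this]; rfl
  have hran : f'.range = ⊤ := by
    refine (LinearMap.range_eq_top (f := (f' : E d × CT d →ₗ[ℝ] E d × CT d))).2 ?_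
    rintro ⟨q, g⟩
    obtain ⟨ψ, hψ⟩ := hbij.2 (g - D (q, 0))
    refine ⟨(q, ψ), Prod.ext rfl ?_⟩
    change D (q, ψ) = g
    rw [hDadd, hDR, hψ]; abel
  let e := ContinuousLinearEquiv.ofBijective f' hker hran
  let Θ : E d × CT d → E d × CT d := fun q => (q.1, eigenEq T a q)
  have hΘ : ContDiffAt ℝ 2 Θ (p₀, φ₀) := (contDiff_fst.prodMk hG).contDiffAt
  have hΘd : HasFDerivAt Θ (e : E d × CT d →L[ℝ] E d × CT d) (p₀, φ₀) := by
    have : (e : E d × CT d →L[ℝ] E d × CT d) = f' := by ext <;> rfl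
    rw [this]
    exact hasFDerivAt_fst.prodMk hGd
  have hΘ0 : Θ (p₀, φ₀) = (p₀, 0) := by
    refine Prod.ext rfl (CT.ext fun x => ?_)
    simp only [Θ, eigenEq, CT.sub_apply, CT.add_apply, CT.mul_apply, CT.smul_apply, CT.one_apply,
      CT.eval_apply, hT0, h x, CT.zero_apply]
    ring
  have h2 : (2 : WithTop ℕ∞) ≠ 0 := by norm_num
  set ι := hΘ.localInverse hΘd h2 with hι
  have hιd : ContDiffAt ℝ 2 ι (p₀, 0) := hΘ0 ▸ hΘ.to_localInverse hΘd h2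
  have hι0 : ι (p₀, 0) = (p₀, φ₀) := hΘ0 ▸ hΘ.localInverse_apply_image hΘd h2
  have hιr : ∀ᶠ y in 𝓝 ((p₀, 0) : E d × CT d), Θ (ι y) = y :=
    hΘ0 ▸ (hΘ.hasStrictFDerivAt' hΘd h2).eventually_right_inverse
  have hpair : ContDiffAt ℝ 2 (fun p : E d => ((p, 0) : E d × CT d)) p₀ :=
    contDiffAt_id.prodMk contDiffAt_const
  have hΦ : ContDiffAt ℝ 2 (fun p => (ι (p, 0)).2) p₀ :=
    contDiffAt_snd.comp p₀ (ContDiffAt.comp p₀ hιd hpair)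
  refine ⟨fun p => (ι (p, 0)).2, hΦ, by simp only [hι0], ?_⟩
  -- Positivity persists as long as the uniform distance to `φ₀` stays below its minimum.
  obtain ⟨m, hm, hmle⟩ := φ₀.exists_pos_le hφ₀
  have hclose : ∀ᶠ p in 𝓝 p₀, ‖(ι (p, 0)).2 - φ₀‖ < m := by
    have := Metric.continuousAt_iff'.1 hΦ.continuousAt m hm
    simp only [hι0] at this
    filter_upwards [this] with p hp
    rwa [← dist_eq_norm]
  filter_upwards [hclose, hpair.continuousAt.eventually hιr] with p hp hr
  constructor
  · intro x
    have h3 := ((ι (p, 0)).2 - φ₀).abs_apply_le x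
    rw [CT.sub_apply] at h3
    have h4 := neg_abs_le ((ι (p, 0)).2 x - φ₀ x)
    have h5 := hmle x
    linarith
  · intro x
    have h3 : (ι (p, 0)).1 = p := congrArg Prod.fst hr
    have h4 : eigenEq T a (ι (p, 0)) = 0 := congrArg Prod.snd hr
    have h5 := congrArg (fun g : CT d => g x) h4
    simp only [eigenEq, CT.sub_apply, CT.add_apply, CT.mul_apply, CT.smul_apply, CT.one_apply,
      CT.eval_apply, CT.zero_apply, h3] at h5
    linarith

/-! ### The cell problem -/

section Cell

variable {J : E d → ℝ} {κ : E d → E d → ℝ}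

lemma isPosOp_tiltOp (hκ : IsPositiveCoefficient κ) (hJ : IsDispersalKernel J) (p : E d) :
    IsPosOp (tiltOp hκ hJ.isWeight p) where
  nonneg φ hφ x := by
    rw [tiltOp, convOp_apply]
    refine integral_nonneg fun z => ?_
    have h1 := hJ.nonneg z
    have h2 := (hκ.pos x (x - z)).le
    have h3 := hφ (x - z)
    positivity
  compact := isCompactOperator_convOp hκ _
  spread := by
    -- The spreading radius is one on which `J > 0`. A vanishing integral of a nonnegative
    -- continuous function makes the integrand zero everywhere, in particular at `z = x - y`.
    obtain ⟨r, hr, h⟩ := Metric.eventually_nhds_iff_ball.1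
      (hJ.continuous.continuousAt.eventually (lt_mem_nhds hJ.pos_zero))
    refine ⟨r, hr, fun φ hφ x hx y hy => ?_⟩
    rw [tiltOp, convOp_apply] at hx
    have hnn : 0 ≤ fun z => J z * Real.exp (inner ℝ p z) * κ x (x - z) * φ (x - z) := fun z => by
      have h1 := hJ.nonneg z
      have h2 := (hκ.pos x (x - z)).le
      have h3 := hφ (x - z)
      simp only [Pi.zero_apply]
      positivity
    have hae := (integral_eq_zero_iff_of_nonneg hnn
      (integrable_convOp hκ (hJ.isWeight.tilt p) φ x)).1 hx
    have hc : Continuous fun z => J z * Real.exp (inner ℝ p z) * κ x (x - z) * φ (x - z) :=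
      ((hJ.isWeight.tilt p).continuous.mul
        (hκ.continuous.comp (continuous_const.prodMk (continuous_const.sub continuous_id)))).mul
        (φ.continuous.comp (continuous_const.sub continuous_id))
    have h0 := congrFun ((hc.ae_eq_iff_eq volume continuous_zero).1 hae) (x - y)
    simp only [sub_sub_cancel, Pi.zero_apply] at h0
    have hy' : x - y ∈ Metric.ball (0 : E d) r := by
      rw [mem_ball_zero_iff, ← dist_eq_norm, dist_comm]; exact hy
    have h1 : J (x - y) * Real.exp (inner ℝ p (x - y)) * κ x y ≠ 0 :=
      mul_ne_zero (mul_ne_zero (h _ hy').ne' (Real.exp_pos _).ne') (hκ.pos _ _).ne'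
    exact (mul_eq_zero.1 h0).resolve_left h1

lemma cellOp_eq (hκ : IsPositiveCoefficient κ) (hJ : IsDispersalKernel J) (a : E d → ℝ)
    (p : E d) (φ : CT d) (ξ : E d) :
    cellOp J κ a p φ ξ = -(tiltOp hκ hJ.isWeight p φ ξ) + a ξ * φ ξ := by
  rw [cellOp, tiltOp, convOp_apply']

/-- A positive function of `C(𝕋^d)` as an element of the Banach space. -/
def IsPositiveTorusFun.toCT {φ : E d → ℝ} (hφ : IsPositiveTorusFun φ) : CT d :=
  CT.mk φ hφ.continuous hφ.periodic

@[simp] lemma IsPositiveTorusFun.coe_toCT {φ : E d → ℝ} (hφ : IsPositiveTorusFun φ) :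
    ⇑hφ.toCT = φ := rfl

lemma CT.isPositiveTorusFun {φ : CT d} (hφ : ∀ x, 0 < φ x) : IsPositiveTorusFun φ :=
  ⟨φ.continuous, φ.periodic, hφ⟩

lemma hamiltonian_eq (hκ : IsPositiveCoefficient κ) (hJ : IsDispersalKernel J) (a : CT d)
    (p : E d) : hamiltonian J κ a p = sSup (admissible (tiltOp hκ hJ.isWeight p) a) := by
  unfold hamiltonian
  congr 1
  ext l
  constructor
  · rintro ⟨φ, hφ, h⟩
    refine ⟨hφ.toCT, hφ.pos, fun x => ?_⟩
    have h1 := h x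
    rw [← hφ.coe_toCT, cellOp_eq hκ hJ] at h1
    linarith
  · rintro ⟨φ, hφ, h⟩
    refine ⟨φ, CT.isPositiveTorusFun hφ, fun x => ?_⟩
    rw [cellOp_eq hκ hJ]
    linarith [h x]

lemma isPrincipalEigenfunction_iff (hκ : IsPositiveCoefficient κ) (hJ : IsDispersalKernel J)
    (a : CT d) (p : E d) (φ : CT d) :
    IsPrincipalEigenfunction J κ a p φ ↔ (∀ x, 0 < φ x) ∧
      ∀ x, tiltOp hκ hJ.isWeight p φ x = (a x - hamiltonian J κ a p) * φ x := by
  constructor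
  · rintro ⟨h1, h2⟩
    refine ⟨h1.pos, fun x => ?_⟩
    have := h2 x
    rw [cellOp_eq hκ hJ] at this
    linarith
  · rintro ⟨h1, h2⟩
    refine ⟨CT.isPositiveTorusFun h1, fun x => ?_⟩
    rw [cellOp_eq hκ hJ, h2 x]
    ring

end Cell

/-! ### Integration over the unit cell -/

/-- The half-open unit cell. -/
def unitCell (d : ℕ) : Set (E d) :=
  ZSpan.fundamentalDomain (EuclideanSpace.basisFun (Fin d) ℝ).toBasis

lemma isAddFundamentalDomain_unitCell : IsAddFundamentalDomain
    (Submodule.span ℤ (Set.range (EuclideanSpace.basisFun (Fin d) ℝ).toBasis)).toAddSubgroup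
    (unitCell d) (volume : Measure (E d)) :=
  ZSpan.isAddFundamentalDomain' _ _

instance : Countable (Submodule.span ℤ
    (Set.range (EuclideanSpace.basisFun (Fin d) ℝ).toBasis)).toAddSubgroup :=
  inferInstanceAs (Countable (Submodule.span ℤ
    (Set.range (EuclideanSpace.basisFun (Fin d) ℝ).toBasis)))

lemma isBounded_unitCell : Bornology.IsBounded (unitCell d) :=
  ZSpan.fundamentalDomain_isBounded _

instance : IsFiniteMeasure (volume.restrict (unitCell d)) :=
  ⟨by rw [Measure.restrict_apply_univ]; exact isBounded_unitCell.measure_lt_top⟩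

lemma volume_unitCell_ne_zero : volume (unitCell d) ≠ 0 :=
  ZSpan.measure_fundamentalDomain_ne_zero _

open scoped Pointwise in
-- The translated cell is another fundamental domain of the lattice, and a periodic function has the
-- same integral over any two of them.
lemma integral_unitCell_add_right {f : E d → ℝ} (hf : IsPeriodic f) (z : E d) :
    ∫ x in unitCell d, f (x + z) = ∫ x in unitCell d, f x := by
  have h1 : ∫ x in unitCell d, f (x + z) = ∫ x in z +ᵥ unitCell d, f x := by
    rw [← (measurePreserving_add_right volume z).setIntegral_preimage_emb
      (measurableEmbedding_addRight z) f (z +ᵥ unitCell d)]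
    congr 2
    ext x
    simp only [Set.mem_preimage, Set.mem_vadd_set_iff_neg_vadd_mem, vadd_eq_add]
    rw [show -z + (x + z) = x by abel]
  rw [h1]
  refine (isAddFundamentalDomain_unitCell.vadd_of_comm z).setIntegral_eq
    isAddFundamentalDomain_unitCell ?_
  rintro ⟨g, hg⟩ x
  obtain ⟨k, hk⟩ := (Submodule.mem_span_range_iff_exists_fun ℤ).1 hg
  have h2 : ∑ i, k i • (EuclideanSpace.basisFun (Fin d) ℝ).toBasis i
      = WithLp.toLp 2 (fun i => (k i : ℝ)) := by
    ext j
    simp [Finset.sum_apply, Pi.single_apply]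
  change f (g + x) = f x
  rw [← hk, h2, add_comm, hf]

lemma CT.integrableOn_unitCell (f : CT d) : IntegrableOn (fun x => f x) (unitCell d) :=
  (integrable_const ‖f‖).mono' f.continuous.aestronglyMeasurable
    (Eventually.of_forall fun x => f.abs_apply_le x)

/-- The integral of a function on the torus over the unit cell. -/
def cellMean (f : CT d) : ℝ := ∫ x in unitCell d, f x

lemma cellMean_pos {f : CT d} (hf : ∀ x, 0 < f x) : 0 < cellMean f := by
  rw [cellMean, setIntegral_pos_iff_support_of_nonneg_ae
    (Eventually.of_forall fun x => (hf x).le) f.integrableOn_unitCell]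
  have : Function.support (fun x => f x) = Set.univ := by
    ext x; simp [(hf x).ne']
  rw [this, Set.univ_inter]
  exact pos_iff_ne_zero.2 volume_unitCell_ne_zero

/-- Fubini and the substitution `ξ ↦ ξ + z`, allowed on the cell by periodicity for each fixed `z`,
identify the adjoint: the arguments of `κ` are exchanged and the weight is reflected. -/
lemma cellMean_mul_convOp {κ : E d → E d → ℝ} {W : E d → ℝ} (hκ : IsPositiveCoefficient κ)
    (hW : IsWeight W) (φ ψ : CT d) :
    cellMean (CT.mul ψ (convOp hκ hW φ)) = cellMean (CT.mul (convOp hκ.swap hW.neg_arg ψ) φ) := by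
  obtain ⟨M, hM0, hM⟩ := hκ.exists_le
  have hb : ∀ ξ η z : E d, |W z * κ ξ η| ≤ M * |W z| := fun ξ η z => by
    rw [abs_mul, abs_of_pos (hκ.pos _ _), mul_comm]
    have := hM ξ η
    gcongr
  have hφc := φ.continuous
  have hψc := ψ.continuous
  have hWc := hW.continuous
  have hbb : ∀ ξ η x y z : E d, ‖W z * κ ξ η * (φ x * ψ y)‖ ≤ M * ‖φ‖ * ‖ψ‖ * |W z| := by
    intro ξ η x y z
    rw [norm_mul, norm_mul (φ x), Real.norm_eq_abs, Real.norm_eq_abs, Real.norm_eq_abs]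
    calc |W z * κ ξ η| * (|φ x| * |ψ y|) ≤ (M * |W z|) * (‖φ‖ * ‖ψ‖) := by
          gcongr
          · exact hb _ _ _
          · exact φ.abs_apply_le _
          · exact ψ.abs_apply_le _
      _ = _ := by ring
  have hdom : Integrable (fun q : E d × E d => M * ‖φ‖ * ‖ψ‖ * |W q.2|)
      ((volume.restrict (unitCell d)).prod volume) :=
    (hW.integrable.abs.comp_snd _).const_mul _
  have hi1 : Integrable (Function.uncurry fun ξ z : E d =>
      W z * κ ξ (ξ - z) * (φ (ξ - z) * ψ ξ)) ((volume.restrict (unitCell d)).prod volume) := by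
    refine hdom.mono' (Continuous.aestronglyMeasurable ?_)
      (Eventually.of_forall fun q => hbb _ _ _ _ _)
    exact ((hWc.comp continuous_snd).mul (hκ.continuous.comp
      (continuous_fst.prodMk (continuous_fst.sub continuous_snd)))).mul
      ((hφc.comp (continuous_fst.sub continuous_snd)).mul (hψc.comp continuous_fst))
  have hi2 : Integrable (Function.uncurry fun ξ z : E d =>
      W z * κ (ξ + z) ξ * (φ ξ * ψ (ξ + z))) ((volume.restrict (unitCell d)).prod volume) := by
    refine hdom.mono' (Continuous.aestronglyMeasurable ?_)
      (Eventually.of_forall fun q => hbb _ _ _ _ _)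
    exact ((hWc.comp continuous_snd).mul (hκ.continuous.comp
      ((continuous_fst.add continuous_snd).prodMk continuous_fst))).mul
      ((hφc.comp continuous_fst).mul (hψc.comp (continuous_fst.add continuous_snd)))
  calc cellMean (CT.mul ψ (convOp hκ hW φ))
      = ∫ ξ in unitCell d, ∫ z, W z * κ ξ (ξ - z) * (φ (ξ - z) * ψ ξ) := by
        unfold cellMean
        congr 1
        ext ξ
        rw [CT.mul_apply, convOp_apply, ← integral_const_mul]
        congr 1
        ext z
        ring
    _ = ∫ z, ∫ ξ in unitCell d, W z * κ ξ (ξ - z) * (φ (ξ - z) * ψ ξ) :=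
        integral_integral_swap hi1
    _ = ∫ z, ∫ ξ in unitCell d, W z * κ (ξ + z) ξ * (φ ξ * ψ (ξ + z)) := by
        congr 1
        ext z
        rw [← integral_unitCell_add_right (z := z)]
        · simp only [add_sub_cancel_right]
        · intro k ξ
          have h1 : ξ + WithLp.toLp 2 (fun i => (k i : ℝ)) - z
              = (ξ - z) + WithLp.toLp 2 (fun i => (k i : ℝ)) := by abel
          have h2 := hκ.periodic_right (ξ + WithLp.toLp 2 (fun i => (k i : ℝ))) k (ξ - z)
          have h3 := hκ.periodic_left (ξ - z) k ξ
          have h4 := φ.periodic k (ξ - z)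
          have h5 := ψ.periodic k ξ
          simp only at h3 h4 h5 ⊢
          rw [h1, h2, h3, h4, h5]
    _ = ∫ ξ in unitCell d, ∫ z, W z * κ (ξ + z) ξ * (φ ξ * ψ (ξ + z)) :=
        (integral_integral_swap hi2).symm
    _ = cellMean (CT.mul (convOp hκ.swap hW.neg_arg ψ) φ) := by
        unfold cellMean
        congr 1
        ext ξ
        rw [CT.mul_apply, convOp_apply, ← integral_mul_const, ← integral_neg_eq_self]
        congr 1
        ext z
        rw [sub_eq_add_neg]
        ring

/-! ### Duality -/

section Dual

variable {J : E d → ℝ} {κ : E d → E d → ℝ}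

/-- The adjoint of `tiltOp` at the tilt `-q`. -/
def adjOp (hκ : IsPositiveCoefficient κ) (hJ : IsDispersalKernel J) (q : E d) :
    CT d →L[ℝ] CT d :=
  tiltOp hκ.swap hJ.neg_arg.isWeight q

lemma cellMean_adjOp (hκ : IsPositiveCoefficient κ) (hJ : IsDispersalKernel J) (p : E d)
    (φ ψ : CT d) :
    cellMean (CT.mul ψ (tiltOp hκ hJ.isWeight p φ)) = cellMean (CT.mul (adjOp hκ hJ (-p) ψ) φ) := by
  rw [tiltOp, cellMean_mul_convOp]
  congr 3
  refine CT.ext fun ξ => ?_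
  rw [adjOp, tiltOp, convOp_apply, convOp_apply]
  simp

/-- Comparison of the spectral values of an operator and of its adjoint. -/
lemma le_of_dual {T S : CT d →L[ℝ] CT d} {a φ ψ : CT d} {lam l : ℝ}
    (hTS : cellMean (CT.mul ψ (T φ)) = cellMean (CT.mul (S ψ) φ))
    (hφ : ∀ x, 0 < φ x) (hψ : ∀ x, 0 < ψ x)
    (h1 : ∀ x, (a x - lam) * φ x ≤ T φ x) (h2 : ∀ x, S ψ x ≤ (a x - l) * ψ x) : l ≤ lam := by
  by_contra hlt
  have hlt : lam < l := not_le.1 hlt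
  -- The integrand is at least `(l - lam) φψ > 0`, while duality makes its mean zero.
  have h3 : cellMean (CT.mul ψ (T φ) - CT.mul (S ψ) φ) = 0 := by
    have : cellMean (CT.mul ψ (T φ) - CT.mul (S ψ) φ)
        = cellMean (CT.mul ψ (T φ)) - cellMean (CT.mul (S ψ) φ) :=
      integral_sub (CT.integrableOn_unitCell _) (CT.integrableOn_unitCell _)
    rw [this, hTS, sub_self]
  have h4 : 0 < cellMean (CT.mul ψ (T φ) - CT.mul (S ψ) φ) := by
    refine cellMean_pos fun x => ?_
    simp only [CT.sub_apply, CT.mul_apply]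
    have e1 := mul_le_mul_of_nonneg_left (h1 x) (hψ x).le
    have e2 := mul_le_mul_of_nonneg_right (h2 x) (hφ x).le
    have e3 := mul_pos (mul_pos (sub_pos.2 hlt) (hφ x)) (hψ x)
    nlinarith
  linarith

/-- A positive eigenfunction of the adjoint operator below `min a` identifies the Hamiltonian. -/
lemma hamiltonian_eq_of_adjoint (hκ : IsPositiveCoefficient κ) (hJ : IsDispersalKernel J)
    {a : CT d} {p : E d} {ψ : CT d} {lam : ℝ} (hlam : ∀ x, lam < a x) (hψ : ∀ x, 0 < ψ x)
    (h : ∀ x, adjOp hκ hJ (-p) ψ x = (a x - lam) * ψ x) : hamiltonian J κ a p = lam := by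
  have hT := isPosOp_tiltOp hκ hJ p
  rw [hamiltonian_eq hκ hJ]
  have hle : sSup (admissible (tiltOp hκ hJ.isWeight p) a) ≤ lam := by
    refine csSup_le (IsPosOp.nonempty_admissible _ _) ?_
    rintro l ⟨φ, hφ, hl⟩
    refine le_of_dual (T := adjOp hκ hJ (-p)) (S := tiltOp hκ hJ.isWeight p) (φ := ψ) (ψ := φ)
      ?_ hψ hφ (fun x => (h x).ge) hl
    have h1 := cellMean_adjOp hκ hJ p φ ψ
    have h2 : ∀ f g : CT d, CT.mul f g = CT.mul g f := fun f g => CT.ext fun x => mul_comm _ _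
    rw [h2, ← h1, h2]
  -- The upper bound places the supremum below `a`, so `T` has a positive eigenfunction for it;
  -- duality with the roles exchanged then gives the reverse inequality.
  refine le_antisymm hle ?_
  obtain ⟨φ, hφ, hφe⟩ := hT.exists_eigenfunction fun x => hle.trans_lt (hlam x)
  exact le_of_dual (cellMean_adjOp hκ hJ p φ ψ) hφ hψ (fun x => (hφe x).ge) fun x => (h x).le

/-- Below `min a` the adjoint operator has a positive eigenfunction for the value `H(p)`. -/
lemma exists_adjoint_eigenfunction (hκ : IsPositiveCoefficient κ) (hJ : IsDispersalKernel J)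
    {a : CT d} {p : E d} (hH : ∀ x, hamiltonian J κ a p < a x) :
    ∃ ψ : CT d, (∀ x, 0 < ψ x) ∧
      ∀ x, adjOp hκ hJ (-p) ψ x = (a x - hamiltonian J κ a p) * ψ x := by
  have hT := isPosOp_tiltOp hκ hJ p
  have hS : IsPosOp (adjOp hκ hJ (-p)) := isPosOp_tiltOp hκ.swap hJ.neg_arg (-p)
  have hH' := hamiltonian_eq hκ hJ a p
  obtain ⟨φ, hφ, hφe⟩ := hT.exists_eigenfunction (a := a) fun x => by rw [← hH']; exact hH x
  -- Duality keeps the principal value of the adjoint below `a`, so it is attained;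
  -- `hamiltonian_eq_of_adjoint` then identifies it with `H(p)`.
  have hle : sSup (admissible (adjOp hκ hJ (-p)) a) ≤ hamiltonian J κ a p := by
    refine csSup_le (IsPosOp.nonempty_admissible _ _) ?_
    rintro l ⟨ψ, hψ, hl⟩
    rw [hH']
    exact le_of_dual (cellMean_adjOp hκ hJ p φ ψ) hφ hψ (fun x => (hφe x).ge) hl
  have hlt : ∀ x, sSup (admissible (adjOp hκ hJ (-p)) a) < a x := fun x => hle.trans_lt (hH x)
  obtain ⟨ψ, hψ, hψe⟩ := hS.exists_eigenfunction hlt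
  refine ⟨ψ, hψ, ?_⟩
  rw [hamiltonian_eq_of_adjoint hκ hJ hlt hψ hψe]
  exact hψe

/-- The smooth branch of adjoint eigenfunctions. -/
lemma exists_adjoint_branch (hκ : IsPositiveCoefficient κ) (hJ : IsDispersalKernel J)
    {a : CT d} {p₀ : E d} (hH : ∀ x, hamiltonian J κ a p₀ < a x) :
    ∃ Φ : E d → CT d, ContDiffAt ℝ 2 Φ (-p₀) ∧
      ContDiffAt ℝ 2 (fun q => hamiltonian J κ a (-q)) (-p₀) ∧ (∀ x, 0 < Φ (-p₀) x) ∧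
      ∀ᶠ q in 𝓝 (-p₀), adjOp hκ hJ q (Φ q)
        = CT.mul a (Φ q) - hamiltonian J κ a (-q) • Φ q := by
  obtain ⟨ψ, hψ, hψe⟩ := exists_adjoint_eigenfunction hκ hJ hH
  have hTd : ContDiff ℝ 2 (adjOp hκ hJ) := contDiff_tiltOp_nat hκ.swap 2 hJ.neg_arg.isWeight
  obtain ⟨Φ, hΦ, hΦ0, hev⟩ := exists_eigen_branch (T := adjOp hκ hJ) (a := a) (p₀ := -p₀)
    (φ₀ := (ψ 0)⁻¹ • ψ) (lam := hamiltonian J κ a p₀) hTd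
    (fun q => isPosOp_tiltOp hκ.swap hJ.neg_arg q)
    (fun x => mul_pos (inv_pos.2 (hψ 0)) (hψ x)) (inv_mul_cancel₀ (hψ 0).ne') hH
    (fun x => by rw [map_smul, CT.smul_apply, CT.smul_apply, hψe x]; ring)
  set lam : E d → ℝ := fun q => a 0 - adjOp hκ hJ q (Φ q) 0 with hlam
  have hlamd : ContDiffAt ℝ 2 lam (-p₀) :=
    contDiffAt_const.sub ((CT.eval 0).contDiff.contDiffAt.comp (-p₀)
      (hTd.contDiffAt.clm_apply hΦ))
  have hlam0 : lam (-p₀) = hamiltonian J κ a p₀ := by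
    simp only [hlam, hΦ0, map_smul, CT.smul_apply, hψe 0]
    field_simp [(hψ 0).ne']
    ring
  obtain ⟨x₁, hx₁⟩ := a.exists_forall_le
  have hlt : ∀ᶠ q in 𝓝 (-p₀), lam q < a x₁ :=
    hlamd.continuousAt.eventually (gt_mem_nhds (by rw [hlam0]; exact hH x₁))
  -- Near `-p₀` the eigenvalue of the branch stays below `min a`, where a positive adjoint
  -- eigenfunction determines the Hamiltonian. Thus `H` inherits the smoothness of the branch.
  have hHlam : ∀ᶠ q in 𝓝 (-p₀), hamiltonian J κ a (-q) = lam q := by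
    filter_upwards [hev, hlt] with q hq hq2
    exact hamiltonian_eq_of_adjoint hκ hJ (fun x => hq2.trans_le (hx₁ x)) hq.1
      (by rw [neg_neg]; exact hq.2)
  refine ⟨Φ, hΦ, hlamd.congr_of_eventuallyEq hHlam, hev.self_of_nhds.1, ?_⟩
  filter_upwards [hev, hHlam] with q hq hq2
  refine CT.ext fun x => ?_
  rw [hq2, hq.2 x]
  simp only [CT.sub_apply, CT.mul_apply, CT.smul_apply, hlam]
  ring

end Dual

/-! ### Derivatives of the eigenvalue equation -/

/-- The partial derivative in the `i`-th coordinate direction. -/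
def partialDeriv {F : Type*} [NormedAddCommGroup F] [NormedSpace ℝ F] (i : Fin d) (f : E d → F)
    (q : E d) : F :=
  fderiv ℝ f q (EuclideanSpace.single i 1)

section PartialDeriv

variable {F G : Type*} [NormedAddCommGroup F] [NormedSpace ℝ F] [NormedAddCommGroup G]
  [NormedSpace ℝ G]

lemma partialDeriv_clm_apply (i : Fin d) {T : E d → F →L[ℝ] G} {u : E d → F} {q : E d}
    (hT : DifferentiableAt ℝ T q) (hu : DifferentiableAt ℝ u q) :
    partialDeriv i (fun y => T y (u y)) q = partialDeriv i T q (u q) + T q (partialDeriv i u q) := by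
  unfold partialDeriv
  rw [fderiv_clm_apply hT hu, add_comm]
  rfl

lemma partialDeriv_smul (i : Fin d) {c : E d → ℝ} {u : E d → F} {q : E d}
    (hc : DifferentiableAt ℝ c q) (hu : DifferentiableAt ℝ u q) :
    partialDeriv i (fun y => c y • u y) q = partialDeriv i c q • u q + c q • partialDeriv i u q := by
  unfold partialDeriv
  rw [fderiv_fun_smul hc hu, add_comm]
  rfl

lemma partialDeriv_clm (i : Fin d) (L : F →L[ℝ] G) {u : E d → F} {q : E d}
    (hu : DifferentiableAt ℝ u q) :
    partialDeriv i (fun y => L (u y)) q = L (partialDeriv i u q) := by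
  unfold partialDeriv
  have := (L.hasFDerivAt.comp q hu.hasFDerivAt).fderiv
  rw [show (fun y => L (u y)) = L ∘ u from rfl, this]
  rfl

lemma partialDeriv_add (i : Fin d) {u v : E d → F} {q : E d}
    (hu : DifferentiableAt ℝ u q) (hv : DifferentiableAt ℝ v q) :
    partialDeriv i (fun y => u y + v y) q = partialDeriv i u q + partialDeriv i v q := by
  unfold partialDeriv
  rw [fderiv_fun_add hu hv]
  rfl

lemma partialDeriv_sub (i : Fin d) {u v : E d → F} {q : E d}
    (hu : DifferentiableAt ℝ u q) (hv : DifferentiableAt ℝ v q) :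
    partialDeriv i (fun y => u y - v y) q = partialDeriv i u q - partialDeriv i v q := by
  unfold partialDeriv
  rw [fderiv_fun_sub hu hv]
  rfl

lemma partialDeriv_congr (i : Fin d) {u v : E d → F} {q : E d} (h : u =ᶠ[𝓝 q] v) :
    partialDeriv i u q = partialDeriv i v q := by
  unfold partialDeriv
  rw [h.fderiv_eq]

lemma contDiffAt_partialDeriv {u : E d → F} {q : E d} (hu : ContDiffAt ℝ 2 u q) (i : Fin d) :
    ContDiffAt ℝ 1 (partialDeriv i u) q :=
  (hu.fderiv_right (m := 1) (by norm_num)).clm_apply contDiffAt_const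

end PartialDeriv

section Identities

variable {J : E d → ℝ} {κ : E d → E d → ℝ}

lemma partialDeriv_tiltOp {w : E d → ℝ} (hκ : IsPositiveCoefficient κ) (hw : IsWeight w)
    (i : Fin d) (q : E d) : partialDeriv i (tiltOp hκ hw) q = tiltOp hκ (hw.coord i) q :=
  fderiv_tiltOp_single hκ hw q i

lemma differentiable_tiltOp {w : E d → ℝ} (hκ : IsPositiveCoefficient κ) (hw : IsWeight w) :
    Differentiable ℝ (tiltOp hκ hw) := fun q => (hasFDerivAt_tiltOp hκ hw q).differentiableAt

/-- First derivatives of the eigenvalue equation. -/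
lemma first_deriv_eigen {w : E d → ℝ} (hκ : IsPositiveCoefficient κ) (hw : IsWeight w)
    {a : CT d} {Φ : E d → CT d} {h : E d → ℝ} {q : E d} (hΦ : DifferentiableAt ℝ Φ q)
    (hh : DifferentiableAt ℝ h q)
    (heq : ∀ᶠ q in 𝓝 q, tiltOp hκ hw q (Φ q) = CT.mul a (Φ q) - h q • Φ q) (i : Fin d) :
    tiltOp hκ (hw.coord i) q (Φ q) + tiltOp hκ hw q (partialDeriv i Φ q)
      = CT.mul a (partialDeriv i Φ q) - (partialDeriv i h q • Φ q + h q • partialDeriv i Φ q) := by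
  have h1 := partialDeriv_congr i heq
  rw [partialDeriv_clm_apply i (differentiable_tiltOp hκ hw q) hΦ, partialDeriv_tiltOp,
    partialDeriv_sub i (u := fun y => CT.mul a (Φ y)) (v := fun y => h y • Φ y)
      ((CT.mul a).differentiableAt.comp q hΦ) (hh.smul hΦ),
    partialDeriv_clm i _ hΦ, partialDeriv_smul i hh hΦ] at h1
  exact h1

/-- Second derivatives of the eigenvalue equation at a critical point of the eigenvalue. -/
lemma second_deriv_eigen {w : E d → ℝ} (hκ : IsPositiveCoefficient κ) (hw : IsWeight w)
    {a : CT d} {Φ : E d → CT d} {h : E d → ℝ} {q : E d} (hΦ : ContDiffAt ℝ 2 Φ q)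
    (hh : ContDiffAt ℝ 2 h q)
    (heq : ∀ᶠ q in 𝓝 q, tiltOp hκ hw q (Φ q) = CT.mul a (Φ q) - h q • Φ q)
    (hcrit : ∀ i, partialDeriv i h q = 0) (i j : Fin d) :
    tiltOp hκ ((hw.coord i).coord j) q (Φ q) + tiltOp hκ (hw.coord i) q (partialDeriv j Φ q)
        + tiltOp hκ (hw.coord j) q (partialDeriv i Φ q)
        + tiltOp hκ hw q (partialDeriv j (partialDeriv i Φ) q)
      = CT.mul a (partialDeriv j (partialDeriv i Φ) q)
        - (partialDeriv j (partialDeriv i h) q • Φ q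
          + h q • partialDeriv j (partialDeriv i Φ) q) := by
  have hΦd : ∀ᶠ y in 𝓝 q, DifferentiableAt ℝ Φ y :=
    (hΦ.eventually (by norm_num)).mono fun y hy => hy.differentiableAt (by norm_num)
  have hhd : ∀ᶠ y in 𝓝 q, DifferentiableAt ℝ h y :=
    (hh.eventually (by norm_num)).mono fun y hy => hy.differentiableAt (by norm_num)
  -- The first-order identity is needed on a whole neighbourhood, with the gradient of `h` still
  -- present, before it can be differentiated again.
  have hev : ∀ᶠ y in 𝓝 q,
      tiltOp hκ (hw.coord i) y (Φ y) + tiltOp hκ hw y (partialDeriv i Φ y)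
        = CT.mul a (partialDeriv i Φ y)
          - (partialDeriv i h y • Φ y + h y • partialDeriv i Φ y) := by
    filter_upwards [hΦd, hhd, heq.eventually_nhds] with y h1 h2 h3
    exact first_deriv_eigen hκ hw h1 h2 h3 i
  have d1 : DifferentiableAt ℝ Φ q := hΦd.self_of_nhds
  have d2 : DifferentiableAt ℝ h q := hhd.self_of_nhds
  have d3 : DifferentiableAt ℝ (partialDeriv i Φ) q :=
    (contDiffAt_partialDeriv hΦ i).differentiableAt (by norm_num)
  have d4 : DifferentiableAt ℝ (partialDeriv i h) q :=
    (contDiffAt_partialDeriv hh i).differentiableAt (by norm_num)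
  have h1 := partialDeriv_congr j hev
  rw [partialDeriv_add j ((differentiable_tiltOp hκ _ q).clm_apply d1)
      ((differentiable_tiltOp hκ _ q).clm_apply d3),
    partialDeriv_clm_apply j (differentiable_tiltOp hκ _ q) d1,
    partialDeriv_clm_apply j (differentiable_tiltOp hκ _ q) d3,
    partialDeriv_tiltOp, partialDeriv_tiltOp,
    partialDeriv_sub j (u := fun y => CT.mul a (partialDeriv i Φ y))
      (v := fun y => partialDeriv i h y • Φ y + h y • partialDeriv i Φ y)
      ((CT.mul a).differentiableAt.comp q d3) ((d4.smul d1).add (d2.smul d3)),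
    partialDeriv_add j (u := fun y => partialDeriv i h y • Φ y)
      (v := fun y => h y • partialDeriv i Φ y) (d4.smul d1) (d2.smul d3), partialDeriv_clm j _ d3,
    partialDeriv_smul j d4 d1, partialDeriv_smul j d2 d3, hcrit i, hcrit j] at h1
  simp only [zero_smul, add_zero, zero_add] at h1
  rw [← h1]
  abel

end Identities

/-! ### Correctors at the maximum point -/

lemma partialDeriv_comp_neg (i : Fin d) (g : E d → ℝ) (q : E d) :
    partialDeriv i (fun y => g (-y)) q = -partialDeriv i g (-q) := by
  unfold partialDeriv
  have h := ContinuousLinearEquiv.comp_right_fderiv (f := g) (x := q)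
    (ContinuousLinearEquiv.neg ℝ : E d ≃L[ℝ] E d)
  rw [show (fun y => g (-y)) = g ∘ (ContinuousLinearEquiv.neg ℝ : E d ≃L[ℝ] E d) from rfl, h]
  simp

lemma secondPartial_eq (g : E d → ℝ) (i j : Fin d) (x : E d) :
    secondPartial g i j x = partialDeriv j (partialDeriv i g) x := rfl

lemma partialDeriv_partialDeriv_comp_neg (i j : Fin d) (g : E d → ℝ) (q : E d) :
    partialDeriv j (partialDeriv i fun y => g (-y)) q = secondPartial g i j (-q) := by
  have h1 : (partialDeriv i fun y => g (-y)) = fun y => (-partialDeriv i g) (-y) := by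
    ext y
    exact partialDeriv_comp_neg i g y
  rw [h1, partialDeriv_comp_neg, secondPartial_eq]
  unfold partialDeriv
  rw [show (-fun q => fderiv ℝ g q (EuclideanSpace.single i 1))
    = fun q => -(fderiv ℝ g q (EuclideanSpace.single i 1)) from rfl, fderiv_fun_neg]
  simp

/-- Adjoint eigenfunction and correctors at the maximum point of the Hamiltonian. -/
structure IsCorrector {J : E d → ℝ} {κ : E d → E d → ℝ} (hκ : IsPositiveCoefficient κ)
    (hJ : IsDispersalKernel J) (a : CT d) (p : E d) (Φ : CT d) (Φ₁ : Fin d → CT d)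
    (Φ₂ : Fin d → Fin d → CT d) : Prop where
  pos : ∀ x, 0 < Φ x
  eq_zero : ∀ x, adjOp hκ hJ (-p) Φ x = (a x - hamiltonian J κ a p) * Φ x
  eq_one : ∀ i x, tiltOp hκ.swap (hJ.neg_arg.isWeight.coord i) (-p) Φ x
    + adjOp hκ hJ (-p) (Φ₁ i) x = (a x - hamiltonian J κ a p) * Φ₁ i x
  eq_two : ∀ i j x, tiltOp hκ.swap ((hJ.neg_arg.isWeight.coord i).coord j) (-p) Φ x
    + tiltOp hκ.swap (hJ.neg_arg.isWeight.coord i) (-p) (Φ₁ j) x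
    + tiltOp hκ.swap (hJ.neg_arg.isWeight.coord j) (-p) (Φ₁ i) x
    + adjOp hκ hJ (-p) (Φ₂ i j) x
    = (a x - hamiltonian J κ a p) * Φ₂ i j x - secondPartial (hamiltonian J κ a) i j p * Φ x

/-- No corrector problem has to be solved: the correctors are the derivatives of the adjoint branch
at `-p₀`. Maximality kills the gradient terms, and in second derivatives the two signs from `q = -p`
cancel. -/
lemma exists_corrector {J : E d → ℝ} {κ : E d → E d → ℝ} (hκ : IsPositiveCoefficient κ)
    (hJ : IsDispersalKernel J) {a : CT d} {p₀ : E d} (hH : ∀ x, hamiltonian J κ a p₀ < a x)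
    (hmax : ∀ p, hamiltonian J κ a p ≤ hamiltonian J κ a p₀) :
    ContDiffAt ℝ 2 (hamiltonian J κ a) p₀ ∧
      ∃ Φ Φ₁ Φ₂, IsCorrector hκ hJ a p₀ Φ Φ₁ Φ₂ := by
  obtain ⟨Φ, hΦ, hh, hpos, hev⟩ := exists_adjoint_branch hκ hJ hH
  have hcrit : ∀ i, partialDeriv i (fun q => hamiltonian J κ a (-q)) (-p₀) = 0 := fun i => by
    have : IsLocalMax (fun q => hamiltonian J κ a (-q)) (-p₀) :=
      Eventually.of_forall fun q => by simpa using hmax (-q)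
    rw [partialDeriv, this.fderiv_eq_zero]
    rfl
  constructor
  · have : hamiltonian J κ a = (fun q => hamiltonian J κ a (-q)) ∘ fun p => -p := by
      ext p; simp
    rw [this]
    exact ContDiffAt.comp p₀ hh contDiff_neg.contDiffAt
  refine ⟨Φ (-p₀), fun i => partialDeriv i Φ (-p₀),
    fun i j => partialDeriv j (partialDeriv i Φ) (-p₀), hpos, fun x => ?_, fun i x => ?_,
    fun i j x => ?_⟩
  · rw [hev.self_of_nhds, neg_neg]
    simp only [CT.sub_apply, CT.mul_apply, CT.smul_apply]
    ring
  · have h1 := first_deriv_eigen hκ.swap hJ.neg_arg.isWeight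
      (hΦ.differentiableAt (by norm_num)) (hh.differentiableAt (by norm_num)) hev i
    rw [hcrit i] at h1
    have h2 := congrArg (fun g : CT d => g x) h1
    simp only [CT.sub_apply, CT.add_apply, CT.mul_apply, CT.smul_apply, neg_neg] at h2
    rw [adjOp, h2]
    ring
  · have h1 := second_deriv_eigen hκ.swap hJ.neg_arg.isWeight hΦ hh hev hcrit i j
    rw [partialDeriv_partialDeriv_comp_neg] at h1
    have h2 := congrArg (fun g : CT d => g x) h1
    simp only [CT.sub_apply, CT.add_apply, CT.mul_apply, CT.smul_apply, neg_neg] at h2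
    rw [adjOp, h2]
    ring

/-! ### Weak compactness -/

/-- Sequential Banach–Alaoglu in a separable Hilbert space, transported through the Riesz
isomorphism. -/
lemma exists_weak_subseq {H : Type*} [NormedAddCommGroup H] [InnerProductSpace ℝ H]
    [CompleteSpace H] [TopologicalSpace.SeparableSpace H] {x : ℕ → H} {C : ℝ}
    (hx : ∀ n, ‖x n‖ ≤ C) :
    ∃ (y : H) (s : ℕ → ℕ), StrictMono s ∧
      ∀ z, Tendsto (fun n => inner ℝ (x (s n)) z) atTop (𝓝 (inner ℝ y z)) := by
  let e := InnerProductSpace.toDual ℝ H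
  obtain ⟨y, -, s, hs, h⟩ := WeakDual.isSeqCompact_closedBall ℝ H 0 C
    (x := fun n => StrongDual.toWeakDual (e (x n))) (fun n => by
      simpa [e] using hx n)
  refine ⟨e.symm (WeakDual.toStrongDual y), s, hs, fun z => ?_⟩
  have h1 := ((WeakDual.eval_continuous z).tendsto y).comp h
  simp only [e, InnerProductSpace.toDual_symm_apply]
  exact h1

/-- A closed subspace is sequentially weakly closed. -/
lemma mem_of_weak_limit {H : Type*} [NormedAddCommGroup H] [InnerProductSpace ℝ H]
    [CompleteSpace H] (S : Submodule ℝ H) (hS : IsClosed (S : Set H)) {x : ℕ → H}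
    (hx : ∀ n, x n ∈ S) {y : H}
    (h : ∀ z, Tendsto (fun n => inner ℝ (x n) z) atTop (𝓝 (inner ℝ y z))) : y ∈ S := by
  have : CompleteSpace S := hS.completeSpace_coe
  rw [← Submodule.orthogonal_orthogonal S, Submodule.mem_orthogonal]
  intro z hz
  rw [real_inner_comm]
  refine tendsto_nhds_unique (h z) ?_
  have : ∀ n, inner ℝ (x n) z = 0 := fun n => (Submodule.mem_orthogonal S z).1 hz _ (hx n)
  simp [this]

instance : Fact ((2 : ENNReal) ≠ ⊤) := ⟨by norm_num⟩

/-! ### Translations in `L²` -/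

/-- `L²(ℝ^d)`. -/
abbrev V (d : ℕ) : Type := Lp ℝ 2 (volume : Measure (E d))

/-- Translation `v ↦ v(· + h)` in `L²(ℝ^d)`. -/
def tr (h : E d) : V d →ₗᵢ[ℝ] V d :=
  Lp.compMeasurePreservingₗᵢ ℝ (fun x => x + h) (measurePreserving_add_right volume h)

lemma coeFn_tr (h : E d) (v : V d) : tr h v =ᵐ[volume] fun x => v (x + h) :=
  Lp.coeFn_compMeasurePreserving v _

lemma continuous_tr (v : V d) : Continuous fun h => tr h v := by
  have hg : Continuous fun h : E d => (ContinuousMap.mk (fun x => x + h) (by fun_prop) : C(E d, E d)) :=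
    (ContinuousMap.curry ⟨fun q : E d × E d => q.2 + q.1, by fun_prop⟩).continuous
  exact Continuous.compMeasurePreservingLp continuous_const hg
    (fun h => measurePreserving_add_right volume h) (by norm_num)

lemma tr_add (h k : E d) (v : V d) : tr (h + k) v = tr h (tr k v) := by
  refine Lp.ext ?_
  have h1 := (measurePreserving_add_right volume h).quasiMeasurePreserving.ae_eq_comp (coeFn_tr k v)
  filter_upwards [coeFn_tr (h + k) v, coeFn_tr h (tr k v), h1] with x e1 e2 e3
  rw [e1, e2]
  simp only [Function.comp_apply] at e3
  rw [e3, add_assoc]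

lemma tr_zero (v : V d) : tr 0 v = v := by
  refine Lp.ext ?_
  filter_upwards [coeFn_tr 0 v] with x hx
  rw [hx, add_zero]

/-- The `L²` modulus of continuity. -/
def shiftNorm (v : V d) (h : E d) : ℝ := ‖tr h v - v‖

lemma shiftNorm_nonneg (v : V d) (h : E d) : 0 ≤ shiftNorm v h := norm_nonneg _

lemma continuous_shiftNorm (v : V d) : Continuous (shiftNorm v) :=
  ((continuous_tr v).sub continuous_const).norm

lemma shiftNorm_zero (v : V d) : shiftNorm v 0 = 0 := by simp [shiftNorm, tr_zero]

/-- Translations are isometries, so the modulus is subadditive in the shift. Both the averaging and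
the chaining argument below rest on this. -/
lemma shiftNorm_add_le (v : V d) (h k : E d) :
    shiftNorm v (h + k) ≤ shiftNorm v h + shiftNorm v k := by
  have h1 : tr (h + k) v - v = tr h (tr k v - v) + (tr h v - v) := by
    rw [tr_add, map_sub]; abel
  unfold shiftNorm
  rw [h1, add_comm ‖tr h v - v‖, ← (tr h).norm_map (tr k v - v)]
  exact norm_add_le _ _

lemma shiftNorm_nsmul_le (v : V d) (h : E d) (n : ℕ) :
    shiftNorm v (n • h) ≤ n * shiftNorm v h := by
  induction n with
  | zero => simp [shiftNorm_zero]
  | succ n ih =>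
    rw [succ_nsmul]
    push_cast
    linarith [shiftNorm_add_le v (n • h) h]

lemma continuous_shiftNorm_left (h : E d) : Continuous fun v : V d => shiftNorm v h :=
  (((tr h).continuous).sub continuous_id).norm

lemma eLpNorm_shift (v : V d) (h : E d) :
    eLpNorm (fun x => v (x + h) - v x) 2 volume = ENNReal.ofReal (shiftNorm v h) := by
  rw [shiftNorm, Lp.norm_def, ENNReal.ofReal_toReal (Lp.eLpNorm_ne_top _)]
  refine eLpNorm_congr_ae ?_
  filter_upwards [coeFn_tr h v, Lp.coeFn_sub (tr h v) v] with x e1 e2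
  rw [e2, Pi.sub_apply, e1]

lemma sq_eLpNorm_two {α F : Type*} [MeasurableSpace α] [NormedAddCommGroup F] (μ : Measure α)
    (f : α → F) : eLpNorm f 2 μ ^ 2 = ∫⁻ x, ‖f x‖ₑ ^ 2 ∂μ := by
  have := eLpNorm_nnreal_pow_eq_lintegral (f := f) (μ := μ) (p := 2) two_ne_zero
  simpa using this

/-- Averaging: an integral bound for small shifts gives a pointwise bound. -/
lemma shiftNorm_sq_le_of_integral (v : V d) {ρ B : ℝ}
    (hB : ∫ h in Metric.ball (0 : E d) ρ, shiftNorm v h ^ 2 ≤ B) {h : E d} (hh : ‖h‖ ≤ ρ / 2) :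
    volume.real (Metric.ball (0 : E d) (ρ / 2)) * shiftNorm v h ^ 2 ≤ 4 * B := by
  have hInt : ∀ (g : E d → E d) (hg : Continuous g) (R : ℝ),
      IntegrableOn (fun z => shiftNorm v (g z) ^ 2) (Metric.ball (0 : E d) R) := fun g hg R =>
    ((((continuous_shiftNorm v).comp hg).pow 2).continuousOn.integrableOn_compact
      (isCompact_closedBall (0 : E d) R)).mono_set Metric.ball_subset_closedBall
  -- Write `h = (h - z) + z` and average over `‖z‖ < ρ/2`: both pieces stay in the ball of radius
  -- `ρ`, and each contributes `2B`.
  have h1 : ∫ _z in Metric.ball (0 : E d) (ρ / 2), shiftNorm v h ^ 2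
      ≤ ∫ z in Metric.ball (0 : E d) (ρ / 2),
        (2 * shiftNorm v (h - z) ^ 2 + 2 * shiftNorm v z ^ 2) := by
    refine integral_mono (by
      refine integrableOn_const ?_
      exact measure_ball_lt_top.ne) (((hInt _ (continuous_const.sub continuous_id) _).const_mul 2).add
      ((hInt _ continuous_id _).const_mul 2)) fun z => ?_
    have h2 := shiftNorm_add_le v (h - z) z
    rw [sub_add_cancel] at h2
    have h3 := shiftNorm_nonneg v h
    simp only
    nlinarith [sq_nonneg (shiftNorm v (h - z) - shiftNorm v z)]
  have hnn : 0 ≤ᵐ[volume.restrict (Metric.ball (0 : E d) ρ)] fun z => shiftNorm v z ^ 2 :=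
    Eventually.of_forall fun z => sq_nonneg _
  have h2 : ∫ z in Metric.ball (0 : E d) (ρ / 2), shiftNorm v z ^ 2 ≤ B := by
    rcases le_or_gt ρ 0 with hρ | hρ
    · have : ρ / 2 ≤ 0 := by linarith
      rw [Metric.ball_eq_empty.2 hρ] at hB
      rw [Metric.ball_eq_empty.2 this]
      simpa using hB
    · exact (setIntegral_mono_set (hInt _ continuous_id ρ) hnn
        (Metric.ball_subset_ball (by linarith)).eventuallyLE).trans hB
  have h3 : ∫ z in Metric.ball (0 : E d) (ρ / 2), shiftNorm v (h - z) ^ 2 ≤ B := by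
    have e1 : ∫ z in Metric.ball (0 : E d) (ρ / 2), shiftNorm v (h - z) ^ 2
        = ∫ z in (fun z => h - z) ⁻¹' (Metric.ball h (ρ / 2)), shiftNorm v (h - z) ^ 2 := by
      congr 2
      ext z
      simp [Metric.mem_ball, dist_eq_norm]
    rw [e1, (Measure.measurePreserving_sub_left volume h).setIntegral_preimage_emb
      (MeasurableEquiv.subLeft h).measurableEmbedding (fun y => shiftNorm v y ^ 2)]
    refine (setIntegral_mono_set (hInt _ continuous_id ρ) hnn
        (LE.le.eventuallyLE ?_)).trans hB
    intro z hz
    rw [Metric.mem_ball, dist_eq_norm] at hz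
    rw [mem_ball_zero_iff]
    have : ‖z‖ ≤ ‖z - h‖ + ‖h‖ := by simpa using norm_add_le (z - h) h
    linarith
  have i1 : IntegrableOn (fun z => 2 * shiftNorm v (h - z) ^ 2) (Metric.ball (0 : E d) (ρ / 2)) :=
    (hInt (fun z => h - z) (continuous_const.sub continuous_id) _).const_mul 2
  have i2 : IntegrableOn (fun z => 2 * shiftNorm v z ^ 2) (Metric.ball (0 : E d) (ρ / 2)) :=
    (hInt (fun z => z) continuous_id _).const_mul 2
  rw [setIntegral_const, smul_eq_mul, integral_add i1 i2, integral_const_mul,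
    integral_const_mul] at h1
  linarith

/-- Chaining: a bound for shifts of length `ε` propagates to all shifts. -/
lemma shiftNorm_le_of_small (v : V d) {K r ε : ℝ} (hK : 0 ≤ K) (hr : 0 < r) (hε : 0 < ε)
    (h : ∀ z : E d, ‖z‖ ≤ r * ε → shiftNorm v z ≤ K * ε) (z : E d) :
    shiftNorm v z ≤ K / r * ‖z‖ + K * ε := by
  have hrε : 0 < r * ε := mul_pos hr hε
  -- Split `z` into `N` equal steps of length at most `rε`. The bound `N ≤ ‖z‖/(rε) + 1` produces
  -- the two terms of the estimate.
  set N := ⌈‖z‖ / (r * ε)⌉₊ with hN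
  rcases Nat.eq_zero_or_pos N with h0 | h0
  · have : z = 0 := by
      rw [hN, Nat.ceil_eq_zero, div_le_iff₀ hrε, zero_mul] at h0
      exact norm_le_zero_iff.1 h0
    rw [this, shiftNorm_zero]
    positivity
  have hN0 : (0 : ℝ) < N := by exact_mod_cast h0
  have hz : z = N • ((N : ℝ)⁻¹ • z) := by
    rw [← Nat.cast_smul_eq_nsmul ℝ, smul_smul, mul_inv_cancel₀ hN0.ne', one_smul]
  have h1 : ‖(N : ℝ)⁻¹ • z‖ ≤ r * ε := by
    rw [norm_smul, norm_inv, Real.norm_of_nonneg hN0.le, inv_mul_le_iff₀ hN0]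
    have := Nat.le_ceil (‖z‖ / (r * ε))
    rw [div_le_iff₀ hrε] at this
    exact this
  have h2 : (N : ℝ) ≤ ‖z‖ / (r * ε) + 1 := (Nat.ceil_lt_add_one (by positivity)).le
  calc shiftNorm v z = shiftNorm v (N • ((N : ℝ)⁻¹ • z)) := by rw [← hz]
    _ ≤ N * shiftNorm v ((N : ℝ)⁻¹ • z) := shiftNorm_nsmul_le _ _ _
    _ ≤ (‖z‖ / (r * ε) + 1) * (K * ε) := by
        gcongr
        · exact shiftNorm_nonneg _ _
        · exact h _ h1
    _ = K / r * ‖z‖ + K * ε := by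
        field_simp

/-! ### Mollification -/

/-- A mollifier: smooth, nonnegative, compactly supported, of integral one. -/
structure IsMollifier (ρ : E d → ℝ) (δ : ℝ) : Prop where
  contDiff : ContDiff ℝ ∞ ρ
  nonneg : ∀ x, 0 ≤ ρ x
  hasCompactSupport : HasCompactSupport ρ
  support : ∀ x, ρ x ≠ 0 → ‖x‖ < δ
  integral : ∫ x, ρ x = 1

lemma exists_isMollifier (d : ℕ) {δ : ℝ} (hδ : 0 < δ) : ∃ ρ : E d → ℝ, IsMollifier ρ δ := by
  let f : ContDiffBump (0 : E d) := ⟨δ / 2, δ, by positivity, by linarith⟩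
  refine ⟨f.normed volume, f.contDiff_normed, f.nonneg_normed, f.hasCompactSupport_normed,
    fun x hx => ?_, f.integral_normed⟩
  have : x ∈ Function.support (f.normed volume) := hx
  rw [f.support_normed_eq] at this
  simpa using this

/-- The mollification `ρ ⋆ v`. -/
def moll (ρ v : E d → ℝ) (x : E d) : ℝ := ∫ h, ρ h * v (x - h)

namespace IsMollifier

variable {ρ : E d → ℝ} {δ : ℝ}

lemma lintegral (hρ : IsMollifier ρ δ) : ∫⁻ x, ENNReal.ofReal (ρ x) = 1 := by
  rw [← ofReal_integral_eq_lintegral_ofReal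
    (hρ.contDiff.continuous.integrable_of_hasCompactSupport hρ.hasCompactSupport)
    (Eventually.of_forall hρ.nonneg), hρ.integral, ENNReal.ofReal_one]

/-- Averages of `L²` functions. -/
lemma eLpNorm_average_le (hρ : IsMollifier ρ δ) {F : E d → E d → ℝ}
    (hF : StronglyMeasurable (Function.uncurry F)) {K : ENNReal}
    (hK : ∀ h, ‖h‖ < δ → eLpNorm (fun x => F x h) 2 volume ≤ K) :
    eLpNorm (fun x => ∫ h, ρ h * F x h) 2 volume ≤ K := by
  have hρm : Measurable fun h => ENNReal.ofReal (ρ h) :=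
    hρ.contDiff.continuous.measurable.ennreal_ofReal
  -- With `ρ dh` as a probability measure, `L¹ ≤ L²` gives the pointwise bound, and Tonelli
  -- exchanges the order of integration.
  let ν : Measure (E d) := volume.withDensity fun h => ENNReal.ofReal (ρ h)
  have : IsProbabilityMeasure ν := ⟨by
    rw [withDensity_apply _ MeasurableSet.univ, Measure.restrict_univ, hρ.lintegral]⟩
  have hFm : Measurable (Function.uncurry F) := hF.measurable
  have hpt : ∀ x, ‖∫ h, ρ h * F x h‖ₑ ^ 2 ≤ ∫⁻ h, ENNReal.ofReal (ρ h) * ‖F x h‖ₑ ^ 2 := by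
    intro x
    have hFx : Measurable (F x) := hFm.comp measurable_prodMk_left
    have h1 : ‖∫ h, ρ h * F x h‖ₑ ≤ eLpNorm (F x) 1 ν := by
      rw [eLpNorm_one_eq_lintegral_enorm, lintegral_withDensity_eq_lintegral_mul _ hρm hFx.enorm]
      refine (enorm_integral_le_lintegral_enorm _).trans (le_of_eq ?_)
      congr 1
      ext h
      rw [enorm_mul, Real.enorm_of_nonneg (hρ.nonneg h)]
      rfl
    have h2 := h1.trans (eLpNorm_le_eLpNorm_of_exponent_le one_le_two hFx.aestronglyMeasurable)
    calc ‖∫ h, ρ h * F x h‖ₑ ^ 2 ≤ eLpNorm (F x) 2 ν ^ 2 := by gcongr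
      _ = _ := by
        rw [sq_eLpNorm_two,
          lintegral_withDensity_eq_lintegral_mul _ hρm (hFx.enorm.pow_const 2)]
        rfl
  have hsq : eLpNorm (fun x => ∫ h, ρ h * F x h) 2 volume ^ 2 ≤ K ^ 2 := by
    rw [sq_eLpNorm_two]
    calc ∫⁻ x, ‖∫ h, ρ h * F x h‖ₑ ^ 2
        ≤ ∫⁻ x, ∫⁻ h, ENNReal.ofReal (ρ h) * ‖F x h‖ₑ ^ 2 := lintegral_mono hpt
      _ = ∫⁻ h, ∫⁻ x, ENNReal.ofReal (ρ h) * ‖F x h‖ₑ ^ 2 := by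
        refine lintegral_lintegral_swap (Measurable.aemeasurable ?_)
        exact (hρm.comp measurable_snd).mul (hFm.enorm.pow_const 2)
      _ ≤ ∫⁻ h, ENNReal.ofReal (ρ h) * K ^ 2 := by
        refine lintegral_mono fun h => ?_
        simp only
        have hFh : Measurable fun x => ‖F x h‖ₑ ^ 2 :=
          (hFm.comp (measurable_prodMk_right (y := h))).enorm.pow_const 2
        rw [lintegral_const_mul _ hFh]
        by_cases h0 : ρ h = 0
        · simp [h0]
        · gcongr
          rw [← sq_eLpNorm_two volume (fun x => F x h)]
          gcongr
          exact hK h (hρ.support h h0)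
      _ = K ^ 2 := by rw [lintegral_mul_const _ hρm, hρ.lintegral, one_mul]
  exact (ENNReal.pow_le_pow_left_iff two_ne_zero).1 hsq

lemma memLp (hρ : IsMollifier ρ δ) : MemLp ρ 2 volume :=
  hρ.contDiff.continuous.memLp_of_hasCompactSupport hρ.hasCompactSupport

lemma integrable_mul (hρ : IsMollifier ρ δ) (v : V d) (x : E d) :
    Integrable fun h => ρ h * v (x - h) :=
  hρ.memLp.integrable_mul ((Lp.memLp v).comp_measurePreserving
    (Measure.measurePreserving_sub_left volume x))

lemma stronglyMeasurable_shift (v : V d) (A : E d × E d → E d) (hA : Measurable A) :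
    StronglyMeasurable fun q => v (A q) :=
  (Lp.stronglyMeasurable v).comp_measurable hA

lemma eLpNorm_moll_sub_le (hρ : IsMollifier ρ δ) (v : V d) {K : ℝ}
    (hK : ∀ h : E d, ‖h‖ < δ → shiftNorm v h ≤ K) :
    eLpNorm (fun x => moll ρ v x - v x) 2 volume ≤ ENNReal.ofReal K := by
  have h1 : (fun x => moll ρ v x - v x) = fun x => ∫ h, ρ h * (v (x - h) - v x) := by
    ext x
    have hi : Integrable fun h => ρ h * v x :=
      (hρ.contDiff.continuous.integrable_of_hasCompactSupport hρ.hasCompactSupport).mul_const _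
    simp only [mul_sub]
    rw [integral_sub (hρ.integrable_mul v x) hi, integral_mul_const, hρ.integral, one_mul, moll]
  rw [h1]
  refine hρ.eLpNorm_average_le (F := fun x h => v (x - h) - v x) ?_ fun h hh => ?_
  · exact (stronglyMeasurable_shift v _ (by fun_prop)).sub
      (stronglyMeasurable_shift v _ measurable_fst)
  · simp only [sub_eq_add_neg (G := E d)]
    rw [eLpNorm_shift]
    exact ENNReal.ofReal_le_ofReal (hK _ (by rwa [norm_neg]))

lemma eLpNorm_moll_shift_le (hρ : IsMollifier ρ δ) (v : V d) (z : E d) :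
    eLpNorm (fun x => moll ρ v (x + z) - moll ρ v x) 2 volume
      ≤ ENNReal.ofReal (shiftNorm v z) := by
  have h1 : (fun x => moll ρ v (x + z) - moll ρ v x)
      = fun x => ∫ h, ρ h * (v (x + z - h) - v (x - h)) := by
    ext x
    simp only [mul_sub]
    rw [integral_sub (hρ.integrable_mul v _) (hρ.integrable_mul v x), moll, moll]
  rw [h1]
  refine hρ.eLpNorm_average_le (F := fun x h => v (x + z - h) - v (x - h)) ?_ fun h _ => ?_
  · exact (stronglyMeasurable_shift v _ (by fun_prop)).sub
      (stronglyMeasurable_shift v _ (by fun_prop))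
  · rw [← eLpNorm_shift]
    have h2 := eLpNorm_comp_measurePreserving (p := 2) (g := fun x => v (x + z) - v x)
      (((Lp.stronglyMeasurable v).comp_measurable (measurable_add_const z)).sub
        (Lp.stronglyMeasurable v)).aestronglyMeasurable
      (measurePreserving_sub_right volume h)
    rw [← h2]
    refine le_of_eq ?_
    congr 1
    ext x
    simp only [Function.comp_apply]
    rw [sub_add_eq_add_sub]

lemma moll_eq_convolution (v : E d → ℝ) :
    moll ρ v = convolution ρ v (ContinuousLinearMap.lsmul ℝ ℝ) volume := by
  ext x
  simp [moll, convolution]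

lemma contDiff_moll (hρ : IsMollifier ρ δ) (v : V d) : ContDiff ℝ ∞ (moll ρ v) := by
  rw [moll_eq_convolution]
  exact hρ.hasCompactSupport.contDiff_convolution_left _ hρ.contDiff
    ((Lp.memLp v).locallyIntegrable one_le_two)

/-- The value at `x` is a bounded functional on `L²` whose norm does not depend on `x`: weak
convergence becomes pointwise convergence of mollifications, with a uniform bound. -/
lemma exists_moll_eq_inner (hρ : IsMollifier ρ δ) (x : E d) : ∃ g : V d,
    ‖g‖ = (eLpNorm ρ 2 volume).toReal ∧ ∀ v : V d, moll ρ v x = inner ℝ v g := by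
  have hm : MemLp (fun y => ρ (x - y)) 2 volume :=
    hρ.memLp.comp_measurePreserving (Measure.measurePreserving_sub_left volume x)
  refine ⟨hm.toLp, ?_, fun v => ?_⟩
  · rw [Lp.norm_toLp]
    congr 1
    exact eLpNorm_comp_measurePreserving (p := 2) hρ.memLp.1
      (Measure.measurePreserving_sub_left volume x)
  · rw [L2.inner_def, moll, ← integral_sub_left_eq_self _ volume x]
    refine integral_congr_ae ?_
    filter_upwards [hm.coeFn_toLp] with y hy
    rw [hy, sub_sub_cancel]
    rfl

lemma abs_moll_le (hρ : IsMollifier ρ δ) (v : V d) (x : E d) :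
    |moll ρ v x| ≤ (eLpNorm ρ 2 volume).toReal * ‖v‖ := by
  obtain ⟨g, hg, h⟩ := hρ.exists_moll_eq_inner x
  rw [h v, ← hg, mul_comm]
  exact abs_real_inner_le_norm _ _

lemma moll_eq_zero {v : E d → ℝ} (hρ : IsMollifier ρ δ) {x : E d}
    (h : ∀ᵐ y, ‖x - y‖ < δ → v y = 0) : moll ρ v x = 0 := by
  rw [moll, ← integral_sub_left_eq_self _ volume x]
  refine integral_eq_zero_of_ae ?_
  filter_upwards [h] with y hy
  simp only [sub_sub_cancel, Pi.zero_apply]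
  by_cases h0 : ρ (x - y) = 0
  · rw [h0, zero_mul]
  · rw [hy (hρ.support _ h0), mul_zero]

end IsMollifier

/-! ### Compactness in `L²` -/

lemma norm_sub_toLp (v : V d) {g : E d → ℝ} (hg : MemLp g 2 volume) :
    ‖v - hg.toLp‖ = (eLpNorm (fun x => v x - g x) 2 volume).toReal := by
  rw [Lp.norm_def]
  congr 1
  refine eLpNorm_congr_ae ?_
  filter_upwards [Lp.coeFn_sub v hg.toLp, hg.coeFn_toLp] with x h1 h2
  rw [h1, Pi.sub_apply, h2]

/-- Mollifications of a weakly convergent sequence with supports in a fixed ball converge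
in `L²`. -/
lemma tendsto_moll_of_weak {ρ : E d → ℝ} {δ : ℝ} (hρ : IsMollifier ρ δ) {v : ℕ → V d} {y : V d}
    {C R : ℝ} (hC : ∀ n, ‖v n‖ ≤ C)
    (hw : ∀ z, Tendsto (fun n => inner ℝ (v n) z) atTop (𝓝 (inner ℝ y z)))
    (hR : ∀ n x, x ∉ Metric.closedBall (0 : E d) R → moll ρ (v n) x = 0) :
    ∃ G : E d → ℝ, MemLp G 2 volume ∧
      Tendsto (fun n => eLpNorm (fun x => moll ρ (v n) x - G x) 2 volume ^ 2) atTop (𝓝 0) := by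
  set B := Metric.closedBall (0 : E d) R
  set M := (eLpNorm ρ 2 volume).toReal
  have hM : 0 ≤ M := ENNReal.toReal_nonneg
  have hC0 : 0 ≤ C := (norm_nonneg _).trans (hC 0)
  let D := max C ‖y‖
  have hpt : ∀ x, Tendsto (fun n => moll ρ (v n) x) atTop (𝓝 (moll ρ y x)) := by
    intro x
    obtain ⟨g, -, hg⟩ := hρ.exists_moll_eq_inner x
    simp only [hg]
    exact hw g
  -- All mollifications vanish off `B`; cutting the limit off there avoids locating the support of
  -- the weak limit.
  let G : E d → ℝ := B.indicator (moll ρ y)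
  have hBm : MeasurableSet B := Metric.isClosed_closedBall.measurableSet
  have hcont : ∀ u : V d, Continuous (moll ρ u) := fun u => (hρ.contDiff_moll u).continuous
  have hpt' : ∀ x, Tendsto (fun n => moll ρ (v n) x) atTop (𝓝 (G x)) := by
    intro x
    by_cases hx : x ∈ B
    · simp only [G, Set.indicator_of_mem hx]
      exact hpt x
    · simp only [G, Set.indicator_of_notMem hx, hR _ x hx]
      exact tendsto_const_nhds
  refine ⟨G, ?_, ?_⟩
  · rw [memLp_indicator_iff_restrict hBm]
    have : IsFiniteMeasure (volume.restrict B) :=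
      ⟨by rw [Measure.restrict_apply_univ]; exact measure_closedBall_lt_top⟩
    exact MemLp.of_bound (hcont y).aestronglyMeasurable (M * ‖y‖)
      (Eventually.of_forall fun x => hρ.abs_moll_le y x)
  · simp only [sq_eLpNorm_two]
    have h0 : ∫⁻ x : E d, (0 : ENNReal) = 0 := lintegral_zero
    rw [← h0]
    refine tendsto_lintegral_of_dominated_convergence'
      (B.indicator fun _ => ENNReal.ofReal (2 * (M * D)) ^ 2) (fun n => ?_) (fun n => ?_) ?_ ?_
    · exact ((hcont _).aestronglyMeasurable.sub
        ((hcont y).aestronglyMeasurable.indicator hBm)).enorm.pow_const 2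
    · refine Eventually.of_forall fun x => ?_
      by_cases hx : x ∈ B
      · simp only [G, Set.indicator_of_mem hx]
        gcongr
        rw [Real.enorm_eq_ofReal_abs]
        refine ENNReal.ofReal_le_ofReal ((abs_sub _ _).trans ?_)
        have h1 := hρ.abs_moll_le (v n) x
        have h2 := hρ.abs_moll_le y x
        have h3 : M * ‖v n‖ ≤ M * D := by
          gcongr
          exact (hC n).trans (le_max_left _ _)
        have h4 : M * ‖y‖ ≤ M * D := by
          gcongr
          exact le_max_right _ _
        linarith
      · simp [G, Set.indicator_of_notMem hx, hR n x hx]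
    · rw [lintegral_indicator hBm, setLIntegral_const]
      exact ENNReal.mul_ne_top (ENNReal.pow_ne_top ENNReal.ofReal_ne_top)
        measure_closedBall_lt_top.ne
    · refine Eventually.of_forall fun x => ?_
      have h1 : Tendsto (fun n => moll ρ (v n) x - G x) atTop (𝓝 (G x - G x)) :=
        (hpt' x).sub_const _
      rw [sub_self] at h1
      have h2 := ENNReal.Tendsto.pow (n := 2) h1.enorm
      simpa using h2

/-- Compactness of sequences with an asymptotically uniform `L²` modulus of continuity. -/
lemma exists_convergent_subseq {Ω : Set (E d)} (hΩ : Bornology.IsBounded Ω) {v : ℕ → V d}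
    {ε : ℕ → ℝ} {C K : ℝ} (hC : ∀ n, ‖v n‖ ≤ C) (hK : 0 ≤ K) (hε : Tendsto ε atTop (𝓝 0))
    (hsupp : ∀ n, ∀ᵐ x, x ∉ Ω → v n x = 0)
    (hv : ∀ n h, shiftNorm (v n) h ≤ K * ‖h‖ + K * ε n) :
    ∃ (w : V d) (s : ℕ → ℕ), StrictMono s ∧ Tendsto (fun n => v (s n)) atTop (𝓝 w) := by
  obtain ⟨y, s, hs, hw⟩ := exists_weak_subseq hC
  obtain ⟨R, hR⟩ := hΩ.subset_closedBall 0
  suffices hcau : CauchySeq fun n => v (s n) by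
    obtain ⟨w, hw⟩ := cauchySeq_tendsto_of_complete hcau
    exact ⟨w, s, hs, hw⟩
  -- One weakly convergent subsequence serves all scales. At scale `δ` the mollifications converge
  -- strongly and lie within `Kδ + Kε` of the functions; each of the three errors is at most `η/4`.
  have key : ∀ η > 0, ∃ g : V d, ∀ᶠ n in atTop, dist (v (s n)) g < η := by
    intro η hη
    set δ := min 1 (η / (4 * (K + 1))) with hδ
    have hδ0 : 0 < δ := by positivity
    have hKδ : K * δ ≤ η / 4 := by
      calc K * δ ≤ (K + 1) * (η / (4 * (K + 1))) := by
            gcongr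
            · linarith
            · exact min_le_right _ _
        _ = η / 4 := by field_simp
    obtain ⟨ρ, hρ⟩ := exists_isMollifier d hδ0
    obtain ⟨G, hG, hlim⟩ := tendsto_moll_of_weak hρ (v := fun n => v (s n)) (y := y) (R := R + 1)
      (fun n => hC (s n)) hw fun n x hx => by
        refine hρ.moll_eq_zero ?_
        filter_upwards [hsupp (s n)] with z hz hxz
        refine hz fun hzΩ => hx ?_
        have h1 := hR hzΩ
        rw [mem_closedBall_zero_iff] at h1 ⊢
        have h2 : ‖x‖ ≤ ‖x - z‖ + ‖z‖ := by simpa using norm_add_le (x - z) z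
        have h3 : δ ≤ 1 := min_le_left _ _
        linarith
    refine ⟨hG.toLp, ?_⟩
    have hε' : ∀ᶠ n in atTop, K * ε (s n) < η / 4 := by
      have : Tendsto (fun n => K * ε (s n)) atTop (𝓝 (K * 0)) :=
        (hε.comp hs.tendsto_atTop).const_mul K
      rw [mul_zero] at this
      exact this.eventually (gt_mem_nhds (by positivity))
    have hsm : ∀ᶠ n in atTop,
        eLpNorm (fun x => moll ρ (v (s n)) x - G x) 2 volume ^ 2 < ENNReal.ofReal (η / 4) ^ 2 :=
      hlim.eventually (gt_mem_nhds (by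
        have : 0 < ENNReal.ofReal (η / 4) := ENNReal.ofReal_pos.2 (by positivity)
        positivity))
    filter_upwards [hε', hsm] with n h1 h2
    rw [dist_eq_norm, norm_sub_toLp]
    have h3 : eLpNorm (fun x => moll ρ (v (s n)) x - v (s n) x) 2 volume
        ≤ ENNReal.ofReal (K * δ + K * ε (s n)) :=
      hρ.eLpNorm_moll_sub_le _ fun h hh => (hv (s n) h).trans (by gcongr)
    have h4 : eLpNorm (fun x => moll ρ (v (s n)) x - G x) 2 volume ≤ ENNReal.ofReal (η / 4) :=
      (ENNReal.pow_le_pow_left_iff two_ne_zero).1 h2.le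
    have hm1 : AEStronglyMeasurable (moll ρ (v (s n))) volume :=
      (hρ.contDiff_moll _).continuous.aestronglyMeasurable
    have h5 : eLpNorm (fun x => v (s n) x - G x) 2 volume
        ≤ ENNReal.ofReal (3 * η / 4) := by
      have e1 : (fun x => v (s n) x - G x)
          = (fun x => moll ρ (v (s n)) x - G x) - fun x => moll ρ (v (s n)) x - v (s n) x := by
        ext x
        simp
      rw [e1]
      refine (eLpNorm_sub_le (hm1.sub hG.1) (hm1.sub (Lp.aestronglyMeasurable _))
        one_le_two).trans ?_
      refine (add_le_add h4 h3).trans ?_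
      rcases le_or_gt 0 (K * δ + K * ε (s n)) with h6 | h6
      · rw [← ENNReal.ofReal_add (by positivity) h6]
        exact ENNReal.ofReal_le_ofReal (by linarith)
      · rw [ENNReal.ofReal_of_nonpos h6.le, add_zero]
        exact ENNReal.ofReal_le_ofReal (by linarith)
    calc (eLpNorm (fun x => v (s n) x - G x) 2 volume).toReal ≤ 3 * η / 4 :=
          ENNReal.toReal_le_of_le_ofReal (by positivity) h5
      _ < η := by linarith
  rw [Metric.cauchySeq_iff]
  intro η hη
  obtain ⟨g, hg⟩ := key (η / 2) (by positivity)
  obtain ⟨N, hN⟩ := eventually_atTop.1 hg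
  refine ⟨N, fun m hm n hn => ?_⟩
  have h1 := hN m hm
  have h2 := hN n hn
  calc dist (v (s m)) (v (s n)) ≤ dist (v (s m)) g + dist (v (s n)) g := dist_triangle_right _ _ _
    _ < η := by linarith

/-! ### `H¹₀` -/

lemma gradient_apply (ψ : E d → ℝ) (x : E d) (i : Fin d) :
    gradient ψ x i = fderiv ℝ ψ x (EuclideanSpace.single i 1) := by
  have h : inner ℝ (gradient ψ x) (EuclideanSpace.single i (1 : ℝ))
      = fderiv ℝ ψ x (EuclideanSpace.single i 1) := by
    rw [gradient, InnerProductSpace.toDual_symm_apply]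
  rw [← h, EuclideanSpace.inner_single_right]
  simp

lemma norm_le_sum_abs (x : E d) : ‖x‖ ≤ ∑ i, |x i| := by
  have h : x = ∑ i, x i • EuclideanSpace.single i (1 : ℝ) := by
    ext j
    simp [Finset.sum_apply, Pi.single_apply]
  calc ‖x‖ = ‖∑ i, x i • EuclideanSpace.single i (1 : ℝ)‖ := by rw [← h]
    _ ≤ ∑ i, ‖x i • EuclideanSpace.single i (1 : ℝ)‖ := norm_sum_le _ _
    _ = ∑ i, |x i| := by simp [norm_smul]

lemma continuous_gradient {ψ : E d → ℝ} (hψ : ContDiff ℝ ∞ ψ) : Continuous (gradient ψ) := by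
  have h1 : Continuous (fderiv ℝ ψ) := hψ.continuous_fderiv (by simp)
  exact (InnerProductSpace.toDual ℝ (E d)).symm.continuous.comp h1

/-- Difference quotients control the gradient in `L²`. -/
lemma eLpNorm_gradient_le {ψ : E d → ℝ} (hψ : ContDiff ℝ ∞ ψ) {K : ℝ}
    (h : ∀ z : E d, eLpNorm (fun x => ψ (x + z) - ψ x) 2 volume ≤ ENNReal.ofReal (K * ‖z‖)) :
    eLpNorm (gradient ψ) 2 volume ≤ d * ENNReal.ofReal K := by
  have hpart : ∀ i : Fin d, eLpNorm (fun x => fderiv ℝ ψ x (EuclideanSpace.single i 1)) 2 volume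
      ≤ ENNReal.ofReal K := by
    intro i
    set e : E d := EuclideanSpace.single i 1 with he
    have hen : ‖e‖ = 1 := by simp [he]
    let f : ℕ → E d → ℝ := fun n x =>
      ((n : ℝ) + 1) * (ψ (x + (1 / ((n : ℝ) + 1)) • e) - ψ x)
    have hf : ∀ n, eLpNorm (f n) 2 volume ≤ ENNReal.ofReal K := by
      intro n
      have h1 : f n = ((n : ℝ) + 1) • fun x => ψ (x + (1 / ((n : ℝ) + 1)) • e) - ψ x := rfl
      rw [h1, eLpNorm_const_smul]
      refine (mul_le_mul_right (h _) _).trans ?_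
      rw [Real.enorm_of_nonneg (by positivity), ← ENNReal.ofReal_mul (by positivity), norm_smul,
        hen, mul_one, Real.norm_of_nonneg (by positivity)]
      refine ENNReal.ofReal_le_ofReal (le_of_eq ?_)
      field_simp
    have hlim : ∀ x, Tendsto (fun n => f n x) atTop (𝓝 (fderiv ℝ ψ x e)) := by
      intro x
      have hd := (hψ.differentiable (by simp) x).hasFDerivAt.hasLineDerivAt e
      have hs := hd.tendsto_slope_zero
      have ht : Tendsto (fun n : ℕ => 1 / ((n : ℝ) + 1)) atTop (𝓝[≠] 0) :=
        tendsto_nhdsWithin_iff.2 ⟨tendsto_one_div_add_atTop_nhds_zero_nat,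
          Eventually.of_forall fun n => by
            have : (0 : ℝ) < 1 / ((n : ℝ) + 1) := by positivity
            exact this.ne'⟩
      refine (hs.comp ht).congr fun n => ?_
      simp [f]
    -- Fatou's lemma along the difference quotients with step `1/(n+1)`.
    refine (Lp.eLpNorm_lim_le_liminf_eLpNorm (f := f) (fun n => ?_) _
      (Eventually.of_forall hlim)).trans ?_
    · have := hψ.continuous
      exact Continuous.aestronglyMeasurable (by fun_prop)
    · refine (liminf_le_liminf (Eventually.of_forall hf)).trans ?_
      simp
  have hc : ∀ i : Fin d, Continuous fun x => fderiv ℝ ψ x (EuclideanSpace.single i 1) :=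
    fun i => (hψ.continuous_fderiv (by simp)).clm_apply continuous_const
  calc eLpNorm (gradient ψ) 2 volume
      ≤ eLpNorm (fun x => ∑ i, |fderiv ℝ ψ x (EuclideanSpace.single i 1)|) 2 volume := by
        refine eLpNorm_mono_real fun x => ?_
        refine (norm_le_sum_abs _).trans (le_of_eq ?_)
        simp only [gradient_apply]
    _ ≤ ∑ i, eLpNorm (fun x => |fderiv ℝ ψ x (EuclideanSpace.single i 1)|) 2 volume := by
        have := eLpNorm_sum_le (μ := (volume : Measure (E d))) (p := 2) (s := Finset.univ)
          (f := fun i x => |fderiv ℝ ψ x (EuclideanSpace.single i 1)|)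
          (fun i _ => (hc i).abs.aestronglyMeasurable) one_le_two
        refine le_trans (le_of_eq ?_) this
        congr 1
        ext x
        simp
    _ ≤ ∑ _i : Fin d, ENNReal.ofReal K := by
        refine Finset.sum_le_sum fun i _ => ?_
        refine le_trans (le_of_eq ?_) (hpart i)
        exact eLpNorm_norm fun x => fderiv ℝ ψ x (EuclideanSpace.single i 1)
    _ = d * ENNReal.ofReal K := by simp

/-! ### Test functions and a criterion for `H¹₀` -/

namespace IsTestFunction

variable {Ω : Set (E d)} {ψ χ : E d → ℝ}

lemma continuous (h : IsTestFunction Ω ψ) : Continuous ψ := h.1.continuous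

lemma zero : IsTestFunction Ω (fun _ => (0 : ℝ)) := by
  refine ⟨contDiff_const, HasCompactSupport.zero, ?_⟩
  have : tsupport (fun _ : E d => (0 : ℝ)) = ∅ := tsupport_eq_empty_iff.2 rfl
  simp [this]

lemma add (h : IsTestFunction Ω ψ) (h' : IsTestFunction Ω χ) :
    IsTestFunction Ω (fun x => ψ x + χ x) :=
  ⟨h.1.add h'.1, h.2.1.add h'.2.1, (tsupport_add ψ χ).trans (Set.union_subset h.2.2 h'.2.2)⟩

lemma const_mul (h : IsTestFunction Ω ψ) (c : ℝ) : IsTestFunction Ω (fun x => c * ψ x) := by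
  refine ⟨contDiff_const.mul h.1, h.2.1.mul_left, ?_⟩
  exact (tsupport_mul_subset_right (f := fun _ => c) (g := ψ)).trans h.2.2

lemma memLp (h : IsTestFunction Ω ψ) : MemLp ψ 2 volume :=
  h.continuous.memLp_of_hasCompactSupport h.2.1

lemma hasCompactSupport_gradient (h : IsTestFunction Ω ψ) : HasCompactSupport (gradient ψ) := by
  have h1 := h.2.1.fderiv (𝕜 := ℝ)
  exact h1.comp_left (map_zero (InnerProductSpace.toDual ℝ (E d)).symm)

lemma memLp_gradient (h : IsTestFunction Ω ψ) : MemLp (gradient ψ) 2 volume :=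
  (continuous_gradient h.1).memLp_of_hasCompactSupport h.hasCompactSupport_gradient

lemma gradient_add (h : IsTestFunction Ω ψ) (h' : IsTestFunction Ω χ) (x : E d) :
    gradient (fun x => ψ x + χ x) x = gradient ψ x + gradient χ x := by
  have h1 := h.1.differentiable (by simp) x
  have h2 := h'.1.differentiable (by simp) x
  rw [gradient, fderiv_fun_add h1 h2, map_add]
  rfl

lemma gradient_const_mul (h : IsTestFunction Ω ψ) (c : ℝ) (x : E d) :
    gradient (fun x => c * ψ x) x = c • gradient ψ x := by
  have h1 := h.1.differentiable (by simp) x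
  rw [gradient, fderiv_const_mul h1, map_smulₛₗ]
  rfl

end IsTestFunction

/-- The Hilbert space of pairs (function, vector field). -/
abbrev GraphSpace (d : ℕ) : Type := WithLp 2 (V d × Lp (E d) 2 (volume : Measure (E d)))

/-- The graph of the gradient on test functions. -/
def gradientGraph (Ω : Set (E d)) : Submodule ℝ (GraphSpace d) where
  carrier := {z | ∃ ψ, IsTestFunction Ω ψ ∧ z.ofLp.1 =ᵐ[volume] ψ ∧
    z.ofLp.2 =ᵐ[volume] gradient ψ}
  zero_mem' := by
    refine ⟨fun _ => 0, IsTestFunction.zero, Lp.coeFn_zero _ _ _, ?_⟩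
    filter_upwards [Lp.coeFn_zero (E d) 2 (volume : Measure (E d))] with x hx
    have : gradient (fun _ : E d => (0 : ℝ)) x = 0 := by simp [gradient]
    rw [this]
    exact hx
  add_mem' := by
    rintro y z ⟨ψ, hψ, h1, h2⟩ ⟨χ, hχ, h3, h4⟩
    refine ⟨_, hψ.add hχ, ?_, ?_⟩
    · filter_upwards [h1, h3, Lp.coeFn_add y.ofLp.1 z.ofLp.1] with x h1 h3 h5
      rw [← h1, ← h3]
      exact h5
    · filter_upwards [h2, h4, Lp.coeFn_add y.ofLp.2 z.ofLp.2] with x h1 h3 h5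
      rw [hψ.gradient_add hχ, ← h1, ← h3]
      exact h5
  smul_mem' := by
    rintro c y ⟨ψ, hψ, h1, h2⟩
    refine ⟨_, hψ.const_mul c, ?_, ?_⟩
    · filter_upwards [h1, Lp.coeFn_smul c y.ofLp.1] with x h1 h5
      rw [← h1]
      exact h5
    · filter_upwards [h2, Lp.coeFn_smul c y.ofLp.2] with x h1 h5
      rw [hψ.gradient_const_mul, ← h1]
      exact h5

/-- `u` is an `L²` limit of test functions with bounded gradients. -/
def IsGradientBoundedLimit (Ω : Set (E d)) (u : V d) : Prop :=
  ∃ K : ℝ, ∀ η : ℝ, 0 < η → ∃ ψ, IsTestFunction Ω ψ ∧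
    eLpNorm (fun x => ψ x - u x) 2 volume ≤ ENNReal.ofReal η ∧
    eLpNorm (gradient ψ) 2 volume ≤ ENNReal.ofReal K

namespace IsGradientBoundedLimit

variable {Ω : Set (E d)} {u w : V d}

lemma zero : IsGradientBoundedLimit Ω (0 : V d) := by
  refine ⟨0, fun η _ => ⟨_, IsTestFunction.zero, ?_, ?_⟩⟩
  · have : (fun x => 0 - (0 : V d) x) =ᵐ[volume] fun _ => (0 : ℝ) := by
      filter_upwards [Lp.coeFn_zero ℝ 2 (volume : Measure (E d))] with x hx
      rw [hx]
      simp
    rw [eLpNorm_congr_ae this]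
    simp
  · have : gradient (fun _ : E d => (0 : ℝ)) = fun _ => 0 := by
      ext x
      simp [gradient]
    rw [this]
    simp

lemma add (hu : IsGradientBoundedLimit Ω u) (hw : IsGradientBoundedLimit Ω w) :
    IsGradientBoundedLimit Ω (u + w) := by
  obtain ⟨K, hK⟩ := hu
  obtain ⟨K', hK'⟩ := hw
  refine ⟨max K 0 + max K' 0, fun η hη => ?_⟩
  obtain ⟨ψ, h1, h2, h3⟩ := hK (η / 2) (by positivity)
  obtain ⟨χ, h4, h5, h6⟩ := hK' (η / 2) (by positivity)
  refine ⟨_, h1.add h4, ?_, ?_⟩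
  · have e : (fun x => ψ x + χ x - (u + w : V d) x)
        =ᵐ[volume] (fun x => ψ x - u x) + fun x => χ x - w x := by
      filter_upwards [Lp.coeFn_add u w] with x hx
      rw [hx]
      simp only [Pi.add_apply]
      ring
    rw [eLpNorm_congr_ae e]
    refine (eLpNorm_add_le (h1.memLp.sub (Lp.memLp u)).1 (h4.memLp.sub (Lp.memLp w)).1
      one_le_two).trans ?_
    refine (add_le_add h2 h5).trans ?_
    rw [← ENNReal.ofReal_add (by positivity) (by positivity), add_halves]
  · have e : gradient (fun x => ψ x + χ x) = gradient ψ + gradient χ :=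
      funext fun x => h1.gradient_add h4 x
    rw [e]
    refine (eLpNorm_add_le h1.memLp_gradient.1 h4.memLp_gradient.1 one_le_two).trans ?_
    rw [ENNReal.ofReal_add (le_max_right _ _) (le_max_right _ _)]
    exact add_le_add (h3.trans (ENNReal.ofReal_le_ofReal (le_max_left _ _)))
      (h6.trans (ENNReal.ofReal_le_ofReal (le_max_left _ _)))

lemma sum {ι : Type*} (s : Finset ι) {u : ι → V d}
    (h : ∀ i ∈ s, IsGradientBoundedLimit Ω (u i)) :
    IsGradientBoundedLimit Ω (∑ i ∈ s, u i) :=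
  Finset.sum_induction u _ (fun _ _ => add) zero h

/-- The gradients are only bounded, so a weak limit of the pairs (function, gradient) is taken. The
closure of the gradient graph is a closed subspace, hence weakly closed, so this limit is also a
strong limit of pairs coming from test functions. -/
lemma memH10 (hu : IsGradientBoundedLimit Ω u) : MemH10 Ω u := by
  obtain ⟨K, hK⟩ := hu
  choose ψ hψ h1 h2 using fun n : ℕ => hK (1 / ((n : ℝ) + 1)) (by positivity)
  have hsep : TopologicalSpace.SeparableSpace (V d × Lp (E d) 2 (volume : Measure (E d))) :=
    ⟨(TopologicalSpace.exists_countable_dense (V d)).choose ×ˢ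
      (TopologicalSpace.exists_countable_dense (Lp (E d) 2 (volume : Measure (E d)))).choose,
      (TopologicalSpace.exists_countable_dense (V d)).choose_spec.1.prod
      (TopologicalSpace.exists_countable_dense
        (Lp (E d) 2 (volume : Measure (E d)))).choose_spec.1,
      (TopologicalSpace.exists_countable_dense (V d)).choose_spec.2.prod
      (TopologicalSpace.exists_countable_dense
        (Lp (E d) 2 (volume : Measure (E d)))).choose_spec.2⟩
  have : TopologicalSpace.SeparableSpace (GraphSpace d) :=
    (WithLp.prodContinuousLinearEquiv 2 ℝ (V d) (Lp (E d) 2 (volume : Measure (E d)))).symm.surjective.denseRange.separableSpace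
      (WithLp.prodContinuousLinearEquiv 2 ℝ (V d) (Lp (E d) 2 (volume : Measure (E d)))).symm.continuous
  let z : ℕ → GraphSpace d := fun n => WithLp.toLp 2 ((hψ n).memLp.toLp, (hψ n).memLp_gradient.toLp)
  have hzG : ∀ n, z n ∈ gradientGraph Ω := fun n =>
    ⟨ψ n, hψ n, (hψ n).memLp.coeFn_toLp, (hψ n).memLp_gradient.coeFn_toLp⟩
  have hz1 : ∀ n : ℕ, ‖u - (z n).ofLp.1‖ ≤ 1 / ((n : ℝ) + 1) := by
    intro n
    have : (z n).ofLp.1 = (hψ n).memLp.toLp := rfl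
    rw [this, norm_sub_toLp]
    refine ENNReal.toReal_le_of_le_ofReal (by positivity) (le_trans (le_of_eq ?_) (h1 n))
    exact eLpNorm_sub_comm (u : E d → ℝ) (ψ n) 2 volume
  have hz1' : Tendsto (fun n => (z n).ofLp.1) atTop (𝓝 u) := by
    rw [tendsto_iff_norm_sub_tendsto_zero]
    refine squeeze_zero (fun _ => norm_nonneg _) (fun n => ?_)
      tendsto_one_div_add_atTop_nhds_zero_nat
    rw [norm_sub_rev]
    exact hz1 n
  have hz2 : ∀ n, ‖(z n).ofLp.2‖ ≤ max K 0 := by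
    intro n
    have : (z n).ofLp.2 = (hψ n).memLp_gradient.toLp := rfl
    rw [this, Lp.norm_toLp]
    exact ENNReal.toReal_le_of_le_ofReal (le_max_right _ _)
      ((h2 n).trans (ENNReal.ofReal_le_ofReal (le_max_left _ _)))
  have hzn : ∀ n, ‖z n‖ ≤ (‖u‖ + 1) + max K 0 := by
    intro n
    have h3 : ‖(z n).ofLp.1‖ ≤ ‖u‖ + 1 := by
      have h4 : ‖(z n).ofLp.1‖ ≤ ‖u‖ + ‖u - (z n).ofLp.1‖ := by
        have := norm_sub_le u (u - (z n).ofLp.1)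
        rwa [sub_sub_cancel] at this
      have h5 : 1 / ((n : ℝ) + 1) ≤ 1 := by
        rw [div_le_one (by positivity)]
        have : (0 : ℝ) ≤ n := n.cast_nonneg
        linarith
      linarith [hz1 n]
    have h6 := WithLp.prod_norm_sq_eq_of_L2 (z n)
    have h7 := hz2 n
    have h8 : (0 : ℝ) ≤ max K 0 := le_max_right _ _
    refine abs_le_of_sq_le_sq' ?_ (by positivity) |>.2
    rw [h6]
    have e1 : (z n).fst = (z n).ofLp.1 := rfl
    have e2 : (z n).snd = (z n).ofLp.2 := rfl
    rw [e1, e2]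
    nlinarith [norm_nonneg (z n).ofLp.1, norm_nonneg (z n).ofLp.2, norm_nonneg u]
  obtain ⟨y, s, hs, hw⟩ := exists_weak_subseq hzn
  -- The first components already converge strongly to `u`, which identifies this half of the weak
  -- limit.
  have hy1 : y.ofLp.1 = u := by
    refine ext_inner_right ℝ fun q => ?_
    have h3 := hw (WithLp.toLp 2 (q, 0))
    simp only [WithLp.prod_inner_apply, inner_zero_right, add_zero] at h3
    exact tendsto_nhds_unique h3 (((hz1'.comp hs.tendsto_atTop)).inner tendsto_const_nhds)
  have hyc : y ∈ (gradientGraph Ω).topologicalClosure :=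
    mem_of_weak_limit _ (Submodule.isClosed_topologicalClosure _)
      (fun n => Submodule.le_topologicalClosure _ (hzG (s n))) hw
  obtain ⟨q, hq, hqy⟩ := mem_closure_iff_seq_limit.1 hyc
  choose χ hχ h3 h4 using hq
  have hc := (WithLp.prod_continuous_ofLp 2 (V d) (Lp (E d) 2 (volume : Measure (E d))))
  have hq' := (hc.tendsto y).comp hqy
  have hq1 := (continuous_fst.tendsto _).comp hq'
  have hq2 := (continuous_snd.tendsto _).comp hq'
  rw [hy1] at hq1
  rw [Lp.tendsto_Lp_iff_tendsto_eLpNorm'] at hq1 hq2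
  refine ⟨χ, y.ofLp.2, hχ, Lp.memLp _, hq1.congr fun n => eLpNorm_congr_ae ?_,
    hq2.congr fun n => eLpNorm_congr_ae ?_⟩
  · filter_upwards [h3 n] with x hx
    rw [← hx]
    rfl
  · filter_upwards [h4 n] with x hx
    rw [← hx]
    rfl

end IsGradientBoundedLimit

/-! ### Localization -/

lemma tr_comm (h k : E d) (v : V d) : tr h (tr k v) = tr k (tr h v) := by
  rw [← tr_add, add_comm, tr_add]

lemma shiftNorm_tr (v : V d) (h k : E d) : shiftNorm (tr k v) h = shiftNorm v h := by
  rw [shiftNorm, tr_comm, ← map_sub, LinearIsometry.norm_map, shiftNorm]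

lemma memLp_mul_of_bound {α : Type*} [MeasurableSpace α] {μ : Measure α} {ζ v : α → ℝ} {C : ℝ}
    (hζm : AEStronglyMeasurable ζ μ) (hζ : ∀ x, |ζ x| ≤ C) (hv : MemLp v 2 μ) :
    MemLp (fun x => ζ x * v x) 2 μ :=
  hv.of_le_mul (c := C) (hζm.mul hv.1) (Eventually.of_forall fun x => by
    rw [norm_mul]
    exact mul_le_mul_of_nonneg_right (hζ x) (norm_nonneg _))

lemma coeFn_sum {ι : Type*} (s : Finset ι) (u : ι → V d) :
    (∑ i ∈ s, u i : V d) =ᵐ[volume] fun x => ∑ i ∈ s, u i x := by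
  classical
  induction s using Finset.induction_on with
  | empty =>
    simp only [Finset.sum_empty]
    exact Lp.coeFn_zero ℝ 2 (volume : Measure (E d))
  | insert i s hi ih =>
    rw [Finset.sum_insert hi]
    filter_upwards [ih, Lp.coeFn_add (u i) (∑ i ∈ s, u i)] with x h1 h2
    rw [h2, Pi.add_apply, h1, Finset.sum_insert hi]

/-- Discrete Leibniz rule: the increment of `ζw` is `ζ(x+h)` times the increment of `w` plus the
increment of `ζ` times `w`, and `ζ` is bounded and Lipschitz. -/
lemma exists_mul_cutoff {ζ : E d → ℝ} (hζ : ContDiff ℝ ∞ ζ) (hc : HasCompactSupport ζ)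
    (w : V d) {K : ℝ} (hK : ∀ h, shiftNorm w h ≤ K * ‖h‖) :
    ∃ (u : V d) (K' : ℝ), 0 ≤ K' ∧ u =ᵐ[volume] (fun x => ζ x * w x) ∧
      ∀ h, shiftNorm u h ≤ K' * ‖h‖ := by
  obtain ⟨M, hM⟩ := hc.exists_bound_of_continuous hζ.continuous
  obtain ⟨L, hL⟩ := ContDiff.lipschitzWith_of_hasCompactSupport hc hζ (by simp)
  have hM' : ∀ x, |ζ x| ≤ M := hM
  have hM0 : 0 ≤ M := (abs_nonneg _).trans (hM' 0)
  have hm := memLp_mul_of_bound (μ := volume) hζ.continuous.aestronglyMeasurable hM' (Lp.memLp w)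
  refine ⟨hm.toLp, M * |K| + L * ‖w‖, by positivity, hm.coeFn_toLp, fun h => ?_⟩
  have e1 := hm.coeFn_toLp
  have e2 : ∀ᵐ x, (hm.toLp : V d) (x + h) = ζ (x + h) * w (x + h) :=
    (measurePreserving_add_right volume h).quasiMeasurePreserving.ae e1
  have hsh : ENNReal.ofReal (shiftNorm (hm.toLp : V d) h)
      ≤ ENNReal.ofReal ((M * |K| + L * ‖w‖) * ‖h‖) := by
    rw [← eLpNorm_shift]
    have e3 : (fun x => (hm.toLp : V d) (x + h) - (hm.toLp : V d) x)
        =ᵐ[volume] (fun x => ζ (x + h) * (w (x + h) - w x))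
          + fun x => (ζ (x + h) - ζ x) * w x := by
      filter_upwards [e1, e2] with x h1 h2
      rw [h1, h2]
      simp only [Pi.add_apply]
      ring
    have hwm : AEStronglyMeasurable (fun x => w (x + h)) volume :=
      ((Lp.stronglyMeasurable w).comp_measurable (measurable_add_const h)).aestronglyMeasurable
    have hζc := hζ.continuous
    have hζh : AEStronglyMeasurable (fun x => ζ (x + h)) volume :=
      Continuous.aestronglyMeasurable (by fun_prop)
    rw [eLpNorm_congr_ae e3]
    refine (eLpNorm_add_le (hζh.mul (hwm.sub (Lp.aestronglyMeasurable w)))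
      ((hζh.sub hζc.aestronglyMeasurable).mul (Lp.aestronglyMeasurable w)) one_le_two).trans ?_
    have b1 : eLpNorm (fun x => ζ (x + h) * (w (x + h) - w x)) 2 volume
        ≤ ENNReal.ofReal M * eLpNorm (fun x => w (x + h) - w x) 2 volume :=
      eLpNorm_le_mul_eLpNorm_of_ae_le_mul (Eventually.of_forall fun x => by
        rw [norm_mul]
        exact mul_le_mul_of_nonneg_right (hM' _) (norm_nonneg _)) 2
    have b2 : eLpNorm (fun x => (ζ (x + h) - ζ x) * w x) 2 volume
        ≤ ENNReal.ofReal (L * ‖h‖) * eLpNorm w 2 volume :=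
      eLpNorm_le_mul_eLpNorm_of_ae_le_mul (Eventually.of_forall fun x => by
        rw [norm_mul]
        refine mul_le_mul_of_nonneg_right ?_ (norm_nonneg _)
        have := hL.norm_sub_le (x + h) x
        simpa using this) 2
    rw [eLpNorm_shift, ← ENNReal.ofReal_mul hM0] at b1
    have b3 : eLpNorm w 2 volume = ENNReal.ofReal ‖w‖ := by
      rw [Lp.norm_def, ENNReal.ofReal_toReal (Lp.eLpNorm_ne_top w)]
    rw [b3, ← ENNReal.ofReal_mul (by positivity)] at b2
    refine (add_le_add b1 b2).trans ?_
    rw [← ENNReal.ofReal_add (mul_nonneg hM0 (shiftNorm_nonneg _ _)) (by positivity)]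
    refine ENNReal.ofReal_le_ofReal ?_
    have : M * shiftNorm w h ≤ M * (|K| * ‖h‖) := by
      gcongr
      exact (hK h).trans (by gcongr; exact le_abs_self K)
    linarith
  exact (ENNReal.ofReal_le_ofReal_iff (by positivity)).1 hsh

/-- Near every point of its closure, a `C¹` domain can be translated into itself. -/
lemma IsBoundedC1Domain.exists_inward {Ω : Set (E d)} (hΩ : IsBoundedC1Domain Ω) {x₀ : E d}
    (hx₀ : x₀ ∈ closure Ω) : ∃ (r : ℝ) (e : E d) (t₀ : ℝ), 0 < r ∧ 0 < t₀ ∧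
      ∀ t, 0 < t → t < t₀ → ∀ y ∈ closure Ω, y ∈ Metric.closedBall x₀ r → y - t • e ∈ Ω := by
  by_cases hin : x₀ ∈ Ω
  · obtain ⟨r, hr, hball⟩ := Metric.nhds_basis_closedBall.mem_iff.1 (hΩ.isOpen.mem_nhds hin)
    refine ⟨r, 0, 1, hr, one_pos, fun t _ _ y _ hy => ?_⟩
    rw [smul_zero, sub_zero]
    exact hball hy
  · have hfr : x₀ ∈ frontier Ω := by
      rw [hΩ.isOpen.frontier_eq]
      exact ⟨hx₀, hin⟩
    obtain ⟨U, hU, hxU, g, hg, hcrit, hΩU⟩ := hΩ.boundary x₀ hfr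
    have hcont : ContinuousOn (fderiv ℝ g) U := hg.continuousOn_fderiv_of_isOpen hU le_rfl
    -- A direction along which `g` increases at `x₀`, hence also nearby; moving against it strictly
    -- decreases `g`, that is, leads into `Ω`.
    obtain ⟨e, he⟩ : ∃ e, 0 < fderiv ℝ g x₀ e := by
      obtain ⟨e, he⟩ := DFunLike.ne_iff.1 (hcrit x₀ hxU)
      rcases lt_or_gt_of_ne he with h | h
      · exact ⟨-e, by rw [map_neg]; simpa using h⟩
      · exact ⟨e, h⟩
    have hev : ∀ᶠ y in 𝓝 x₀, y ∈ U ∧ 0 < fderiv ℝ g y e := by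
      refine (hU.eventually_mem hxU).and ?_
      have h1 : ContinuousAt (fun y => fderiv ℝ g y e) x₀ :=
        (hcont.continuousAt (hU.mem_nhds hxU)).clm_apply continuousAt_const
      exact h1.eventually (lt_mem_nhds he)
    obtain ⟨R, hR, hball⟩ := Metric.eventually_nhds_iff_ball.1 hev
    have hene : 0 < ‖e‖ := norm_pos_iff.2 (by
      rintro rfl
      simp at he)
    -- A start within `R/2` and a displacement shorter than `R/2` keep the whole segment in the ball
    -- of radius `R`.
    refine ⟨R / 2, e, R / (2 * ‖e‖), by positivity, by positivity, fun t ht ht' y hy hyB => ?_⟩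
    have hte : t * ‖e‖ < R / 2 := by
      rw [lt_div_iff₀ (by positivity)] at ht'
      linarith
    have hline : ∀ s ∈ Set.Icc 0 t, y - s • e ∈ Metric.ball x₀ R := by
      intro s hs
      rw [Metric.mem_ball, dist_eq_norm]
      rw [Metric.mem_closedBall, dist_eq_norm] at hyB
      have h1 : ‖y - s • e - x₀‖ ≤ ‖y - x₀‖ + ‖s • e‖ := by
        have := norm_sub_le (y - x₀) (s • e)
        rwa [sub_right_comm] at this
      rw [norm_smul, Real.norm_of_nonneg hs.1] at h1
      have : s * ‖e‖ ≤ t * ‖e‖ := by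
        gcongr
        exact hs.2
      linarith
    have hgd : ∀ z ∈ Metric.ball x₀ R, HasFDerivAt g (fderiv ℝ g z) z := fun z hz =>
      ((hg.differentiableOn one_ne_zero).differentiableAt
        (hU.mem_nhds (hball z hz).1)).hasFDerivAt
    have hder : ∀ s ∈ Set.Icc 0 t,
        HasDerivAt (fun s : ℝ => g (y - s • e)) (-(fderiv ℝ g (y - s • e) e)) s := by
      intro s hs
      have h1 : HasDerivAt (fun s : ℝ => y - s • e) (-e) s := by
        simpa using ((hasDerivAt_id s).smul_const e).const_sub y
      have := (hgd _ (hline s hs)).comp_hasDerivAt s h1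
      rw [map_neg] at this
      exact this
    have hy0 : y - (0 : ℝ) • e = y := by simp
    have hyball := hline 0 ⟨le_rfl, ht.le⟩
    rw [hy0] at hyball
    have hgy : g y ≤ 0 := by
      by_contra! hpos
      have hc : ContinuousAt g y := (hgd y hyball).continuousAt
      have h2 : ∀ᶠ z in 𝓝 y, 0 < g z ∧ z ∈ U :=
        (hc.eventually (lt_mem_nhds hpos)).and (hU.eventually_mem (hball y hyball).1)
      obtain ⟨z, hz, hzΩ⟩ := mem_closure_iff_nhds.1 hy _ h2
      have h3 : z ∈ Ω ∩ U := ⟨hzΩ, hz.2⟩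
      rw [hΩU] at h3
      exact absurd h3.2 (not_lt.2 hz.1.le)
    have hanti : StrictAntiOn (fun s : ℝ => g (y - s • e)) (Set.Icc 0 t) := by
      refine strictAntiOn_of_deriv_neg (convex_Icc 0 t)
        (fun s hs => (hder s hs).continuousAt.continuousWithinAt) fun s hs => ?_
      have hs' := interior_subset hs
      rw [(hder s hs').deriv, neg_lt_zero]
      exact (hball _ (hline s hs')).2
    have hlt := hanti ⟨le_rfl, ht.le⟩ ⟨ht.le, le_rfl⟩ ht
    simp only [hy0] at hlt
    have h4 : y - t • e ∈ {y ∈ U | g y < 0} :=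
      ⟨(hball _ (hline t ⟨ht.le, le_rfl⟩)).1, hlt.trans_le hgy⟩
    rw [← hΩU] at h4
    exact h4.1

/-- A function with an `L²` Lipschitz modulus whose support can be translated inwards is a limit
of test functions with bounded gradients. -/
lemma isGradientBoundedLimit_of_inward {Ω S : Set (E d)} (hΩ : IsOpen Ω) (hS : IsCompact S)
    {e : E d} {t₀ : ℝ} (ht₀ : 0 < t₀) (hin : ∀ t, 0 < t → t < t₀ → ∀ y ∈ S, y - t • e ∈ Ω)
    {u : V d} (hu : ∀ᵐ x, x ∉ S → u x = 0) {K : ℝ} (hK0 : 0 ≤ K)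
    (hK : ∀ h, shiftNorm u h ≤ K * ‖h‖) : IsGradientBoundedLimit Ω u := by
  refine ⟨d * K, fun η hη => ?_⟩
  -- The translation costs at most `η/2` in `L²` and moves the support to a compact subset of `Ω`.
  -- The mollification radius `δ` is then chosen to cost another `η/2` without leaving `Ω`.
  set t := min (t₀ / 2) (η / (2 * (K + 1) * (‖e‖ + 1))) with ht
  have htpos : 0 < t := by positivity
  have htt₀ : t < t₀ := (min_le_left _ _).trans_lt (by linarith)
  have hKt : K * ‖t • e‖ ≤ η / 2 := by
    rw [norm_smul, Real.norm_of_nonneg htpos.le]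
    calc K * (t * ‖e‖) ≤ (K + 1) * (η / (2 * (K + 1) * (‖e‖ + 1)) * (‖e‖ + 1)) := by
          gcongr
          · linarith
          · exact min_le_right _ _
          · linarith
      _ = η / 2 := by field_simp
  set S' : Set (E d) := (fun y => y - t • e) '' S with hS'
  have hS'c : IsCompact S' := hS.image (by fun_prop)
  have hS'Ω : S' ⊆ Ω := by
    rintro _ ⟨y, hy, rfl⟩
    exact hin t htpos htt₀ y hy
  obtain ⟨δ₀, hδ₀, hthick⟩ := hS'c.exists_cthickening_subset_open hΩ hS'Ω
  set δ := min δ₀ (η / (2 * (K + 1))) with hδ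
  have hδpos : 0 < δ := by positivity
  have hKδ : K * δ ≤ η / 2 := by
    calc K * δ ≤ (K + 1) * (η / (2 * (K + 1))) := by
          gcongr
          · linarith
          · exact min_le_right _ _
      _ = η / 2 := by field_simp
  obtain ⟨ρ, hρ⟩ := exists_isMollifier d hδpos
  set w := tr (t • e) u with hw
  have hwS : ∀ᵐ x, x ∉ S' → w x = 0 := by
    filter_upwards [coeFn_tr (t • e) u,
      (measurePreserving_add_right volume (t • e)).quasiMeasurePreserving.ae hu] with x h1 h2 hx
    rw [hw, h1]
    refine h2 fun hxS => hx ⟨_, hxS, ?_⟩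
    simp
  have hzero : ∀ x, x ∉ Metric.cthickening δ S' → moll ρ w x = 0 := by
    intro x hx
    refine hρ.moll_eq_zero ?_
    filter_upwards [hwS] with y hy hxy
    refine hy fun hyS => hx ?_
    exact Metric.mem_cthickening_of_dist_le x y δ S' hyS (by rw [dist_eq_norm]; exact hxy.le)
  have hts : tsupport (moll ρ w) ⊆ Metric.cthickening δ S' :=
    closure_minimal (fun x hx => by
      by_contra hx'
      exact hx (hzero x hx')) Metric.isClosed_cthickening
  have htest : IsTestFunction Ω (moll ρ w) :=
    ⟨hρ.contDiff_moll w, HasCompactSupport.of_support_subset_isCompact hS'c.cthickening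
      (subset_closure.trans hts),
      hts.trans ((Metric.cthickening_mono (min_le_left _ _) S').trans hthick)⟩
  refine ⟨_, htest, ?_, ?_⟩
  · have b1 : eLpNorm (fun x => moll ρ w x - w x) 2 volume ≤ ENNReal.ofReal (K * δ) :=
      hρ.eLpNorm_moll_sub_le w fun h hh => by
        rw [hw, shiftNorm_tr]
        exact (hK h).trans (by gcongr)
    have b2 : eLpNorm (fun x => w x - u x) 2 volume ≤ ENNReal.ofReal (K * ‖t • e‖) := by
      have e1 : (fun x => w x - u x) =ᵐ[volume] fun x => u (x + t • e) - u x := by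
        filter_upwards [coeFn_tr (t • e) u] with x h1
        rw [hw, h1]
      rw [eLpNorm_congr_ae e1, eLpNorm_shift]
      exact ENNReal.ofReal_le_ofReal (hK _)
    have e2 : (fun x => moll ρ w x - u x) = (fun x => moll ρ w x - w x) + fun x => w x - u x := by
      ext x
      simp
    rw [e2]
    refine (eLpNorm_add_le (htest.memLp.sub (Lp.memLp w)).1 ((Lp.memLp w).sub (Lp.memLp u)).1
      one_le_two).trans ((add_le_add b1 b2).trans ?_)
    rw [← ENNReal.ofReal_add (by positivity) (by positivity)]
    exact ENNReal.ofReal_le_ofReal (by linarith)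
  · refine (eLpNorm_gradient_le htest.1 (K := K) fun z => ?_).trans (le_of_eq ?_)
    · refine (hρ.eLpNorm_moll_shift_le w z).trans (ENNReal.ofReal_le_ofReal ?_)
      rw [hw, shiftNorm_tr]
      exact hK z
    · rw [ENNReal.ofReal_mul (by positivity), ENNReal.ofReal_natCast]

/-- A function vanishing outside a bounded `C¹` domain with an `L²` Lipschitz modulus of
continuity belongs to `H¹₀`. -/
lemma memH10_of_shiftNorm {Ω : Set (E d)} (hΩ : IsBoundedC1Domain Ω) {w : V d}
    (hw : ∀ᵐ x, x ∉ Ω → w x = 0) {K : ℝ} (hK : ∀ h, shiftNorm w h ≤ K * ‖h‖) :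
    MemH10 Ω w := by
  have hcpt : IsCompact (closure Ω) := hΩ.isBounded.isCompact_closure
  choose! r e t₀ hr ht₀ hin using fun x (hx : x ∈ closure Ω) => hΩ.exists_inward hx
  obtain ⟨T, hT, hcov⟩ := hcpt.elim_nhds_subcover (fun x => Metric.ball x (r x))
    fun x hx => Metric.ball_mem_nhds x (hr x hx)
  -- Each piece `F i * w` lives in a ball where one inward direction serves all points of the
  -- closure, so a single translation handles its whole support.
  obtain ⟨F, hF⟩ := SmoothPartitionOfUnity.exists_isSubordinate (modelWithCornersSelf ℝ (E d))
    isClosed_closure (fun x : T => Metric.ball (x : E d) (r x)) (fun x => Metric.isOpen_ball)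
    (hcov.trans (by simp [Set.iUnion_subtype]))
  have hFsmooth : ∀ i, ContDiff ℝ ∞ (F i) := fun i => (F i).contMDiff.contDiff
  have hFts : ∀ i : T, tsupport (F i) ⊆ Metric.closedBall (i : E d) (r i) := fun i =>
    (hF i).trans Metric.ball_subset_closedBall
  have hFc : ∀ i, HasCompactSupport (F i) := fun i =>
    HasCompactSupport.of_support_subset_isCompact (isCompact_closedBall _ _)
      (subset_closure.trans (hFts i))
  choose u K' hK'0 hu hK' using fun i => exists_mul_cutoff (hFsmooth i) (hFc i) w hK
  have hsum : w = ∑ i, u i := by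
    refine Lp.ext ?_
    have h1 : ∀ᵐ x, ∀ i, u i x = F i x * w x := (eventually_countable_forall).2 hu
    filter_upwards [hw, h1, coeFn_sum Finset.univ u] with x h2 h3 h4
    rw [h4]
    simp only [h3]
    rw [← Finset.sum_mul]
    by_cases hx : x ∈ Ω
    · have := F.sum_eq_one (subset_closure hx)
      rw [finsum_eq_sum_of_fintype] at this
      rw [this, one_mul]
    · rw [h2 hx, mul_zero]
  rw [hsum]
  refine (IsGradientBoundedLimit.sum _ fun i _ => ?_).memH10
  refine isGradientBoundedLimit_of_inward hΩ.isOpen (S := closure Ω ∩ tsupport (F i))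
    (hcpt.inter_right isClosed_closure) (ht₀ i (hT i i.2))
    (fun t h1 h2 y hy => hin i (hT i i.2) t h1 h2 y hy.1 (hFts i hy.2)) ?_ (hK'0 i) (hK' i)
  filter_upwards [hu i, hw] with x h1 h2 hx
  rw [h1]
  by_cases hxΩ : x ∈ Ω
  · have : x ∉ tsupport (F i) := fun h => hx ⟨subset_closure hxΩ, h⟩
    rw [image_eq_zero_of_notMem_tsupport this, zero_mul]
  · rw [h2 hxΩ, mul_zero]

/-! ### Balanced kernels and their energy -/

/-- A nonnegative kernel whose row and column integrals coincide. -/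
structure IsBalancedKernel (M : E d → E d → ℝ) (m : E d → ℝ) : Prop where
  continuous : Continuous fun q : E d × E d => M q.1 q.2
  nonneg : ∀ x y, 0 ≤ M x y
  continuous_mass : Continuous m
  exists_bound : ∃ C, 0 ≤ C ∧ (∀ x y, M x y ≤ C) ∧ ∀ x, m x ≤ C
  integrable_right : ∀ x, Integrable fun y => M x y
  integral_right : ∀ x, ∫ y, M x y = m x
  integrable_left : ∀ y, Integrable fun x => M x y
  integral_left : ∀ y, ∫ x, M x y = m y

/-- The energy `∬ M(x,y) (u(x) - u(y))² dx dy`. -/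
def energy (M : E d → E d → ℝ) (u : E d → ℝ) : ℝ :=
  ∫ q : E d × E d, M q.1 q.2 * (u q.1 - u q.2) ^ 2

lemma Lp_norm_sq {α : Type*} [MeasurableSpace α] {ν : Measure α} (f : Lp ℝ 2 ν) :
    ‖f‖ ^ 2 = ∫ x, f x ^ 2 ∂ν := by
  rw [← real_inner_self_eq_norm_sq, L2.inner_def]
  congr 1
  ext x
  simp [sq]

namespace IsBalancedKernel

variable {M : E d → E d → ℝ} {m : E d → ℝ} {u w : E d → ℝ}

lemma swap (hM : IsBalancedKernel M m) : IsBalancedKernel (fun x y => M y x) m where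
  continuous := hM.continuous.comp continuous_swap
  nonneg x y := hM.nonneg y x
  continuous_mass := hM.continuous_mass
  exists_bound := by
    obtain ⟨C, h0, h1, h2⟩ := hM.exists_bound
    exact ⟨C, h0, fun x y => h1 y x, h2⟩
  integrable_right := hM.integrable_left
  integral_right := hM.integral_left
  integrable_left := hM.integrable_right
  integral_left := hM.integral_right

lemma mass_nonneg (hM : IsBalancedKernel M m) (x : E d) : 0 ≤ m x := by
  rw [← hM.integral_right x]
  exact integral_nonneg (hM.nonneg x)

lemma integrable_mass_mul (hM : IsBalancedKernel M m) (hu : Integrable u) :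
    Integrable fun x => m x * u x := by
  obtain ⟨C, h0, h1, h2⟩ := hM.exists_bound
  exact hu.bdd_mul (c := C) hM.continuous_mass.aestronglyMeasurable
    (Eventually.of_forall fun x => by
      rw [Real.norm_of_nonneg (hM.mass_nonneg x)]
      exact h2 x)

lemma integrable_sq_left (hM : IsBalancedKernel M m) (hu : MemLp u 2 volume) :
    Integrable (fun q : E d × E d => M q.1 q.2 * u q.1 ^ 2) := by
  have hmeas : AEStronglyMeasurable (fun q : E d × E d => M q.1 q.2 * u q.1 ^ 2)
      ((volume : Measure (E d)).prod volume) :=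
    hM.continuous.aestronglyMeasurable.mul (hu.1.comp_fst.pow 2)
  refine (integrable_prod_iff hmeas).2 ⟨Eventually.of_forall fun x =>
    (hM.integrable_right x).mul_const (u x ^ 2), ?_⟩
  have : (fun x => ∫ y, ‖M x y * u x ^ 2‖) = fun x => m x * u x ^ 2 := by
    ext x
    rw [← hM.integral_right x, ← integral_mul_const]
    congr 1
    ext y
    exact Real.norm_of_nonneg (mul_nonneg (hM.nonneg x y) (sq_nonneg _))
  simp only [this]
  exact hM.integrable_mass_mul hu.integrable_sq

lemma integral_sq_left (hM : IsBalancedKernel M m) (hu : MemLp u 2 volume) :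
    ∫ q : E d × E d, M q.1 q.2 * u q.1 ^ 2 = ∫ x, m x * u x ^ 2 := by
  have h := integral_prod _ (hM.integrable_sq_left hu)
  refine h.trans (integral_congr_ae (Eventually.of_forall fun x => ?_))
  simp only
  rw [integral_mul_const, hM.integral_right x]

lemma integrable_sq_right (hM : IsBalancedKernel M m) (hu : MemLp u 2 volume) :
    Integrable (fun q : E d × E d => M q.1 q.2 * u q.2 ^ 2) :=
  (hM.swap.integrable_sq_left hu).swap

lemma integral_sq_right (hM : IsBalancedKernel M m) (hu : MemLp u 2 volume) :
    ∫ q : E d × E d, M q.1 q.2 * u q.2 ^ 2 = ∫ x, m x * u x ^ 2 := by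
  rw [← hM.swap.integral_sq_left hu]
  exact (integral_prod_swap (μ := (volume : Measure (E d))) (ν := (volume : Measure (E d)))
    fun q => M q.1 q.2 * u q.2 ^ 2).symm

lemma integrable_mul (hM : IsBalancedKernel M m) (hu : MemLp u 2 volume) (hw : MemLp w 2 volume) :
    Integrable (fun q : E d × E d => M q.1 q.2 * (u q.1 * w q.2)) := by
  refine ((hM.integrable_sq_left hu).add (hM.integrable_sq_right hw)).mono'
    (hM.continuous.aestronglyMeasurable.mul (hu.1.comp_fst.mul hw.1.comp_snd))
    (Eventually.of_forall fun q => ?_)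
  rw [norm_mul, Real.norm_of_nonneg (hM.nonneg _ _), Pi.add_apply, ← mul_add]
  refine mul_le_mul_of_nonneg_left ?_ (hM.nonneg _ _)
  rw [norm_mul, Real.norm_eq_abs, Real.norm_eq_abs, ← sq_abs (u q.1), ← sq_abs (w q.2)]
  nlinarith [sq_nonneg (|u q.1| - |w q.2|), abs_nonneg (u q.1), abs_nonneg (w q.2)]

lemma integral_mul (hM : IsBalancedKernel M m) (hu : MemLp u 2 volume) (hw : MemLp w 2 volume) :
    ∫ q : E d × E d, M q.1 q.2 * (u q.1 * w q.2) = ∫ x, u x * ∫ y, M x y * w y := by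
  refine (integral_prod _ (hM.integrable_mul hu hw)).trans
    (integral_congr_ae (Eventually.of_forall fun x => ?_))
  simp only
  rw [← integral_const_mul]
  congr 1
  ext y
  ring

lemma integral_mul' (hM : IsBalancedKernel M m) (hu : MemLp u 2 volume) (hw : MemLp w 2 volume) :
    ∫ x, u x * ∫ y, M x y * w y = ∫ y, w y * ∫ x, M x y * u x := by
  rw [← hM.integral_mul hu hw, ← hM.swap.integral_mul hw hu]
  refine (integral_prod_swap (μ := (volume : Measure (E d))) (ν := (volume : Measure (E d)))
    _).symm.trans ?_
  congr 1
  ext q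
  simp only [Prod.fst_swap, Prod.snd_swap]
  ring

lemma integrable_mul_integral (hM : IsBalancedKernel M m) (hu : MemLp u 2 volume)
    (hw : MemLp w 2 volume) : Integrable fun x => u x * ∫ y, M x y * w y := by
  refine (hM.integrable_mul hu hw).integral_prod_left.congr (Eventually.of_forall fun x => ?_)
  simp only
  rw [← integral_const_mul]
  congr 1
  ext y
  ring

lemma integrable_energy (hM : IsBalancedKernel M m) (hu : MemLp u 2 volume) :
    Integrable (fun q : E d × E d => M q.1 q.2 * (u q.1 - u q.2) ^ 2) := by
  refine (((hM.integrable_sq_left hu).add (hM.integrable_sq_right hu)).sub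
    ((hM.integrable_mul hu hu).const_mul 2)).congr (Eventually.of_forall fun q => ?_)
  simp only [Pi.sub_apply, Pi.add_apply]
  ring

lemma energy_nonneg (hM : IsBalancedKernel M m) : 0 ≤ energy M u :=
  integral_nonneg fun _ => mul_nonneg (hM.nonneg _ _) (sq_nonneg _)

/-- After expanding the square, both diagonal terms integrate to `∫ m u²` because row and column
masses agree. Symmetry of `M` is not needed. -/
lemma energy_eq (hM : IsBalancedKernel M m) (hu : MemLp u 2 volume) :
    energy M u = 2 * ∫ x, (m x * u x - ∫ y, M x y * u y) * u x := by
  have e1 : ∀ q : E d × E d, M q.1 q.2 * (u q.1 - u q.2) ^ 2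
      = M q.1 q.2 * u q.1 ^ 2 + M q.1 q.2 * u q.2 ^ 2 - 2 * (M q.1 q.2 * (u q.1 * u q.2)) :=
    fun q => by ring
  have e2 : ∀ x, (m x * u x - ∫ y, M x y * u y) * u x
      = m x * u x ^ 2 - u x * ∫ y, M x y * u y := fun x => by ring
  simp only [energy, e1, e2]
  rw [integral_sub, integral_add, integral_const_mul, hM.integral_sq_left hu,
    hM.integral_sq_right hu, hM.integral_mul hu hu, integral_sub
    (hM.integrable_mass_mul hu.integrable_sq) (hM.integrable_mul_integral hu hu)]
  · ring
  · exact hM.integrable_sq_left hu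
  · exact hM.integrable_sq_right hu
  · exact (hM.integrable_sq_left hu).add (hM.integrable_sq_right hu)
  · exact (hM.integrable_mul hu hu).const_mul 2

lemma integrable_quad (hM : IsBalancedKernel M m) (hu : MemLp u 2 volume) :
    Integrable fun x => (m x * u x - ∫ y, M x y * u y) * u x := by
  refine ((hM.integrable_mass_mul hu.integrable_sq).sub (hM.integrable_mul_integral hu hu)).congr
    (Eventually.of_forall fun x => ?_)
  simp only [Pi.sub_apply]
  ring

/-- The a priori estimate for the resolvent equation. -/
lemma apriori (hM : IsBalancedKernel M m) {Ω : Set (E d)} {μ : E d → ℝ}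
    (hμc : Continuous μ) {μ₀ μ₁ e : ℝ} (hμ₀ : 0 < μ₀) (hμ : ∀ x, μ₀ ≤ μ x) (hμ' : ∀ x, μ x ≤ μ₁)
    {v : V d} {f : Lp ℝ 2 (volume.restrict Ω)} (hv : ∀ᵐ x, x ∉ Ω → v x = 0)
    (heq : ∀ᵐ x ∂(volume.restrict Ω),
      e * (m x * v x - ∫ y, M x y * v y) + μ x * v x = μ x * f x) :
    μ₀ * ‖v‖ ^ 2 + e * energy M v ≤ μ₁ ^ 2 / μ₀ * ‖f‖ ^ 2 := by
  have hvm := Lp.memLp v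
  have hμb : Integrable fun x => μ x * v x ^ 2 :=
    hvm.integrable_sq.bdd_mul (c := μ₁) hμc.aestronglyMeasurable (Eventually.of_forall fun x => by
      rw [Real.norm_of_nonneg (hμ₀.le.trans (hμ x))]
      exact hμ' x)
  have hF : Integrable fun x => e * ((m x * v x - ∫ y, M x y * v y) * v x) + μ x * v x ^ 2 :=
    ((hM.integrable_quad hvm).const_mul e).add hμb
  have h1 : ∫ x, (e * ((m x * v x - ∫ y, M x y * v y) * v x) + μ x * v x ^ 2)
      = e * energy M v / 2 + ∫ x, μ x * v x ^ 2 := by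
    rw [integral_add ((hM.integrable_quad hvm).const_mul e) hμb, integral_const_mul,
      hM.energy_eq hvm]
    ring
  have h2 : ∫ x, (e * ((m x * v x - ∫ y, M x y * v y) * v x) + μ x * v x ^ 2)
      = ∫ x in Ω, (e * ((m x * v x - ∫ y, M x y * v y) * v x) + μ x * v x ^ 2) := by
    symm
    refine setIntegral_eq_integral_of_ae_compl_eq_zero ?_
    filter_upwards [hv] with x hx hxΩ
    rw [hx hxΩ]
    ring
  have hf2 : Integrable (fun x => f x ^ 2) (volume.restrict Ω) := (Lp.memLp f).integrable_sq
  have h3 : ∫ x in Ω, (e * ((m x * v x - ∫ y, M x y * v y) * v x) + μ x * v x ^ 2)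
      ≤ ∫ x in Ω, (1 / 2 * (μ x * v x ^ 2) + μ₁ ^ 2 / (2 * μ₀) * f x ^ 2) := by
    refine integral_mono_ae hF.integrableOn
      (((hμb.integrableOn).const_mul _).add (hf2.const_mul _)) ?_
    filter_upwards [heq] with x hx
    have e1 : e * ((m x * v x - ∫ y, M x y * v y) * v x) + μ x * v x ^ 2
        = μ x * f x * v x := by
      rw [← hx]
      ring
    rw [e1]
    have hpos : 0 < μ x := hμ₀.trans_le (hμ x)
    have e2 : μ x * f x * v x ≤ 1 / 2 * (μ x * v x ^ 2) + 1 / 2 * (μ x * f x ^ 2) := by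
      -- Young's inequality; half of `∫ μ v²` is absorbed on the left, and afterwards `μ ≤ μ₁²/μ₀`.
      nlinarith [mul_nonneg hpos.le (sq_nonneg (f x - v x))]
    have e3 : 1 / 2 * (μ x * f x ^ 2) ≤ μ₁ ^ 2 / (2 * μ₀) * f x ^ 2 := by
      rw [← mul_assoc]
      refine mul_le_mul_of_nonneg_right ?_ (sq_nonneg _)
      rw [le_div_iff₀ (by positivity)]
      have := hμ x
      have := hμ' x
      nlinarith
    linarith
  rw [integral_add ((hμb.integrableOn).const_mul _) (hf2.const_mul _), integral_const_mul,
    integral_const_mul] at h3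
  have h4 : ∫ x in Ω, μ x * v x ^ 2 = ∫ x, μ x * v x ^ 2 := by
    refine setIntegral_eq_integral_of_ae_compl_eq_zero ?_
    filter_upwards [hv] with x hx hxΩ
    rw [hx hxΩ]
    ring
  have h5 : μ₀ * ‖v‖ ^ 2 ≤ ∫ x, μ x * v x ^ 2 := by
    rw [Lp_norm_sq, ← integral_const_mul]
    exact integral_mono (hvm.integrable_sq.const_mul _) hμb fun x =>
      mul_le_mul_of_nonneg_right (hμ x) (sq_nonneg _)
  rw [← h2, h1, h4, ← Lp_norm_sq] at h3
  have h6 : μ₁ ^ 2 / μ₀ * ‖f‖ ^ 2 = 2 * (μ₁ ^ 2 / (2 * μ₀) * ‖f‖ ^ 2) := by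
    field_simp
  linarith

/-- A kernel bounded below near the diagonal controls small shifts. -/
lemma integral_shiftNorm_sq_le (hM : IsBalancedKernel M m) {ρ m₀ : ℝ} (hm₀ : 0 < m₀)
    (hlow : ∀ x h, ‖h‖ < ρ → m₀ ≤ M x (x + h)) (v : V d) :
    ∫ h in Metric.ball (0 : E d) ρ, shiftNorm v h ^ 2 ≤ m₀⁻¹ * energy M v := by
  have hvm := Lp.memLp v
  have hvs := Lp.stronglyMeasurable v
  have hen := hM.integrable_energy hvm
  have hsh : ∀ h, ENNReal.ofReal (shiftNorm v h ^ 2) = ∫⁻ x, ‖v (x + h) - v x‖ₑ ^ 2 := by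
    intro h
    rw [ENNReal.ofReal_pow (shiftNorm_nonneg _ _), ← eLpNorm_shift, sq_eLpNorm_two]
  have hInt : IntegrableOn (fun h => shiftNorm v h ^ 2) (Metric.ball (0 : E d) ρ) :=
    (((continuous_shiftNorm v).pow 2).continuousOn.integrableOn_compact
      (isCompact_closedBall 0 ρ)).mono_set Metric.ball_subset_closedBall
  have key : ENNReal.ofReal (∫ h in Metric.ball (0 : E d) ρ, shiftNorm v h ^ 2)
      ≤ ENNReal.ofReal (m₀⁻¹ * energy M v) := by
    rw [ofReal_integral_eq_lintegral_ofReal hInt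
      (Eventually.of_forall fun h => sq_nonneg _)]
    have hmeas : Measurable fun q : E d × E d => ‖v (q.2 + q.1) - v q.2‖ₑ ^ 2 :=
      (((hvs.measurable.comp (measurable_snd.add measurable_fst)).sub
        (hvs.measurable.comp measurable_snd)).enorm).pow_const 2
    have hmeas2 : Measurable fun q : E d × E d =>
        ENNReal.ofReal (m₀⁻¹ * (M q.1 q.2 * (v q.1 - v q.2) ^ 2)) :=
      (measurable_const.mul (hM.continuous.measurable.mul
        (((hvs.measurable.comp measurable_fst).sub
        (hvs.measurable.comp measurable_snd)).pow_const 2))).ennreal_ofReal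
    -- On `‖h‖ < ρ` the factor `m₀⁻¹ M(x,x+h)` is at least `1` and may be inserted. Tonelli and `y =
    -- x + h` then rebuild the energy.
    calc ∫⁻ h in Metric.ball (0 : E d) ρ, ENNReal.ofReal (shiftNorm v h ^ 2)
        = ∫⁻ h in Metric.ball (0 : E d) ρ, ∫⁻ x, ‖v (x + h) - v x‖ₑ ^ 2 := by simp only [hsh]
      _ ≤ ∫⁻ h in Metric.ball (0 : E d) ρ,
            ∫⁻ x, ENNReal.ofReal (m₀⁻¹ * (M x (x + h) * (v x - v (x + h)) ^ 2)) := by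
          refine setLIntegral_mono' Metric.isOpen_ball.measurableSet fun h hh => ?_
          refine lintegral_mono fun x => ?_
          rw [mem_ball_zero_iff] at hh
          rw [Real.enorm_eq_ofReal_abs, ← ENNReal.ofReal_pow (abs_nonneg _), sq_abs]
          refine ENNReal.ofReal_le_ofReal ?_
          rw [← mul_assoc]
          have h1 : 1 ≤ m₀⁻¹ * M x (x + h) := by
            rw [inv_mul_eq_div, one_le_div hm₀]
            exact hlow x h hh
          nlinarith [sq_nonneg (v x - v (x + h))]
      _ ≤ ∫⁻ h, ∫⁻ x, ENNReal.ofReal (m₀⁻¹ * (M x (x + h) * (v x - v (x + h)) ^ 2)) :=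
          setLIntegral_le_lintegral _ _
      _ = ∫⁻ x, ∫⁻ h, ENNReal.ofReal (m₀⁻¹ * (M x (x + h) * (v x - v (x + h)) ^ 2)) := by
          refine lintegral_lintegral_swap ?_
          exact (hmeas2.comp (measurable_snd.prodMk
            (measurable_snd.add measurable_fst))).aemeasurable
      _ = ∫⁻ x, ∫⁻ y, ENNReal.ofReal (m₀⁻¹ * (M x y * (v x - v y) ^ 2)) := by
          refine lintegral_congr fun x => ?_
          exact lintegral_add_left_eq_self
            (fun y => ENNReal.ofReal (m₀⁻¹ * (M x y * (v x - v y) ^ 2))) x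
      _ = ∫⁻ q : E d × E d, ENNReal.ofReal (m₀⁻¹ * (M q.1 q.2 * (v q.1 - v q.2) ^ 2)) :=
          (lintegral_prod _ hmeas2.aemeasurable).symm
      _ = ENNReal.ofReal (m₀⁻¹ * energy M v) := by
          rw [energy, ← integral_const_mul, ofReal_integral_eq_lintegral_ofReal
            (hen.const_mul _) (Eventually.of_forall fun q => ?_)]
          have := hM.nonneg q.1 q.2
          positivity
  exact (ENNReal.ofReal_le_ofReal_iff (mul_nonneg (by positivity) hM.energy_nonneg)).1 key

end IsBalancedKernel

/-! ### Solvability -/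

/-- A bounded linear operator on `L²` from its values on representatives. -/
lemma exists_clm_of_ae {α : Type*} [MeasurableSpace α] {ν : Measure α}
    {F : Lp ℝ 2 ν → α → ℝ} {C : ℝ} (hm : ∀ v, AEStronglyMeasurable (F v) ν)
    (hadd : ∀ v w, F (v + w) =ᵐ[ν] fun x => F v x + F w x)
    (hsmul : ∀ (c : ℝ) v, F (c • v) =ᵐ[ν] fun x => c * F v x)
    (hb : ∀ v, eLpNorm (F v) 2 ν ≤ ENNReal.ofReal (C * ‖v‖)) :
    ∃ T : Lp ℝ 2 ν →L[ℝ] Lp ℝ 2 ν, ∀ v, T v =ᵐ[ν] F v := by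
  have hmem : ∀ v, MemLp (F v) 2 ν := fun v => ⟨hm v, (hb v).trans_lt ENNReal.ofReal_lt_top⟩
  let T : Lp ℝ 2 ν →ₗ[ℝ] Lp ℝ 2 ν :=
    { toFun := fun v => (hmem v).toLp
      map_add' := fun v w => by
        refine Lp.ext ?_
        filter_upwards [(hmem (v + w)).coeFn_toLp, (hmem v).coeFn_toLp, (hmem w).coeFn_toLp,
          hadd v w, Lp.coeFn_add (hmem v).toLp (hmem w).toLp] with x h1 h2 h3 h4 h5
        rw [h1, h4, h5, Pi.add_apply, h2, h3]
      map_smul' := fun c v => by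
        refine Lp.ext ?_
        filter_upwards [(hmem (c • v)).coeFn_toLp, (hmem v).coeFn_toLp,
          hsmul c v, Lp.coeFn_smul c (hmem v).toLp] with x h1 h2 h3 h4
        simp only [RingHom.id_apply]
        rw [h1, h3, h4, Pi.smul_apply, h2, smul_eq_mul] }
  refine ⟨T.mkContinuous (max C 0) fun v => ?_, fun v => (hmem v).coeFn_toLp⟩
  change ‖(hmem v).toLp‖ ≤ _
  rw [Lp.norm_toLp]
  refine ENNReal.toReal_le_of_le_ofReal (by positivity) ((hb v).trans ?_)
  exact ENNReal.ofReal_le_ofReal (by gcongr; exact le_max_left _ _)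

/-- A coercive bounded operator is onto. -/
lemma surjective_of_coercive {H : Type*} [NormedAddCommGroup H] [InnerProductSpace ℝ H]
    [CompleteSpace H] (T : H →L[ℝ] H) {c : ℝ} (hc : 0 < c)
    (h : ∀ v, c * ‖v‖ ^ 2 ≤ inner ℝ (T v) v) : Function.Surjective T := by
  have hB : IsCoercive ((innerSL ℝ).comp T : H →L[ℝ] H →L[ℝ] ℝ) :=
    ⟨c, hc, fun u => by
      rw [mul_assoc, ← sq]
      exact h u⟩
  have e : ∀ v, hB.continuousLinearEquivOfBilin v = T v := fun v =>
    ext_inner_right ℝ fun w => hB.continuousLinearEquivOfBilin_apply v w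
  intro f
  obtain ⟨v, hv⟩ := hB.continuousLinearEquivOfBilin.surjective f
  exact ⟨v, (e v).symm.trans hv⟩

/-- Lax–Milgram on `L²(Ω)`. Applied to the zero extension, `energy_eq` makes the nonlocal part
nonnegative, so the form is coercive with the constant `μ₀`. -/
lemma IsBalancedKernel.exists_solution {M : E d → E d → ℝ} {m : E d → ℝ}
    (hM : IsBalancedKernel M m) {Ω : Set (E d)} (hΩ : MeasurableSet Ω)
    (hΩf : volume Ω < ⊤) {μ : E d → ℝ}
    (hμc : Continuous μ) {μ₀ μ₁ e : ℝ} (he : 0 ≤ e) (hμ₀ : 0 < μ₀) (hμ : ∀ x, μ₀ ≤ μ x)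
    (hμ' : ∀ x, μ x ≤ μ₁) (f : Lp ℝ 2 (volume.restrict Ω)) :
    ∃ v : V d, (∀ᵐ x, x ∉ Ω → v x = 0) ∧ ∀ᵐ x ∂(volume.restrict Ω),
      e * (m x * v x - ∫ y, M x y * v y) + μ x * v x = μ x * f x := by
  obtain ⟨C, hC0, hMC, hmC⟩ := hM.exists_bound
  have hfin : IsFiniteMeasure (volume.restrict Ω) := ⟨by rwa [Measure.restrict_apply_univ]⟩
  have hμ₁ : 0 ≤ μ₁ := (hμ₀.le.trans (hμ 0)).trans (hμ' 0)
  let F : Lp ℝ 2 (volume.restrict Ω) → E d → ℝ := fun v x =>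
    e * (m x * v x - ∫ y, M x y * v y ∂(volume.restrict Ω)) + μ x * v x
  have hMx : ∀ (v : Lp ℝ 2 (volume.restrict Ω)) x, Integrable (fun y => M x y * v y) (volume.restrict Ω) := fun v x =>
    ((Lp.memLp v).integrable one_le_two).bdd_mul (c := C)
      (hM.continuous.comp (continuous_const.prodMk continuous_id)).aestronglyMeasurable
      (Eventually.of_forall fun y => by
        rw [Real.norm_of_nonneg (hM.nonneg _ _)]
        exact hMC x y)
  -- Hölder factor bounding the `L¹` norm on `Ω` by the `L²` norm; `D` below bounds the `L²` norm by
  -- the sup norm.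
  let N : ENNReal := (volume.restrict Ω) Set.univ ^ (1 / (1 : ENNReal).toReal - 1 / (2 : ENNReal).toReal)
  have hN : N ≠ ⊤ := by
    refine ENNReal.rpow_ne_top_of_nonneg (by norm_num) (measure_ne_top _ _)
  have hL1 : ∀ v : Lp ℝ 2 (volume.restrict Ω), ∫ y, ‖v y‖ ∂(volume.restrict Ω) ≤ N.toReal * ‖v‖ := by
    intro v
    have h1 := eLpNorm_le_eLpNorm_mul_rpow_measure_univ (μ := (volume.restrict Ω)) (f := v) one_le_two
      (Lp.aestronglyMeasurable v)
    rw [eLpNorm_one_eq_lintegral_enorm] at h1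
    rw [integral_norm_eq_lintegral_enorm (Lp.aestronglyMeasurable v), Lp.norm_def,
      ← ENNReal.toReal_mul, mul_comm]
    exact ENNReal.toReal_mono (ENNReal.mul_ne_top (Lp.eLpNorm_ne_top v) hN) h1
  have hT : ∀ (v : Lp ℝ 2 (volume.restrict Ω)) x, ‖∫ y, M x y * v y ∂(volume.restrict Ω)‖ ≤ C * (N.toReal * ‖v‖) := by
    intro v x
    refine (norm_integral_le_integral_norm _).trans ?_
    refine le_trans ?_ (mul_le_mul_of_nonneg_left (hL1 v) hC0)
    rw [← integral_const_mul]
    refine integral_mono (hMx v x).norm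
      (((Lp.memLp v).integrable one_le_two).norm.const_mul C) fun y => ?_
    simp only [norm_mul]
    rw [Real.norm_of_nonneg (hM.nonneg _ _)]
    exact mul_le_mul_of_nonneg_right (hMC x y) (norm_nonneg _)
  have hTm : ∀ v : Lp ℝ 2 (volume.restrict Ω), AEStronglyMeasurable (fun x => ∫ y, M x y * v y ∂(volume.restrict Ω)) (volume.restrict Ω) := fun v =>
    (StronglyMeasurable.integral_prod_right (f := fun x y => M x y * v y)
      (hM.continuous.stronglyMeasurable.mul
        ((Lp.stronglyMeasurable v).comp_measurable measurable_snd))).aestronglyMeasurable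
  have hvm : ∀ v : Lp ℝ 2 (volume.restrict Ω), AEStronglyMeasurable v (volume.restrict Ω) := fun v => Lp.aestronglyMeasurable v
  have hm_m := hM.continuous_mass.aestronglyMeasurable (μ := (volume.restrict Ω))
  have hFm : ∀ v, AEStronglyMeasurable (F v) (volume.restrict Ω) := fun v =>
    (((hm_m.mul (hvm v)).sub (hTm v)).const_mul e).add (hμc.aestronglyMeasurable.mul (hvm v))
  let D : ENNReal := (volume.restrict Ω) Set.univ ^ (2 : ENNReal).toReal⁻¹
  have hD : D ≠ ⊤ := ENNReal.rpow_ne_top_of_nonneg (by norm_num) (measure_ne_top _ _)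
  obtain ⟨T, hTF⟩ := exists_clm_of_ae (F := F)
    (C := (e * C + μ₁) + D.toReal * (e * (C * N.toReal))) hFm (fun v w => by
      filter_upwards [Lp.coeFn_add v w] with x hx
      have h1 : ∫ y, M x y * (v + w : Lp ℝ 2 (volume.restrict Ω)) y ∂(volume.restrict Ω)
          = ∫ y, M x y * v y ∂(volume.restrict Ω) + ∫ y, M x y * w y ∂(volume.restrict Ω) := by
        rw [← integral_add (hMx v x) (hMx w x)]
        refine integral_congr_ae ?_
        filter_upwards [Lp.coeFn_add v w] with y hy
        rw [hy, Pi.add_apply, mul_add]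
      simp only [F]
      rw [h1, hx, Pi.add_apply]
      ring) (fun c v => by
      filter_upwards [Lp.coeFn_smul c v] with x hx
      have h1 : ∫ y, M x y * (c • v : Lp ℝ 2 (volume.restrict Ω)) y ∂(volume.restrict Ω) = c * ∫ y, M x y * v y ∂(volume.restrict Ω) := by
        rw [← integral_const_mul]
        refine integral_congr_ae ?_
        filter_upwards [Lp.coeFn_smul c v] with y hy
        rw [hy, Pi.smul_apply, smul_eq_mul]
        ring
      simp only [F]
      rw [h1, hx, Pi.smul_apply, smul_eq_mul]
      ring) (fun v => by
      have e1 : F v = (fun x => (e * m x + μ x) * v x) + fun x => -(e * ∫ y, M x y * v y ∂(volume.restrict Ω)) := by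
        ext x
        simp only [F, Pi.add_apply]
        ring
      rw [e1]
      refine (eLpNorm_add_le ?_ ((hTm v).const_mul e).neg one_le_two).trans ?_
      · exact ((hm_m.const_mul e).add hμc.aestronglyMeasurable).mul (hvm v)
      have b1 : eLpNorm (fun x => (e * m x + μ x) * v x) 2 (volume.restrict Ω)
          ≤ ENNReal.ofReal (e * C + μ₁) * eLpNorm v 2 (volume.restrict Ω) :=
        eLpNorm_le_mul_eLpNorm_of_ae_le_mul (Eventually.of_forall fun x => by
          rw [norm_mul]
          refine mul_le_mul_of_nonneg_right ?_ (norm_nonneg _)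
          have h1 := hM.mass_nonneg x
          have h2 := hμ₀.le.trans (hμ x)
          rw [Real.norm_of_nonneg (by positivity)]
          gcongr
          · exact hmC x
          · exact hμ' x) 2
      have b2 : eLpNorm (fun x => -(e * ∫ y, M x y * v y ∂(volume.restrict Ω))) 2 (volume.restrict Ω)
          ≤ D * ENNReal.ofReal (e * (C * (N.toReal * ‖v‖))) :=
        eLpNorm_le_of_ae_bound (Eventually.of_forall fun x => by
          rw [norm_neg, norm_mul, Real.norm_of_nonneg he]
          exact mul_le_mul_of_nonneg_left (hT v x) he)
      have b3 : eLpNorm v 2 (volume.restrict Ω) = ENNReal.ofReal ‖v‖ := by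
        rw [Lp.norm_def, ENNReal.ofReal_toReal (Lp.eLpNorm_ne_top v)]
      rw [b3, ← ENNReal.ofReal_mul (by positivity)] at b1
      rw [← ENNReal.ofReal_toReal hD, ← ENNReal.ofReal_mul ENNReal.toReal_nonneg] at b2
      refine (add_le_add b1 b2).trans ?_
      rw [← ENNReal.ofReal_add (by positivity) (by positivity)]
      exact ENNReal.ofReal_le_ofReal (le_of_eq (by ring)))
  have hext : ∀ v : Lp ℝ 2 (volume.restrict Ω), MemLp (Ω.indicator v) 2 volume := fun v =>
    (memLp_indicator_iff_restrict hΩ).2 (Lp.memLp v)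
  have hind : ∀ (v : Lp ℝ 2 (volume.restrict Ω)) x, ∫ y, M x y * v y ∂(volume.restrict Ω) = ∫ y, M x y * Ω.indicator v y := by
    intro v x
    rw [← integral_indicator hΩ]
    congr 1
    ext y
    by_cases hy : y ∈ Ω <;> simp [hy]
  have hcoer : ∀ v : Lp ℝ 2 (volume.restrict Ω), μ₀ * ‖v‖ ^ 2 ≤ inner ℝ (T v) v := by
    intro v
    set u := Ω.indicator v with hu
    have hum : MemLp u 2 volume := hext v
    have h1 : inner ℝ (T v) v = ∫ x in Ω, (e * ((m x * u x - ∫ y, M x y * u y) * u x)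
        + μ x * u x ^ 2) := by
      rw [L2.inner_def]
      refine integral_congr_ae ?_
      filter_upwards [hTF v, ae_restrict_mem hΩ] with x hx hxΩ
      have : u x = v x := Set.indicator_of_mem hxΩ _
      rw [hx, this]
      simp only [F, hind]
      simp only [RCLike.inner_apply, conj_trivial]
      ring
    have hμb : Integrable fun x => μ x * u x ^ 2 :=
      hum.integrable_sq.bdd_mul (c := μ₁) hμc.aestronglyMeasurable
        (Eventually.of_forall fun x => by
          rw [Real.norm_of_nonneg (hμ₀.le.trans (hμ x))]
          exact hμ' x)
    rw [h1, setIntegral_eq_integral_of_forall_compl_eq_zero (fun x hx => by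
      have : u x = 0 := Set.indicator_of_notMem hx _
      rw [this]
      ring), integral_add ((hM.integrable_quad hum).const_mul e) hμb, integral_const_mul]
    have h2 := hM.energy_eq hum
    have h3 : 0 ≤ energy M u := hM.energy_nonneg
    have h4 : μ₀ * ‖v‖ ^ 2 ≤ ∫ x, μ x * u x ^ 2 := by
      have h5 : ‖v‖ ^ 2 = ∫ x, u x ^ 2 := by
        rw [Lp_norm_sq, ← integral_indicator hΩ]
        congr 1
        ext y
        by_cases hy : y ∈ Ω <;> simp [hy, hu]
      rw [h5, ← integral_const_mul]
      exact integral_mono (hum.integrable_sq.const_mul _) hμb fun x =>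
        mul_le_mul_of_nonneg_right (hμ x) (sq_nonneg _)
    have h5 : 0 ≤ e * ∫ x, (m x * u x - ∫ y, M x y * u y) * u x :=
      mul_nonneg he (by linarith)
    linarith
  have hμf : MemLp (fun x => μ x * f x) 2 (volume.restrict Ω) :=
    memLp_mul_of_bound (C := μ₁) hμc.aestronglyMeasurable
      (fun x => by rw [abs_of_nonneg (hμ₀.le.trans (hμ x))]; exact hμ' x) (Lp.memLp f)
  obtain ⟨v, hv⟩ := surjective_of_coercive T hμ₀ hcoer hμf.toLp
  refine ⟨(hext v).toLp, ?_, ?_⟩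
  · filter_upwards [(hext v).coeFn_toLp] with x hx hxΩ
    rw [hx, Set.indicator_of_notMem hxΩ]
  · filter_upwards [hTF v, hμf.coeFn_toLp, ae_restrict_of_ae (hext v).coeFn_toLp,
      ae_restrict_mem hΩ] with x h1 h2 h3 h4
    rw [hv, h2] at h1
    have h5 : ∫ y, M x y * ((hext v).toLp : V d) y = ∫ y, M x y * Ω.indicator v y := by
      refine integral_congr_ae ?_
      filter_upwards [(hext v).coeFn_toLp] with y hy
      rw [hy]
    rw [h1, h3, h5, Set.indicator_of_mem h4]
    simp only [F, hind]

/-! ### The symmetrized rescaled kernel -/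

lemma continuous_unscale (s : ℝ) (g : CT d) : Continuous fun x : E d => g (s • x) :=
  g.continuous.comp (continuous_const_smul s)

lemma integral_comp_inv_smul {ε : ℝ} (hε : 0 < ε) (g : E d → ℝ) :
    ∫ y, g (ε⁻¹ • y) = ε ^ d * ∫ η, g η := by
  rw [Measure.integral_comp_smul, finrank_euclideanSpace_fin, inv_pow, inv_inv,
    abs_of_nonneg (by positivity), smul_eq_mul]

/-- The kernel `Φ(x/ε) J(z/ε) e^{p·z/ε} κ(x/ε,y/ε) φ(y/ε)` with `z = x - y`. -/
def symKernel (J : E d → ℝ) (κ : E d → E d → ℝ) (p : E d) (Φ φ : CT d) (ε : ℝ) (x y : E d) : ℝ :=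
  Φ (ε⁻¹ • x) * (J (ε⁻¹ • x - ε⁻¹ • y) * Real.exp (inner ℝ p (ε⁻¹ • x - ε⁻¹ • y))
    * κ (ε⁻¹ • x) (ε⁻¹ • y)) * φ (ε⁻¹ • y)

/-- The data of the homogenization problem: eigenfunctions `φ`, `Φ` of the cell operator and of
its adjoint, with `c = a - H(p)`. -/
structure IsEigenPair {J : E d → ℝ} {κ : E d → E d → ℝ} (hκ : IsPositiveCoefficient κ)
    (hJ : IsDispersalKernel J) (p : E d) (c Φ φ : CT d) : Prop where
  pos_adjoint : ∀ x, 0 < Φ x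
  pos : ∀ x, 0 < φ x
  eq_adjoint : ∀ x, adjOp hκ hJ (-p) Φ x = c x * Φ x
  eq : ∀ x, tiltOp hκ hJ.isWeight p φ x = c x * φ x

/-! ### Well-posedness and uniform estimates for the resolvent problem -/

namespace IsEigenPair

variable {J : E d → ℝ} {κ : E d → E d → ℝ} {hκ : IsPositiveCoefficient κ}
  {hJ : IsDispersalKernel J} {p : E d} {c Φ φ : CT d}

/-- The row integral is computed from the equation of `φ` and the column integral from that of `Φ`;
both equal `cΦφ` at the rescaled point, with `ε ^ d` from the change of variables. -/
lemma isBalancedKernel (h : IsEigenPair hκ hJ p c Φ φ) {ε : ℝ} (hε : 0 < ε) :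
    IsBalancedKernel (symKernel J κ p Φ φ ε)
      fun x => ε ^ d * (c (ε⁻¹ • x) * (Φ (ε⁻¹ • x) * φ (ε⁻¹ • x))) := by
  set s := ε⁻¹ with hs
  have hs0 : s ≠ 0 := by positivity
  have hW := hJ.isWeight.tilt p
  have hcont : Continuous fun q : E d × E d => symKernel J κ p Φ φ ε q.1 q.2 := by
    have h1 : Continuous fun q : E d × E d => s • q.1 - s • q.2 := by fun_prop
    have h2 : Continuous fun q : E d × E d => κ (s • q.1) (s • q.2) :=
      hκ.continuous.comp (Continuous.prodMk (by fun_prop) (by fun_prop))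
    have h3 : Continuous fun q : E d × E d => Φ (s • q.1) := Φ.continuous.comp (by fun_prop)
    have h4 : Continuous fun q : E d × E d => φ (s • q.2) := φ.continuous.comp (by fun_prop)
    exact (h3.mul ((hW.continuous.comp h1).mul h2)).mul h4
  have eright : ∀ x y, symKernel J κ p Φ φ ε x y = Φ (s • x) *
      (fun η => J (s • x - η) * Real.exp (inner ℝ p (s • x - η)) * κ (s • x) η * φ η)
        (s • y) := fun x y => by
    simp only [symKernel, ← hs]
    ring
  have eleft : ∀ x y, symKernel J κ p Φ φ ε x y = φ (s • y) *
      (fun ξ => J (-(s • y - ξ)) * Real.exp (inner ℝ (-p) (s • y - ξ)) * κ ξ (s • y) * Φ ξ)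
        (s • x) := fun x y => by
    have e1 : inner ℝ (-p) (s • y - s • x) = inner ℝ p (s • x - s • y) := by
      rw [inner_neg_left, ← inner_neg_right, neg_sub]
    simp only [symKernel, ← hs]
    rw [e1, neg_sub]
    ring
  have iright : ∀ ξ, Integrable fun η =>
      J (ξ - η) * Real.exp (inner ℝ p (ξ - η)) * κ ξ η * φ η := fun ξ => by
    have := (integrable_convOp hκ hW φ ξ).comp_sub_left ξ
    simpa using this
  have ileft : ∀ η, Integrable fun ξ =>
      J (-(η - ξ)) * Real.exp (inner ℝ (-p) (η - ξ)) * κ ξ η * Φ ξ := fun η => by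
    have := (integrable_convOp hκ.swap (hJ.neg_arg.isWeight.tilt (-p)) Φ η).comp_sub_left η
    simpa using this
  have hcont_m : Continuous fun x => ε ^ d * (c (s • x) * (Φ (s • x) * φ (s • x))) :=
    continuous_const.mul ((continuous_unscale s c).mul
      ((continuous_unscale s Φ).mul (continuous_unscale s φ)))
  refine ⟨hcont, fun x y => ?_, hcont_m, ?_, fun x => ?_, fun x => ?_, fun y => ?_, fun y => ?_⟩
  · have h1 := (h.pos_adjoint (s • x)).le
    have h2 := (h.pos (s • y)).le
    have h3 := (hκ.pos (s • x) (s • y)).le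
    have h4 := hJ.nonneg (s • x - s • y)
    rw [symKernel, ← hs]
    positivity
  · obtain ⟨B, hB0, hB⟩ := hW.exists_bound 0
    simp only [zero_mul, neg_zero, Real.exp_zero, mul_one] at hB
    obtain ⟨K, hK0, hK⟩ := hκ.exists_le
    refine ⟨max (‖Φ‖ * (|B| * K) * ‖φ‖) (ε ^ d * (‖c‖ * (‖Φ‖ * ‖φ‖))),
      le_max_of_le_right (by positivity), fun x y => le_max_of_le_left ?_,
      fun x => le_max_of_le_right ?_⟩
    · rw [symKernel, ← hs]
      have h1 := hB (s • x - s • y)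
      have h2 := hJ.nonneg (s • x - s • y)
      have h3 := (hκ.pos (s • x) (s • y)).le
      have h5 := (h.pos_adjoint (s • x)).le
      gcongr
      · exact (h.pos _).le
      · exact (le_abs_self _).trans (Φ.abs_apply_le _)
      · exact (le_abs_self _).trans (h1.trans (le_abs_self B))
      · exact hK _ _
      · exact (le_abs_self _).trans (φ.abs_apply_le _)
    · have h1 := (h.pos_adjoint (s • x)).le
      have h2 := (h.pos (s • x)).le
      gcongr
      · exact (le_abs_self _).trans (c.abs_apply_le _)
      · exact (le_abs_self _).trans (Φ.abs_apply_le _)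
      · exact (le_abs_self _).trans (φ.abs_apply_le _)
  · simp only [eright]
    exact ((iright (s • x)).comp_smul hs0).const_mul _
  · have h1 := h.eq (s • x)
    rw [tiltOp, convOp_apply'] at h1
    simp_rw [eright x]
    rw [integral_const_mul, integral_comp_inv_smul hε (fun η => J (s • x - η)
      * Real.exp (inner ℝ p (s • x - η)) * κ (s • x) η * φ η), h1]
    ring
  · simp only [eleft]
    exact ((ileft (s • y)).comp_smul hs0).const_mul _
  · have h1 := h.eq_adjoint (s • y)
    rw [adjOp, tiltOp, convOp_apply'] at h1
    simp_rw [eleft _ y]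
    rw [integral_const_mul, integral_comp_inv_smul hε (fun ξ => J (-(s • y - ξ))
      * Real.exp (inner ℝ (-p) (s • y - ξ)) * κ ξ (s • y) * Φ ξ), h1]
    ring

/-- The resolvent equation in symmetrized form. -/
lemma isResolventSolution_iff (h : IsEigenPair hκ hJ p c Φ φ) {ε : ℝ} (hε : 0 < ε)
    (Ω : Set (E d)) (f : Lp ℝ 2 (volume.restrict Ω)) (v : V d) :
    IsResolventSolution J κ p φ Ω ε f v ↔ (∀ᵐ x, x ∉ Ω → v x = 0) ∧
      ∀ᵐ x ∂(volume.restrict Ω), 1 / ε ^ (d + 2) *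
        (ε ^ d * (c (ε⁻¹ • x) * (Φ (ε⁻¹ • x) * φ (ε⁻¹ • x))) * v x
          - ∫ y, symKernel J κ p Φ φ ε x y * v y)
        + (Φ (ε⁻¹ • x) * φ (ε⁻¹ • x)) * v x = (Φ (ε⁻¹ • x) * φ (ε⁻¹ • x)) * f x := by
  rw [IsResolventSolution, and_comm]
  refine and_congr_right fun hv => ?_
  have hM := h.isBalancedKernel hε
  refine eventually_congr (Eventually.of_forall fun x => ?_)
  have hφ := h.pos (ε⁻¹ • x)
  have hΦ := h.pos_adjoint (ε⁻¹ • x)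
  -- The symmetrized kernel is `K` times `(Φφ)(x/ε)`, a factor independent of `y` and positive;
  -- multiplying the equation by it is an equivalence.
  have hk : ∀ y, symKernel J κ p Φ φ ε x y
      = (Φ (ε⁻¹ • x) * φ (ε⁻¹ • x)) * kernelK J κ p φ (ε⁻¹ • x) (ε⁻¹ • y) := fun y => by
    rw [symKernel, kernelK]
    have := mul_inv_cancel₀ hφ.ne'
    linear_combination (-(Φ (ε⁻¹ • x) * (J (ε⁻¹ • x - ε⁻¹ • y)
      * Real.exp (inner ℝ p (ε⁻¹ • x - ε⁻¹ • y)) * κ (ε⁻¹ • x) (ε⁻¹ • y)) * φ (ε⁻¹ • y))) * this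
  have h1 : ∫ y, symKernel J κ p Φ φ ε x y * v y
      = (Φ (ε⁻¹ • x) * φ (ε⁻¹ • x)) *
        ∫ y in Ω, kernelK J κ p φ (ε⁻¹ • x) (ε⁻¹ • y) * v y := by
    rw [setIntegral_eq_integral_of_ae_compl_eq_zero, ← integral_const_mul]
    · congr 1
      ext y
      rw [hk, mul_assoc]
    · filter_upwards [hv] with y hy hyΩ
      rw [hy hyΩ, mul_zero]
  have h2 := hM.integral_right x
  simp only [hk] at h2
  rw [integral_const_mul] at h2
  have hpos : 0 < Φ (ε⁻¹ • x) * φ (ε⁻¹ • x) := mul_pos hΦ hφ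
  rw [h1, ← h2, transformedOp]
  set I := ∫ y in Ω, kernelK J κ p φ (ε⁻¹ • x) (ε⁻¹ • y) * v y
  set I' := ∫ y, kernelK J κ p φ (ε⁻¹ • x) (ε⁻¹ • y)
  have e : 1 / ε ^ (d + 2) * ((Φ (ε⁻¹ • x) * φ (ε⁻¹ • x)) * I' * v x
      - (Φ (ε⁻¹ • x) * φ (ε⁻¹ • x)) * I) + (Φ (ε⁻¹ • x) * φ (ε⁻¹ • x)) * v x
      = (Φ (ε⁻¹ • x) * φ (ε⁻¹ • x)) *
        (-(1 / ε ^ (d + 2)) * I + 1 / ε ^ (d + 2) * I' * v x + v x) := by ring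
  rw [e]
  exact (mul_right_inj' hpos.ne').symm

lemma exists_weight_bounds (h : IsEigenPair hκ hJ p c Φ φ) : ∃ μ₀ μ₁ : ℝ, 0 < μ₀ ∧ 0 ≤ μ₁ ∧
    (∀ x, μ₀ ≤ Φ x * φ x) ∧ ∀ x, Φ x * φ x ≤ μ₁ := by
  obtain ⟨m₁, h1, h1'⟩ := Φ.exists_pos_le h.pos_adjoint
  obtain ⟨m₂, h2, h2'⟩ := φ.exists_pos_le h.pos
  refine ⟨m₁ * m₂, ‖Φ‖ * ‖φ‖, by positivity, by positivity, fun x => ?_, fun x => ?_⟩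
  · have := h.pos_adjoint x
    exact mul_le_mul (h1' x) (h2' x) h2.le this.le
  · have := (h.pos x).le
    exact mul_le_mul ((le_abs_self _).trans (Φ.abs_apply_le x))
      ((le_abs_self _).trans (φ.abs_apply_le x)) this (norm_nonneg _)

/-- The tilted `J` stays above `J(0)/2` near the origin and the remaining factors are bounded below;
rescaling only changes the radius to `rε`. -/
lemma exists_symKernel_ge (h : IsEigenPair hκ hJ p c Φ φ) : ∃ r m₀ : ℝ, 0 < r ∧ 0 < m₀ ∧
    ∀ ε : ℝ, 0 < ε → ∀ x z : E d, ‖z‖ < r * ε → m₀ ≤ symKernel J κ p Φ φ ε x (x + z) := by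
  obtain ⟨m₁, h1, h1'⟩ := Φ.exists_pos_le h.pos_adjoint
  obtain ⟨m₂, h2, h2'⟩ := φ.exists_pos_le h.pos
  obtain ⟨k₀, hk, hk'⟩ := hκ.exists_ge
  have hW := (hJ.isWeight.tilt p).continuous
  have hpos : J 0 / 2 < J 0 * Real.exp (inner ℝ p (0 : E d)) := by
    rw [inner_zero_right, Real.exp_zero, mul_one]
    linarith [hJ.pos_zero]
  obtain ⟨r, hr, hball⟩ := Metric.eventually_nhds_iff_ball.1
    ((hW.tendsto 0).eventually (lt_mem_nhds hpos))
  have hJ0 := hJ.pos_zero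
  refine ⟨r, m₁ * (J 0 / 2 * k₀) * m₂, hr, by positivity, fun ε hε x z hz => ?_⟩
  have e1 : ε⁻¹ • x - ε⁻¹ • (x + z) = -(ε⁻¹ • z) := by
    rw [smul_add]
    abel
  have h3 := hball (-(ε⁻¹ • z)) (by
    rw [mem_ball_zero_iff, norm_neg, norm_smul, Real.norm_of_nonneg (by positivity),
      inv_mul_lt_iff₀ hε, mul_comm]
    exact hz)
  have h4 := h.pos_adjoint (ε⁻¹ • x)
  rw [symKernel, e1]
  have h5 := hk' (ε⁻¹ • x) (ε⁻¹ • (x + z))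
  have h6 := hJ.nonneg (-(ε⁻¹ • z))
  have h7 := h1' (ε⁻¹ • x)
  have h8 := h2' (ε⁻¹ • (x + z))
  have h9 := (hκ.pos (ε⁻¹ • x) (ε⁻¹ • (x + z))).le
  gcongr

/-- A priori estimates, uniform in `ε`. -/
lemma exists_uniform_bound (h : IsEigenPair hκ hJ p c Φ φ) (Ω : Set (E d)) :
    ∃ C : ℝ, 0 ≤ C ∧ ∀ (ε : ℝ) (f : Lp ℝ 2 (volume.restrict Ω)) (v : V d), 0 < ε →
      IsResolventSolution J κ p φ Ω ε f v → ‖v‖ ≤ C * ‖f‖ ∧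
        ∀ z, shiftNorm v z ≤ C * ‖f‖ * ‖z‖ + C * ‖f‖ * ε := by
  obtain ⟨μ₀, μ₁, hμ₀, hμ₁, hμ, hμ'⟩ := h.exists_weight_bounds
  obtain ⟨r, m₀, hr, hm₀, hlow⟩ := h.exists_symKernel_ge
  set b := volume.real (Metric.ball (0 : E d) 1) with hb
  have hb0 : 0 < b := ENNReal.toReal_pos (Metric.measure_ball_pos _ _ one_pos).ne'
    measure_ball_lt_top.ne
  set A := μ₁ ^ 2 / μ₀ with hA
  have hA0 : 0 ≤ A := by positivity
  set Q := 4 * (m₀⁻¹ * A) / ((r / 2) ^ d * b) with hQ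
  have hQ0 : 0 ≤ Q := by positivity
  refine ⟨√(A / μ₀) + √Q + √Q / (r / 2), by positivity, fun ε f v hε hv => ?_⟩
  obtain ⟨hv0, hveq⟩ := (h.isResolventSolution_iff hε Ω f v).1 hv
  have hM := h.isBalancedKernel hε
  have hap := hM.apriori (μ := fun x => Φ (ε⁻¹ • x) * φ (ε⁻¹ • x))
    ((continuous_unscale _ Φ).mul (continuous_unscale _ φ)) hμ₀ (fun x => hμ _)
    (fun x => hμ' _) hv0 hveq
  have hen0 : 0 ≤ energy (symKernel J κ p Φ φ ε) v := hM.energy_nonneg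
  have hεd : 0 < ε ^ (d + 2) := by positivity
  constructor
  · have h1 : μ₀ * ‖v‖ ^ 2 ≤ A * ‖f‖ ^ 2 := by
      have : 0 ≤ 1 / ε ^ (d + 2) * energy (symKernel J κ p Φ φ ε) v := by positivity
      linarith
    have h2 : ‖v‖ ^ 2 ≤ (√(A / μ₀) * ‖f‖) ^ 2 := by
      rw [mul_pow, Real.sq_sqrt (by positivity), div_mul_eq_mul_div, le_div_iff₀ hμ₀]
      linarith
    have h3 : ‖v‖ ≤ √(A / μ₀) * ‖f‖ := abs_le_of_sq_le_sq' h2 (by positivity) |>.2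
    refine h3.trans (mul_le_mul_of_nonneg_right ?_ (norm_nonneg _))
    have : 0 ≤ √Q + √Q / (r / 2) := by positivity
    linarith
  · have h1 : energy (symKernel J κ p Φ φ ε) v ≤ ε ^ (d + 2) * (A * ‖f‖ ^ 2) := by
      have h2 : 1 / ε ^ (d + 2) * energy (symKernel J κ p Φ φ ε) v ≤ A * ‖f‖ ^ 2 := by
        have : 0 ≤ μ₀ * ‖v‖ ^ 2 := by positivity
        linarith
      rwa [one_div, inv_mul_le_iff₀ hεd] at h2
    have h2 := hM.integral_shiftNorm_sq_le hm₀ (ρ := r * ε) (fun x z hz => hlow ε hε x z hz) v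
    have h3 : ∫ z in Metric.ball (0 : E d) (r * ε), shiftNorm v z ^ 2
        ≤ m₀⁻¹ * (ε ^ (d + 2) * (A * ‖f‖ ^ 2)) := h2.trans (by gcongr)
    -- The energy is of order `ε ^ (d + 2)` and the averaging ball has volume of order `ε ^ d`; the
    -- quotient `ε ^ 2` is the square of the modulus at scale `ε`.
    have hsmall : ∀ z : E d, ‖z‖ ≤ r / 2 * ε → shiftNorm v z ≤ √Q * ‖f‖ * ε := by
      intro z hz
      have h4 := shiftNorm_sq_le_of_integral v h3 (h := z) (by linarith)
      have h5 : volume.real (Metric.ball (0 : E d) (r * ε / 2)) = (r / 2) ^ d * b * ε ^ d := by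
        rw [measureReal_def, Measure.addHaar_ball_of_pos volume _ (by positivity),
          ENNReal.toReal_mul, ENNReal.toReal_ofReal (by positivity), finrank_euclideanSpace_fin,
          hb, measureReal_def]
        rw [show r * ε / 2 = r / 2 * ε by ring, mul_pow]
        ring
      rw [h5] at h4
      have h6 : shiftNorm v z ^ 2 ≤ (√Q * ‖f‖ * ε) ^ 2 := by
        rw [mul_pow, mul_pow, Real.sq_sqrt hQ0, hQ]
        have h7 : 0 < (r / 2) ^ d * b := by positivity
        rw [div_mul_eq_mul_div, div_mul_eq_mul_div, le_div_iff₀ h7]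
        have h8 : 0 < ε ^ d := by positivity
        refine le_of_mul_le_mul_right ?_ h8
        calc shiftNorm v z ^ 2 * ((r / 2) ^ d * b) * ε ^ d
            = (r / 2) ^ d * b * ε ^ d * shiftNorm v z ^ 2 := by ring
          _ ≤ 4 * (m₀⁻¹ * (ε ^ (d + 2) * (A * ‖f‖ ^ 2))) := h4
          _ = 4 * (m₀⁻¹ * A) * ‖f‖ ^ 2 * ε ^ 2 * ε ^ d := by ring
      exact abs_le_of_sq_le_sq' h6 (by positivity) |>.2
    intro z
    refine (shiftNorm_le_of_small v (by positivity) (half_pos hr) hε hsmall z).trans ?_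
    have h9 : 0 ≤ √(A / μ₀) := Real.sqrt_nonneg _
    have h10 : 0 ≤ √Q := Real.sqrt_nonneg _
    have h11 : 0 ≤ √Q / (r / 2) := by positivity
    have e1 : √Q * ‖f‖ / (r / 2) * ‖z‖ = √Q / (r / 2) * ‖f‖ * ‖z‖ := by ring
    rw [e1]
    gcongr <;> linarith

/-- Linearity needs the kernel integrals to converge: each row is bounded and integrable, hence in
`L²`. -/
lemma isResolventSolution_sub (h : IsEigenPair hκ hJ p c Φ φ) {Ω : Set (E d)} {ε : ℝ}
    (hε : 0 < ε) {f : Lp ℝ 2 (volume.restrict Ω)} {v w : V d}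
    (hv : IsResolventSolution J κ p φ Ω ε f v) (hw : IsResolventSolution J κ p φ Ω ε f w) :
    IsResolventSolution J κ p φ Ω ε 0 (v - w) := by
  rw [h.isResolventSolution_iff hε] at hv hw ⊢
  have hM := h.isBalancedKernel hε
  have hInt : ∀ (u : V d) x, Integrable fun y => symKernel J κ p Φ φ ε x y * u y := fun u x => by
    obtain ⟨B, hB0, hB, -⟩ := hM.exists_bound
    have h2 : MemLp (fun y => symKernel J κ p Φ φ ε x y) 2 volume := by
      have hc : Continuous fun y => symKernel J κ p Φ φ ε x y :=
        hM.continuous.comp (continuous_const.prodMk continuous_id)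
      rw [memLp_two_iff_integrable_sq hc.aestronglyMeasurable]
      refine ((hM.integrable_right x).const_mul B).mono'
        (hc.pow 2).aestronglyMeasurable (Eventually.of_forall fun y => ?_)
      rw [Real.norm_of_nonneg (sq_nonneg _), sq]
      exact mul_le_mul_of_nonneg_right (hB x y) (hM.nonneg x y)
    exact h2.integrable_mul (Lp.memLp u)
  refine ⟨?_, ?_⟩
  · filter_upwards [hv.1, hw.1, Lp.coeFn_sub v w] with x h1 h2 h3 hx
    rw [h3, Pi.sub_apply, h1 hx, h2 hx, sub_zero]
  · filter_upwards [hv.2, hw.2, ae_restrict_of_ae (Lp.coeFn_sub v w),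
      Lp.coeFn_zero ℝ 2 (volume.restrict Ω)] with x h1 h2 h3 h4
    have h5 : ∫ y, symKernel J κ p Φ φ ε x y * (v - w : V d) y
        = (∫ y, symKernel J κ p Φ φ ε x y * v y) - ∫ y, symKernel J κ p Φ φ ε x y * w y := by
      rw [← integral_sub (hInt v x) (hInt w x)]
      refine integral_congr_ae ?_
      filter_upwards [Lp.coeFn_sub v w] with y hy
      rw [hy, Pi.sub_apply, mul_sub]
    rw [h5, h3, h4, Pi.sub_apply, Pi.zero_apply, mul_zero]
    linear_combination h1 - h2

/-- Well-posedness of the resolvent problem. -/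
lemma existsUnique (h : IsEigenPair hκ hJ p c Φ φ) {Ω : Set (E d)} (hΩ : IsOpen Ω)
    (hΩb : Bornology.IsBounded Ω) {ε : ℝ} (hε : 0 < ε) (f : Lp ℝ 2 (volume.restrict Ω)) :
    ∃! v, IsResolventSolution J κ p φ Ω ε f v := by
  obtain ⟨μ₀, μ₁, hμ₀, hμ₁, hμ, hμ'⟩ := h.exists_weight_bounds
  have hM := h.isBalancedKernel hε
  obtain ⟨v, hv⟩ := hM.exists_solution hΩ.measurableSet hΩb.measure_lt_top
    (μ := fun x => Φ (ε⁻¹ • x) * φ (ε⁻¹ • x)) (e := 1 / ε ^ (d + 2))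
    ((continuous_unscale _ Φ).mul (continuous_unscale _ φ)) (by positivity) hμ₀ (fun x => hμ _)
    (fun x => hμ' _) f
  have hvs := (h.isResolventSolution_iff hε Ω f v).2 hv
  refine ⟨v, hvs, fun w hw => ?_⟩
  obtain ⟨C, hC, hb⟩ := h.exists_uniform_bound Ω
  have h1 := (hb ε 0 (w - v) hε (h.isResolventSolution_sub hε hw hvs)).1
  rw [norm_zero, mul_zero] at h1
  exact sub_eq_zero.1 (norm_le_zero_iff.1 h1)

end IsEigenPair

/-! ### Taylor expansions of test functions -/

lemma contDiff_partialDeriv {g : E d → ℝ} (hg : ContDiff ℝ ∞ g) (i : Fin d) :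
    ContDiff ℝ ∞ (partialDeriv i g) :=
  (hg.fderiv_right (m := ∞) (by simp)).clm_apply contDiff_const

lemma hasCompactSupport_partialDeriv {g : E d → ℝ} (hg : HasCompactSupport g) (i : Fin d) :
    HasCompactSupport (partialDeriv i g) :=
  (hg.fderiv (𝕜 := ℝ)).comp_left (g := fun L : E d →L[ℝ] ℝ => L (EuclideanSpace.single i 1))
    (by simp)

lemma tsupport_partialDeriv_subset (g : E d → ℝ) (i : Fin d) :
    tsupport (partialDeriv i g) ⊆ tsupport g := by
  refine (closure_mono ?_).trans (tsupport_fderiv_subset ℝ (f := g))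
  intro x hx h0
  exact hx (by simp only [partialDeriv]; rw [h0]; simp)

lemma IsTestFunction.partialDeriv {Ω : Set (E d)} {ψ : E d → ℝ} (h : IsTestFunction Ω ψ)
    (i : Fin d) : IsTestFunction Ω (partialDeriv i ψ) :=
  ⟨contDiff_partialDeriv h.1 i, hasCompactSupport_partialDeriv h.2.1 i,
    (tsupport_partialDeriv_subset ψ i).trans h.2.2⟩

lemma fderiv_eq_sum (g : E d → ℝ) (x h : E d) :
    fderiv ℝ g x h = ∑ i, h i * partialDeriv i g x := by
  have e : h = ∑ i, h i • EuclideanSpace.single i (1 : ℝ) := by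
    ext j
    simp [Finset.sum_apply, Pi.single_apply]
  conv_lhs => rw [e, map_sum]
  simp [partialDeriv]

lemma abs_coord_le (h : E d) (i : Fin d) : |h i| ≤ ‖h‖ := by
  simpa using PiLp.norm_apply_le h i

lemma hasDerivAt_line {g : E d → ℝ} (hg : ContDiff ℝ ∞ g) (y h : E d) (t : ℝ) :
    HasDerivAt (fun t : ℝ => g (y - t • h)) (-∑ i, h i * partialDeriv i g (y - t • h)) t := by
  have h1 : HasDerivAt (fun t : ℝ => y - t • h) (-h) t := by
    simpa using ((hasDerivAt_id t).smul_const h).const_sub y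
  have h2 := ((hg.differentiable (by simp)) (y - t • h)).hasFDerivAt.comp_hasDerivAt t h1
  rw [map_neg, fderiv_eq_sum] at h2
  exact h2

lemma taylor_first {g : E d → ℝ} (hg : ContDiff ℝ ∞ g) (hc : HasCompactSupport g) :
    ∃ C, 0 ≤ C ∧ ∀ y h : E d, |g (y - h) - g y| ≤ C * ‖h‖ := by
  obtain ⟨L, hL⟩ := ContDiff.lipschitzWith_of_hasCompactSupport hc hg (by simp)
  refine ⟨L, L.2, fun y h => ?_⟩
  have := hL.norm_sub_le (y - h) y
  simpa using this

/-- Along `t ↦ y - th` the derivative of the remainder is a sum of lower-order remainders of the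
partial derivatives; the mean value inequality on `[0,1]` adds one power of `‖h‖`. The third-order
case repeats this. -/
lemma taylor_second {g : E d → ℝ} (hg : ContDiff ℝ ∞ g) (hc : HasCompactSupport g) :
    ∃ C, 0 ≤ C ∧ ∀ y h : E d,
      |g (y - h) - (g y - ∑ i, h i * partialDeriv i g y)| ≤ C * ‖h‖ ^ 2 := by
  choose C hC0 hC using fun i =>
    taylor_first (contDiff_partialDeriv hg i) (hasCompactSupport_partialDeriv hc i)
  refine ⟨∑ i, C i, Finset.sum_nonneg fun i _ => hC0 i, fun y h => ?_⟩
  let F : ℝ → ℝ := fun t => g (y - t • h) - (g y - t * ∑ i, h i * partialDeriv i g y)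
  have hF : ∀ t, HasDerivAt F
      (-∑ i, h i * (partialDeriv i g (y - t • h) - partialDeriv i g y)) t := by
    intro t
    have h1 := (hasDerivAt_line hg y h t).sub
      (((hasDerivAt_id t).mul_const (∑ i, h i * partialDeriv i g y)).const_sub (g y))
    refine h1.congr_deriv ?_
    simp only [mul_sub, Finset.sum_sub_distrib]
    ring
  have h2 := norm_image_sub_le_of_norm_deriv_le_segment_01' (f := F) (C := (∑ i, C i) * ‖h‖ ^ 2)
    (fun t _ => (hF t).hasDerivWithinAt) fun t ht => by
      rw [norm_neg]
      refine (norm_sum_le _ _).trans ?_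
      rw [Finset.sum_mul]
      refine Finset.sum_le_sum fun i _ => ?_
      rw [norm_mul]
      have h3 : ‖partialDeriv i g (y - t • h) - partialDeriv i g y‖ ≤ C i * ‖h‖ := by
        refine (hC i y (t • h)).trans (mul_le_mul_of_nonneg_left ?_ (hC0 i))
        rw [norm_smul, Real.norm_of_nonneg ht.1]
        exact mul_le_of_le_one_left (norm_nonneg _) ht.2.le
      calc ‖h i‖ * ‖partialDeriv i g (y - t • h) - partialDeriv i g y‖
          ≤ ‖h‖ * (C i * ‖h‖) := mul_le_mul (abs_coord_le h i) h3 (norm_nonneg _) (norm_nonneg _)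
        _ = C i * ‖h‖ ^ 2 := by ring
  simpa [F] using h2

lemma taylor_third {g : E d → ℝ} (hg : ContDiff ℝ ∞ g) (hc : HasCompactSupport g) :
    ∃ C, 0 ≤ C ∧ ∀ y h : E d,
      |g (y - h) - (g y - ∑ i, h i * partialDeriv i g y
        + 1 / 2 * ∑ i, ∑ j, h i * h j * secondPartial g i j y)| ≤ C * ‖h‖ ^ 3 := by
  choose C hC0 hC using fun i =>
    taylor_second (contDiff_partialDeriv hg i) (hasCompactSupport_partialDeriv hc i)
  refine ⟨∑ i, C i, Finset.sum_nonneg fun i _ => hC0 i, fun y h => ?_⟩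
  set S := ∑ i, ∑ j, h i * h j * secondPartial g i j y with hS
  let F : ℝ → ℝ := fun t => g (y - t • h) - (g y - t * ∑ i, h i * partialDeriv i g y
    + 1 / 2 * t ^ 2 * S)
  have hF : ∀ t, HasDerivAt F (-∑ i, h i * (partialDeriv i g (y - t • h)
      - (partialDeriv i g y - ∑ j, (t • h) j * partialDeriv j (partialDeriv i g) y))) t := by
    intro t
    have h1 := (hasDerivAt_line hg y h t).sub
      ((((hasDerivAt_id t).mul_const (∑ i, h i * partialDeriv i g y)).const_sub (g y)).add
        (((hasDerivAt_pow 2 t).const_mul (1 / 2 : ℝ)).mul_const S))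
    refine h1.congr_deriv ?_
    have e1 : ∑ i, h i * ∑ j, (t • h) j * partialDeriv j (partialDeriv i g) y = t * S := by
      rw [hS, Finset.mul_sum]
      refine Finset.sum_congr rfl fun i _ => ?_
      rw [Finset.mul_sum, Finset.mul_sum]
      refine Finset.sum_congr rfl fun j _ => ?_
      rw [secondPartial_eq, PiLp.smul_apply, smul_eq_mul]
      ring
    simp only [mul_sub, Finset.sum_sub_distrib, e1]
    simp
    ring
  have h2 := norm_image_sub_le_of_norm_deriv_le_segment_01' (f := F) (C := (∑ i, C i) * ‖h‖ ^ 3)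
    (fun t _ => (hF t).hasDerivWithinAt) fun t ht => by
      rw [norm_neg]
      refine (norm_sum_le _ _).trans ?_
      rw [Finset.sum_mul]
      refine Finset.sum_le_sum fun i _ => ?_
      rw [norm_mul]
      have h3 : ‖partialDeriv i g (y - t • h) - (partialDeriv i g y
          - ∑ j, (t • h) j * partialDeriv j (partialDeriv i g) y)‖ ≤ C i * ‖h‖ ^ 2 := by
        refine (hC i y (t • h)).trans (mul_le_mul_of_nonneg_left ?_ (hC0 i))
        rw [norm_smul, Real.norm_of_nonneg ht.1]
        refine pow_le_pow_left₀ (mul_nonneg ht.1 (norm_nonneg _)) ?_ 2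
        exact mul_le_of_le_one_left (norm_nonneg _) ht.2.le
      calc _ ≤ ‖h‖ * (C i * ‖h‖ ^ 2) :=
            mul_le_mul (abs_coord_le h i) h3 (norm_nonneg _) (norm_nonneg _)
        _ = C i * ‖h‖ ^ 3 := by ring
  simpa [F] using h2

/-! ### Expansion of the adjoint operator on oscillating functions -/

/-- `F` is integrable with integral `I`. -/
def HasIntegral (F : E d → ℝ) (I : ℝ) : Prop := Integrable F ∧ ∫ z, F z = I

namespace HasIntegral

variable {F G : E d → ℝ} {a b : ℝ}

lemma add (h : HasIntegral F a) (h' : HasIntegral G b) :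
    HasIntegral (fun z => F z + G z) (a + b) :=
  ⟨h.1.add h'.1, by rw [integral_add h.1 h'.1, h.2, h'.2]⟩

lemma sub (h : HasIntegral F a) (h' : HasIntegral G b) :
    HasIntegral (fun z => F z - G z) (a - b) :=
  ⟨h.1.sub h'.1, by rw [integral_sub h.1 h'.1, h.2, h'.2]⟩

lemma const_mul (h : HasIntegral F a) (c : ℝ) : HasIntegral (fun z => c * F z) (c * a) :=
  ⟨h.1.const_mul c, by rw [integral_const_mul, h.2]⟩

lemma sum {ι : Type*} {s : Finset ι} {F : ι → E d → ℝ} {a : ι → ℝ}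
    (h : ∀ i ∈ s, HasIntegral (F i) (a i)) :
    HasIntegral (fun z => ∑ i ∈ s, F i z) (∑ i ∈ s, a i) :=
  ⟨integrable_finsetSum _ fun i hi => (h i hi).1, by
    rw [integral_finsetSum _ fun i hi => (h i hi).1]
    exact Finset.sum_congr rfl fun i hi => (h i hi).2⟩

lemma congr (h : HasIntegral F a) (hFG : ∀ z, F z = G z) : HasIntegral G a := by
  have : F = G := funext hFG
  rwa [← this]

end HasIntegral

section Expansion

variable {J : E d → ℝ} {κ : E d → E d → ℝ}

/-- The kernel of the adjoint operator at the point `η`. -/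
def adjKernel (J : E d → ℝ) (κ : E d → E d → ℝ) (p η z : E d) : ℝ :=
  J (-z) * Real.exp (inner ℝ (-p) z) * κ (η - z) η

/-- The adjoint operator weighted by `z_i`. -/
def adjOpCoord (hκ : IsPositiveCoefficient κ) (hJ : IsDispersalKernel J) (p : E d) (i : Fin d) :
    CT d →L[ℝ] CT d :=
  tiltOp hκ.swap (hJ.neg_arg.isWeight.coord i) (-p)

/-- The adjoint operator weighted by `z_i z_j`. -/
def adjOpCoord₂ (hκ : IsPositiveCoefficient κ) (hJ : IsDispersalKernel J) (p : E d)
    (i j : Fin d) : CT d →L[ℝ] CT d :=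
  tiltOp hκ.swap ((hJ.neg_arg.isWeight.coord i).coord j) (-p)

lemma hasIntegral_adjOp (hκ : IsPositiveCoefficient κ) (hJ : IsDispersalKernel J) (p : E d)
    (χ : CT d) (η : E d) :
    HasIntegral (fun z => adjKernel J κ p η z * χ (η - z)) (adjOp hκ hJ (-p) χ η) :=
  ⟨integrable_convOp hκ.swap (hJ.neg_arg.isWeight.tilt (-p)) χ η, rfl⟩

lemma hasIntegral_adjOpCoord (hκ : IsPositiveCoefficient κ) (hJ : IsDispersalKernel J) (p : E d)
    (i : Fin d) (χ : CT d) (η : E d) :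
    HasIntegral (fun z => adjKernel J κ p η z * χ (η - z) * z i) (adjOpCoord hκ hJ p i χ η) :=
  HasIntegral.congr (F := fun z => J (-z) * z i * Real.exp (inner ℝ (-p) z) * κ (η - z) η
    * χ (η - z))
    ⟨integrable_convOp hκ.swap ((hJ.neg_arg.isWeight.coord i).tilt (-p)) χ η, rfl⟩
    fun z => by
      simp only [adjKernel]
      ring

lemma hasIntegral_adjOpCoord₂ (hκ : IsPositiveCoefficient κ) (hJ : IsDispersalKernel J) (p : E d)
    (i j : Fin d) (χ : CT d) (η : E d) :
    HasIntegral (fun z => adjKernel J κ p η z * χ (η - z) * (z i * z j))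
      (adjOpCoord₂ hκ hJ p i j χ η) :=
  HasIntegral.congr (F := fun z => J (-z) * z i * z j * Real.exp (inner ℝ (-p) z) * κ (η - z) η
    * χ (η - z))
    ⟨integrable_convOp hκ.swap (((hJ.neg_arg.isWeight.coord i).coord j).tilt (-p)) χ η, rfl⟩
    fun z => by
      simp only [adjKernel]
      ring

lemma hasIntegral_polynomial (hκ : IsPositiveCoefficient κ) (hJ : IsDispersalKernel J) (p : E d)
    (χ : CT d) (η : E d) (ε q₀ : ℝ) (q₁ : Fin d → ℝ) (q₂ : Fin d → Fin d → ℝ) :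
    HasIntegral (fun z => adjKernel J κ p η z * χ (η - z) *
        (q₀ - ∑ i, (ε • z) i * q₁ i + 1 / 2 * ∑ i, ∑ j, (ε • z) i * (ε • z) j * q₂ i j))
      (q₀ * adjOp hκ hJ (-p) χ η - ε * ∑ i, q₁ i * adjOpCoord hκ hJ p i χ η
        + ε ^ 2 / 2 * ∑ i, ∑ j, q₂ i j * adjOpCoord₂ hκ hJ p i j χ η) := by
  have h0 := (hasIntegral_adjOp hκ hJ p χ η).const_mul q₀
  have h1 := (HasIntegral.sum (s := Finset.univ) fun i _ =>
    (hasIntegral_adjOpCoord hκ hJ p i χ η).const_mul (q₁ i)).const_mul ε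
  have h2 := (HasIntegral.sum (s := Finset.univ) fun i _ =>
    HasIntegral.sum (s := Finset.univ) fun j _ =>
      (hasIntegral_adjOpCoord₂ hκ hJ p i j χ η).const_mul (q₂ i j)).const_mul (ε ^ 2 / 2)
  refine ((h0.sub h1).add h2).congr fun z => ?_
  set k := adjKernel J κ p η z * χ (η - z)
  simp only [PiLp.smul_apply, smul_eq_mul]
  have e1 : ∑ i, q₁ i * (k * z i) = k * ∑ i, z i * q₁ i := by
    rw [Finset.mul_sum]
    exact Finset.sum_congr rfl fun i _ => by ring
  have e2 : ∑ i, ∑ j, q₂ i j * (k * (z i * z j)) = k * ∑ i, ∑ j, z i * z j * q₂ i j := by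
    simp only [Finset.mul_sum]
    exact Finset.sum_congr rfl fun i _ => Finset.sum_congr rfl fun j _ => by ring
  have e3 : ∑ i, ε * z i * q₁ i = ε * ∑ i, z i * q₁ i := by
    rw [Finset.mul_sum]
    exact Finset.sum_congr rfl fun i _ => by ring
  have e4 : ∑ i, ∑ j, ε * z i * (ε * z j) * q₂ i j = ε ^ 2 * ∑ i, ∑ j, z i * z j * q₂ i j := by
    simp only [Finset.mul_sum]
    exact Finset.sum_congr rfl fun i _ => Finset.sum_congr rfl fun j _ => by ring
  rw [e1, e2, e3, e4]
  ring

/-- Expansion of the adjoint operator acting on `χ(x/ε) g(x)`. -/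
lemma exists_expansion (hκ : IsPositiveCoefficient κ) (hJ : IsDispersalKernel J) (p : E d)
    (χ : CT d) {g : E d → ℝ} (hg : Continuous g) {C : ℝ} (n : ℕ)
    {q₀ : E d → ℝ} {q₁ : Fin d → E d → ℝ} {q₂ : Fin d → Fin d → E d → ℝ}
    (hq : ∀ y h : E d, |g (y - h) - (q₀ y - ∑ i, h i * q₁ i y
      + 1 / 2 * ∑ i, ∑ j, h i * h j * q₂ i j y)| ≤ C * ‖h‖ ^ n) :
    ∃ D, 0 ≤ D ∧ ∀ ε : ℝ, 0 < ε → ∀ y : E d,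
      Integrable (fun z => adjKernel J κ p (ε⁻¹ • y) z * χ (ε⁻¹ • y - z) * g (y - ε • z)) ∧
      |(∫ z, adjKernel J κ p (ε⁻¹ • y) z * χ (ε⁻¹ • y - z) * g (y - ε • z))
        - (q₀ y * adjOp hκ hJ (-p) χ (ε⁻¹ • y)
          - ε * ∑ i, q₁ i y * adjOpCoord hκ hJ p i χ (ε⁻¹ • y)
          + ε ^ 2 / 2 * ∑ i, ∑ j, q₂ i j y * adjOpCoord₂ hκ hJ p i j χ (ε⁻¹ • y))|
        ≤ D * ε ^ n := by
  obtain ⟨B, hB0, hB⟩ := hκ.swap.exists_le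
  have hW := hJ.neg_arg.isWeight.tilt (-p)
  have hWn := hW.mul_norm_pow_exp n 0
  set W : E d → ℝ := fun z => J (-z) * Real.exp (inner ℝ (-p) z) with hWdef
  have hWnn : ∀ z, 0 ≤ W z := fun z => mul_nonneg (hJ.nonneg _) (Real.exp_pos _).le
  set N := ∫ z, W z * ‖z‖ ^ n with hN
  have hNint : Integrable fun z => W z * ‖z‖ ^ n := by
    have := hWn.integrable
    simpa only [zero_mul, Real.exp_zero, mul_one] using this
  have hN0 : 0 ≤ N := integral_nonneg fun z => mul_nonneg (hWnn z) (by positivity)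
  -- `N` is the `n`-th moment of the tilted kernel. The polynomial part integrates exactly, so only
  -- the Taylor remainder contributes an error.
  refine ⟨B * ‖χ‖ * |C| * N, by positivity, fun ε hε y => ?_⟩
  set η := ε⁻¹ • y
  have hP := hasIntegral_polynomial hκ hJ p χ η ε (q₀ y) (fun i => q₁ i y) fun i j => q₂ i j y
  set P : E d → ℝ := fun z => q₀ y - ∑ i, (ε • z) i * q₁ i y
    + 1 / 2 * ∑ i, ∑ j, (ε • z) i * (ε • z) j * q₂ i j y with hPdef
  have hkc : Continuous fun z => adjKernel J κ p η z * χ (η - z) := by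
    have h1 : Continuous fun z => κ (η - z) η :=
      hκ.continuous.comp (Continuous.prodMk (by fun_prop) continuous_const)
    have h2 : Continuous fun z => χ (η - z) := χ.continuous.comp (by fun_prop)
    exact (hW.continuous.mul h1).mul h2
  have hgc : Continuous fun z => g (y - ε • z) := by fun_prop
  have hbound : ∀ z, ‖adjKernel J κ p η z * χ (η - z) * (g (y - ε • z) - P z)‖
      ≤ B * ‖χ‖ * |C| * ε ^ n * (W z * ‖z‖ ^ n) := by
    intro z
    have h1 : ‖adjKernel J κ p η z * χ (η - z)‖ ≤ B * ‖χ‖ * W z := by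
      have := norm_convOp_integrand_le hκ.swap hB W χ η z
      rwa [Real.norm_of_nonneg (hWnn z)] at this
    have h2 : ‖g (y - ε • z) - P z‖ ≤ |C| * (ε ^ n * ‖z‖ ^ n) := by
      have := hq y (ε • z)
      rw [norm_smul, Real.norm_of_nonneg hε.le, mul_pow] at this
      exact this.trans (mul_le_mul_of_nonneg_right (le_abs_self C) (by positivity))
    rw [norm_mul]
    calc _ ≤ (B * ‖χ‖ * W z) * (|C| * (ε ^ n * ‖z‖ ^ n)) :=
          mul_le_mul h1 h2 (norm_nonneg _) (mul_nonneg (by positivity) (hWnn z))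
      _ = _ := by ring
  have hPc : Continuous P := by
    simp only [hPdef]
    fun_prop
  have hrem : Integrable fun z => adjKernel J κ p η z * χ (η - z) * (g (y - ε • z) - P z) :=
    (hNint.const_mul _).mono' (hkc.mul (hgc.sub hPc)).aestronglyMeasurable
      (Eventually.of_forall hbound)
  have hsplit : ∀ z, adjKernel J κ p η z * χ (η - z) * g (y - ε • z)
      = adjKernel J κ p η z * χ (η - z) * (g (y - ε • z) - P z)
        + adjKernel J κ p η z * χ (η - z) * P z := fun z => by ring
  simp only [hsplit]
  refine ⟨hrem.add hP.1, ?_⟩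
  rw [integral_add hrem hP.1, hP.2, add_sub_cancel_right]
  refine (norm_integral_le_of_norm_le (hNint.const_mul (B * ‖χ‖ * |C| * ε ^ n))
    (Eventually.of_forall hbound)).trans (le_of_eq ?_)
  rw [integral_const_mul]
  ring

end Expansion

/-! ### The oscillating test function -/

/-- `Φ(x/ε) ψ(x) - ε Σ Φ₁ᵢ(x/ε) ∂ᵢψ(x) + ε²/2 Σ Φ₂ᵢⱼ(x/ε) ∂ᵢⱼψ(x)`. -/
def oscTest (Φ : CT d) (Φ₁ : Fin d → CT d) (Φ₂ : Fin d → Fin d → CT d) (ψ : E d → ℝ) (ε : ℝ)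
    (x : E d) : ℝ :=
  Φ (ε⁻¹ • x) * ψ x - ε * ∑ i, Φ₁ i (ε⁻¹ • x) * partialDeriv i ψ x
    + ε ^ 2 / 2 * ∑ i, ∑ j, Φ₂ i j (ε⁻¹ • x) * secondPartial ψ i j x

section

variable {Ω : Set (E d)} {ψ : E d → ℝ} {Φ : CT d} {Φ₁ : Fin d → CT d} {Φ₂ : Fin d → Fin d → CT d}

lemma IsTestFunction.secondPartial (h : IsTestFunction Ω ψ) (i j : Fin d) :
    IsTestFunction Ω (secondPartial ψ i j) := (h.partialDeriv i).partialDeriv j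

/-- Needed so that the two cross terms in the second corrector equation contribute equally. -/
lemma secondPartial_comm (h : ContDiff ℝ ∞ ψ) (i j : Fin d) (x : E d) :
    secondPartial ψ i j x = secondPartial ψ j i x := by
  have hs : IsSymmSndFDerivAt ℝ ψ x :=
    ((contDiff_infty.1 h 2).contDiffAt (x := x)).isSymmSndFDerivAt (by simp)
  have hd : DifferentiableAt ℝ (fderiv ℝ ψ) x :=
    ((h.fderiv_right (m := ∞) (by simp)).differentiable (by simp)) x
  have e : ∀ i j : Fin d, NonlocalHomogenization.secondPartial ψ i j x
      = fderiv ℝ (fderiv ℝ ψ) x (EuclideanSpace.single j 1) (EuclideanSpace.single i 1) := by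
    intro i j
    rw [NonlocalHomogenization.secondPartial, fderiv_clm_apply hd (differentiableAt_const _)]
    simp
  rw [e, e]
  exact hs _ _

lemma IsTestFunction.continuous_oscTest (h : IsTestFunction Ω ψ) (ε : ℝ) :
    Continuous (oscTest Φ Φ₁ Φ₂ ψ ε) := by
  have h0 := h.continuous
  have h1 := fun i => (h.partialDeriv i).continuous
  have h2 := fun i j => (h.secondPartial i j).continuous
  have g0 := continuous_unscale ε⁻¹ Φ
  have g1 := fun i => continuous_unscale ε⁻¹ (Φ₁ i)
  have g2 := fun i j => continuous_unscale ε⁻¹ (Φ₂ i j)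
  exact ((g0.mul h0).sub (continuous_const.mul (continuous_finsetSum _ fun i _ =>
    (g1 i).mul (h1 i)))).add (continuous_const.mul (continuous_finsetSum _ fun i _ =>
    continuous_finsetSum _ fun j _ => (g2 i j).mul (h2 i j)))

lemma oscTest_eq_zero {x : E d} (hx : x ∉ tsupport ψ) (ε : ℝ) :
    oscTest Φ Φ₁ Φ₂ ψ ε x = 0 := by
  have h0 : ψ x = 0 := image_eq_zero_of_notMem_tsupport hx
  have h1 : ∀ i, partialDeriv i ψ x = 0 := fun i =>
    image_eq_zero_of_notMem_tsupport fun h => hx (tsupport_partialDeriv_subset ψ i h)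
  have h2 : ∀ i j, secondPartial ψ i j x = 0 := fun i j =>
    image_eq_zero_of_notMem_tsupport fun h => hx (tsupport_partialDeriv_subset ψ i
      (tsupport_partialDeriv_subset (partialDeriv i ψ) j h))
  simp [oscTest, h0, h1, h2]

lemma IsTestFunction.exists_bound (h : IsTestFunction Ω ψ) : ∃ C, 0 ≤ C ∧ ∀ x, |ψ x| ≤ C := by
  obtain ⟨C, hC⟩ := h.2.1.exists_bound_of_continuous h.continuous
  exact ⟨C, (norm_nonneg _).trans (hC 0), hC⟩

lemma IsTestFunction.exists_oscTest_sub_le (h : IsTestFunction Ω ψ) :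
    ∃ C, 0 ≤ C ∧ ∀ ε : ℝ, 0 < ε → ε ≤ 1 → ∀ x,
      |oscTest Φ Φ₁ Φ₂ ψ ε x - Φ (ε⁻¹ • x) * ψ x| ≤ C * ε := by
  choose C₁ hC₁ h1 using fun i => (h.partialDeriv i).exists_bound
  choose C₂ hC₂ h2 using fun i j => (h.secondPartial i j).exists_bound
  have hA : 0 ≤ ∑ i, ‖Φ₁ i‖ * C₁ i :=
    Finset.sum_nonneg fun i _ => mul_nonneg (norm_nonneg _) (hC₁ i)
  have hB : 0 ≤ ∑ i, ∑ j, ‖Φ₂ i j‖ * C₂ i j :=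
    Finset.sum_nonneg fun i _ => Finset.sum_nonneg fun j _ => mul_nonneg (norm_nonneg _) (hC₂ i j)
  refine ⟨(∑ i, ‖Φ₁ i‖ * C₁ i) + ∑ i, ∑ j, ‖Φ₂ i j‖ * C₂ i j, add_nonneg hA hB,
    fun ε hε hε1 x => ?_⟩
  have b1 : |∑ i, Φ₁ i (ε⁻¹ • x) * NonlocalHomogenization.partialDeriv i ψ x|
      ≤ ∑ i, ‖Φ₁ i‖ * C₁ i := by
    refine (Finset.abs_sum_le_sum_abs _ _).trans (Finset.sum_le_sum fun i _ => ?_)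
    rw [abs_mul]
    exact mul_le_mul ((Φ₁ i).abs_apply_le _) (h1 i x) (abs_nonneg _) (norm_nonneg _)
  have b2 : |∑ i, ∑ j, Φ₂ i j (ε⁻¹ • x) * NonlocalHomogenization.secondPartial ψ i j x|
      ≤ ∑ i, ∑ j, ‖Φ₂ i j‖ * C₂ i j := by
    refine (Finset.abs_sum_le_sum_abs _ _).trans (Finset.sum_le_sum fun i _ => ?_)
    refine (Finset.abs_sum_le_sum_abs _ _).trans (Finset.sum_le_sum fun j _ => ?_)
    rw [abs_mul]
    exact mul_le_mul ((Φ₂ i j).abs_apply_le _) (h2 i j x) (abs_nonneg _) (norm_nonneg _)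
  rw [abs_le] at b1 b2
  have e2 : ε ^ 2 / 2 ≤ ε := by nlinarith
  rw [oscTest, abs_le]
  have e3 : 0 ≤ ε ^ 2 / 2 := by positivity
  constructor <;> nlinarith

end

/-! ### Cancellation of the leading orders by the correctors -/

section

variable {J : E d → ℝ} {κ : E d → E d → ℝ} {Φ : CT d} {Φ₁ : Fin d → CT d}
  {Φ₂ : Fin d → Fin d → CT d} {Ω : Set (E d)} {ψ : E d → ℝ} {a : CT d} {p : E d}

/-- The corrector equations cancel the leading orders. -/
lemma IsCorrector.exists_expansion {hκ : IsPositiveCoefficient κ} {hJ : IsDispersalKernel J}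
    (h : IsCorrector hκ hJ a p Φ Φ₁ Φ₂) (hψ : IsTestFunction Ω ψ) :
    ∃ C, 0 ≤ C ∧ ∀ ε : ℝ, 0 < ε → ∀ y : E d,
      |(∫ z, adjKernel J κ p (ε⁻¹ • y) z * oscTest Φ Φ₁ Φ₂ ψ ε (y - ε • z))
        - ((a (ε⁻¹ • y) - hamiltonian J κ a p) * oscTest Φ Φ₁ Φ₂ ψ ε y
          - ε ^ 2 / 2 * (Φ (ε⁻¹ • y) *
            ∑ i, ∑ j, secondPartial (hamiltonian J κ a) i j p * secondPartial ψ i j y))|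
        ≤ C * ε ^ 3 := by
  obtain ⟨T, hT0, hT⟩ := taylor_third hψ.1 hψ.2.1
  choose T₁ hT₁0 hT₁ using fun i => taylor_second (hψ.partialDeriv i).1 (hψ.partialDeriv i).2.1
  choose T₂ hT₂0 hT₂ using fun i j =>
    taylor_first (hψ.secondPartial i j).1 (hψ.secondPartial i j).2.1
  -- The terms of `oscTest` carry the factors `1`, `ε`, `ε²/2`; expanding them to orders `3`, `2`,
  -- `1` makes every error `O(ε³)`. The shorter expansions use zero coefficients.
  obtain ⟨D, hD0, hD⟩ := NonlocalHomogenization.exists_expansion hκ hJ p Φ hψ.continuous 3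
    (q₀ := ψ) (q₁ := fun i => partialDeriv i ψ) (q₂ := fun i j => secondPartial ψ i j) hT
  choose D₁ hD₁0 hD₁ using fun i => NonlocalHomogenization.exists_expansion hκ hJ p (Φ₁ i)
    (hψ.partialDeriv i).continuous 2 (C := T₁ i) (q₀ := partialDeriv i ψ)
    (q₁ := fun j => secondPartial ψ i j) (q₂ := fun _ _ _ => 0) (fun y h => by
      simpa [secondPartial_eq] using hT₁ i y h)
  choose D₂ hD₂0 hD₂ using fun i j => NonlocalHomogenization.exists_expansion hκ hJ p (Φ₂ i j)
    (hψ.secondPartial i j).continuous 1 (C := T₂ i j) (q₀ := secondPartial ψ i j)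
    (q₁ := fun _ _ => 0) (q₂ := fun _ _ _ => 0) (fun y h => by
      simpa using hT₂ i j y h)
  have hS₁ : 0 ≤ ∑ i, D₁ i := Finset.sum_nonneg fun i _ => hD₁0 i
  have hS₂ : 0 ≤ ∑ i, ∑ j, D₂ i j :=
    Finset.sum_nonneg fun i _ => Finset.sum_nonneg fun j _ => hD₂0 i j
  refine ⟨D + (∑ i, D₁ i) + ∑ i, ∑ j, D₂ i j, by positivity, fun ε hε y => ?_⟩
  set η := ε⁻¹ • y with hη
  obtain ⟨i0, b0⟩ := hD ε hε y
  have hη' : ∀ z, ε⁻¹ • (y - ε • z) = η - z := fun z => by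
    rw [smul_sub, smul_smul, inv_mul_cancel₀ hε.ne', one_smul]
  set I₀ := ∫ z, adjKernel J κ p η z * Φ (η - z) * ψ (y - ε • z) with hI₀
  set I₁ : Fin d → ℝ := fun i =>
    ∫ z, adjKernel J κ p η z * Φ₁ i (η - z) * partialDeriv i ψ (y - ε • z) with hI₁
  set I₂ : Fin d → Fin d → ℝ := fun i j =>
    ∫ z, adjKernel J κ p η z * Φ₂ i j (η - z) * secondPartial ψ i j (y - ε • z) with hI₂
  have hInt : HasIntegral (fun z => adjKernel J κ p η z * oscTest Φ Φ₁ Φ₂ ψ ε (y - ε • z))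
      (I₀ - ε * ∑ i, I₁ i + ε ^ 2 / 2 * ∑ i, ∑ j, I₂ i j) := by
    have g0 : HasIntegral (fun z => adjKernel J κ p η z * Φ (η - z) * ψ (y - ε • z)) I₀ :=
      ⟨i0, rfl⟩
    have g1 := (HasIntegral.sum (s := Finset.univ) (a := I₁) fun i _ =>
      ⟨(hD₁ i ε hε y).1, rfl⟩).const_mul ε
    have g2 := (HasIntegral.sum (s := Finset.univ) fun i _ =>
      HasIntegral.sum (s := Finset.univ) (a := I₂ i) fun j _ =>
      ⟨(hD₂ i j ε hε y).1, rfl⟩).const_mul (ε ^ 2 / 2)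
    refine ((g0.sub g1).add g2).congr fun z => ?_
    simp only [oscTest, hη', mul_add, mul_sub, Finset.mul_sum]
    refine congrArg₂ _ (congrArg₂ _ (by ring) ?_) ?_
    · exact Finset.sum_congr rfl fun i _ => by ring
    · exact Finset.sum_congr rfl fun i _ => Finset.sum_congr rfl fun j _ => by ring
  rw [hInt.2]
  set c := a η - hamiltonian J κ a p with hc
  set t : Fin d → ℝ := fun i => adjOpCoord hκ hJ p i Φ η with ht
  set t₂ : Fin d → Fin d → ℝ := fun i j => adjOpCoord₂ hκ hJ p i j Φ η with ht₂
  set u : Fin d → Fin d → ℝ := fun i j => adjOpCoord hκ hJ p j (Φ₁ i) η with hu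
  set h2 : Fin d → Fin d → ℝ := fun i j => secondPartial (hamiltonian J κ a) i j p with hh2
  have q0 : adjOp hκ hJ (-p) Φ η = c * Φ η := h.eq_zero η
  have q1 : ∀ i, adjOp hκ hJ (-p) (Φ₁ i) η = c * Φ₁ i η - t i := fun i => by
    have : t i + adjOp hκ hJ (-p) (Φ₁ i) η = c * Φ₁ i η := h.eq_one i η
    linarith
  have q2 : ∀ i j, adjOp hκ hJ (-p) (Φ₂ i j) η
      = c * Φ₂ i j η - h2 i j * Φ η - t₂ i j - u j i - u i j := fun i j => by
    have : t₂ i j + u j i + u i j + adjOp hκ hJ (-p) (Φ₂ i j) η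
      = c * Φ₂ i j η - h2 i j * Φ η := h.eq_two i j η
    linarith
  set A₀ := ψ y * (c * Φ η) - ε * ∑ i, partialDeriv i ψ y * t i
    + ε ^ 2 / 2 * ∑ i, ∑ j, secondPartial ψ i j y * t₂ i j with hA₀
  set A₁ : Fin d → ℝ := fun i => partialDeriv i ψ y * (c * Φ₁ i η - t i)
    - ε * ∑ j, secondPartial ψ i j y * u i j with hA₁
  set A₂ : Fin d → Fin d → ℝ := fun i j => secondPartial ψ i j y
    * (c * Φ₂ i j η - h2 i j * Φ η - t₂ i j - u j i - u i j) with hA₂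
  have c0 : |I₀ - A₀| ≤ D * ε ^ 3 := by
    have := b0
    rw [q0] at this
    exact this
  have c1 : ∀ i, |I₁ i - A₁ i| ≤ D₁ i * ε ^ 2 := fun i => by
    have := (hD₁ i ε hε y).2
    rw [← hη, q1] at this
    simpa using this
  have c2 : ∀ i j, |I₂ i j - A₂ i j| ≤ D₂ i j * ε := fun i j => by
    have := (hD₂ i j ε hε y).2
    rw [← hη, q2] at this
    simpa using this
  have hsym : ∑ i, ∑ j, secondPartial ψ i j y * u j i = ∑ i, ∑ j, secondPartial ψ i j y * u i j := by
    rw [Finset.sum_comm]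
    exact Finset.sum_congr rfl fun i _ => Finset.sum_congr rfl fun j _ => by
      rw [secondPartial_comm hψ.1]
  -- The `t` terms cancel at order `ε`. At order `ε²` the `t₂` terms cancel, and the two halves of
  -- the `u` terms cancel against the contribution of the first corrector; only the Hessian of `H`
  -- survives.
  have hmain : A₀ - ε * ∑ i, A₁ i + ε ^ 2 / 2 * ∑ i, ∑ j, A₂ i j
      = c * oscTest Φ Φ₁ Φ₂ ψ ε y
        - ε ^ 2 / 2 * (Φ η * ∑ i, ∑ j, h2 i j * secondPartial ψ i j y) := by
    have s1 : ∑ i, A₁ i = c * (∑ i, Φ₁ i η * partialDeriv i ψ y)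
        - ∑ i, partialDeriv i ψ y * t i - ε * ∑ i, ∑ j, secondPartial ψ i j y * u i j := by
      simp only [hA₁, mul_sub, Finset.sum_sub_distrib, Finset.mul_sum]
      congr 2
      exact Finset.sum_congr rfl fun i _ => by ring
    have s2 : ∑ i, ∑ j, A₂ i j = c * (∑ i, ∑ j, Φ₂ i j η * secondPartial ψ i j y)
        - Φ η * (∑ i, ∑ j, h2 i j * secondPartial ψ i j y)
        - (∑ i, ∑ j, secondPartial ψ i j y * t₂ i j)
        - (∑ i, ∑ j, secondPartial ψ i j y * u j i)
        - ∑ i, ∑ j, secondPartial ψ i j y * u i j := by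
      simp only [hA₂, mul_sub, Finset.sum_sub_distrib, Finset.mul_sum]
      congr 4
      · exact Finset.sum_congr rfl fun i _ => Finset.sum_congr rfl fun j _ => by ring
      · exact Finset.sum_congr rfl fun i _ => Finset.sum_congr rfl fun j _ => by ring
    rw [s1, s2, hsym, hA₀, oscTest, ← hη]
    ring
  have hdiff : I₀ - ε * ∑ i, I₁ i + ε ^ 2 / 2 * ∑ i, ∑ j, I₂ i j
      - (c * oscTest Φ Φ₁ Φ₂ ψ ε y
        - ε ^ 2 / 2 * (Φ η * ∑ i, ∑ j, h2 i j * secondPartial ψ i j y))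
      = (I₀ - A₀) - ε * ∑ i, (I₁ i - A₁ i) + ε ^ 2 / 2 * ∑ i, ∑ j, (I₂ i j - A₂ i j) := by
    rw [← hmain]
    simp only [Finset.sum_sub_distrib]
    ring
  rw [hdiff]
  have d1 : |∑ i, (I₁ i - A₁ i)| ≤ (∑ i, D₁ i) * ε ^ 2 := by
    refine (Finset.abs_sum_le_sum_abs _ _).trans ?_
    rw [Finset.sum_mul]
    exact Finset.sum_le_sum fun i _ => c1 i
  have d2 : |∑ i, ∑ j, (I₂ i j - A₂ i j)| ≤ (∑ i, ∑ j, D₂ i j) * ε := by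
    refine (Finset.abs_sum_le_sum_abs _ _).trans ?_
    rw [Finset.sum_mul]
    refine Finset.sum_le_sum fun i _ => (Finset.abs_sum_le_sum_abs _ _).trans ?_
    rw [Finset.sum_mul]
    exact Finset.sum_le_sum fun j _ => c2 i j
  have f1 : |ε * ∑ i, (I₁ i - A₁ i)| ≤ (∑ i, D₁ i) * ε ^ 3 := by
    rw [abs_mul, abs_of_pos hε]
    calc _ ≤ ε * ((∑ i, D₁ i) * ε ^ 2) := by gcongr
      _ = _ := by ring
  have f2 : |ε ^ 2 / 2 * ∑ i, ∑ j, (I₂ i j - A₂ i j)| ≤ (∑ i, ∑ j, D₂ i j) * ε ^ 3 := by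
    rw [abs_mul, abs_of_pos (by positivity)]
    calc _ ≤ ε ^ 2 / 2 * ((∑ i, ∑ j, D₂ i j) * ε) := by gcongr
      _ = (∑ i, ∑ j, D₂ i j) * ε ^ 3 / 2 := by ring
      _ ≤ _ := by
        have : 0 ≤ (∑ i, ∑ j, D₂ i j) * ε ^ 3 := by positivity
        linarith
  refine (abs_add_le _ _).trans ?_
  have := abs_sub (I₀ - A₀) (ε * ∑ i, (I₁ i - A₁ i))
  linarith

end

/-! ### Weak convergence of rapidly oscillating functions -/

/-- Continuity of translations in `L¹`. -/
lemma tendsto_integral_shift {F : E d → ℝ} (hF : Integrable F) :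
    Tendsto (fun h : E d => ∫ x, ‖F (x + h) - F x‖) (𝓝 0) (𝓝 0) := by
  have hm : MemLp F 1 volume := memLp_one_iff_integrable.2 hF
  let u : Lp ℝ 1 (volume : Measure (E d)) := hm.toLp
  let T : E d → Lp ℝ 1 (volume : Measure (E d)) := fun h =>
    Lp.compMeasurePreserving (fun x => x + h) (measurePreserving_add_right volume h) u
  have hg : Continuous fun h : E d =>
      (ContinuousMap.mk (fun x => x + h) (by fun_prop) : C(E d, E d)) :=
    (ContinuousMap.curry ⟨fun q : E d × E d => q.2 + q.1, by fun_prop⟩).continuous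
  have hT : Continuous T := Continuous.compMeasurePreservingLp continuous_const hg
    (fun h => measurePreserving_add_right volume h) (by norm_num)
  have hn : ∀ h, ‖T h - u‖ = ∫ x, ‖F (x + h) - F x‖ := by
    intro h
    rw [L1.norm_eq_integral_norm]
    refine integral_congr_ae ?_
    filter_upwards [Lp.coeFn_sub (T h) u, hm.coeFn_toLp,
      Lp.coeFn_compMeasurePreserving u (measurePreserving_add_right volume h),
      (measurePreserving_add_right volume h).quasiMeasurePreserving.ae hm.coeFn_toLp]
      with x h1 h2 h3 h4
    rw [h1, Pi.sub_apply, h2, h3, Function.comp_apply, h4]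
  have h0 : T 0 - u = 0 := by
    rw [← norm_eq_zero, hn]
    simp
  have h1 : Tendsto (fun h => ‖T h - u‖) (𝓝 0) (𝓝 ‖T 0 - u‖) :=
    ((hT.sub continuous_const).norm).tendsto 0
  rw [h0, norm_zero] at h1
  simpa only [hn] using h1

lemma integrable_mul_unscale {F : E d → ℝ} (hF : Integrable F) (μ : CT d) (r : ℝ) (s : E d) :
    Integrable fun x => F x * μ (r • x + s) :=
  hF.mul_bdd (c := ‖μ‖) (μ.continuous.comp (by fun_prop)).aestronglyMeasurable
    (Eventually.of_forall fun x => μ.abs_apply_le _)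

/-- Rapidly oscillating periodic functions converge weakly to their mean. -/
lemma tendsto_integral_mul_oscillating {F : E d → ℝ} (hF : Integrable F) (μ : CT d) {ε : ℕ → ℝ}
    (hε : ∀ n, 0 < ε n) (hε0 : Tendsto ε atTop (𝓝 0)) :
    Tendsto (fun n => ∫ x, F x * μ ((ε n)⁻¹ • x)) atTop
      (𝓝 (cellMean μ / volume.real (unitCell d) * ∫ x, F x)) := by
  have hfin : volume (unitCell d) < ⊤ := isBounded_unitCell.measure_lt_top
  set b := volume.real (unitCell d) with hb
  have hb0 : 0 < b := ENNReal.toReal_pos volume_unitCell_ne_zero hfin.ne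
  have hfm : IsFiniteMeasure (volume.restrict (unitCell d)) :=
    ⟨by rwa [Measure.restrict_apply_univ]⟩
  obtain ⟨R, hR0, hR⟩ := isBounded_unitCell (d := d) |>.exists_pos_norm_le
  rw [Metric.tendsto_nhds]
  intro δ hδ
  set δ' := δ / (2 * (‖μ‖ + 1)) with hδ'
  have hδ'0 : 0 < δ' := by positivity
  have hμδ : ‖μ‖ * δ' < δ := by
    calc ‖μ‖ * δ' ≤ (‖μ‖ + 1) * (δ / (2 * (‖μ‖ + 1))) := by
          gcongr
          linarith
      _ = δ / 2 := by field_simp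
      _ < δ := by linarith
  obtain ⟨r, hr, hball⟩ := Metric.eventually_nhds_iff_ball.1
    ((tendsto_integral_shift hF).eventually (gt_mem_nhds hδ'0))
  have hev : ∀ᶠ n in atTop, ε n < r / R := hε0.eventually (gt_mem_nhds (by positivity))
  filter_upwards [hev] with n hn
  set e := ε n with he
  have he0 : 0 < e := hε n
  set I := ∫ x, F x * μ (e⁻¹ • x) with hI
  -- Shifting the phase by `s` amounts to translating `F` by `εs`, a small change in `L¹`. Averaging
  -- over `s` in the cell replaces the oscillating factor by its mean exactly.
  have hclose : ∀ s ∈ unitCell d, |I - ∫ x, F x * μ (e⁻¹ • x + s)| ≤ ‖μ‖ * δ' := by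
    intro s hs
    have h1 : I = ∫ x, F (x + e • s) * μ (e⁻¹ • x + s) := by
      rw [hI, ← integral_add_right_eq_self _ (e • s)]
      refine integral_congr_ae (Eventually.of_forall fun x => ?_)
      simp only [smul_add, smul_smul, inv_mul_cancel₀ he0.ne', one_smul]
    have hFs : Integrable fun x => F (x + e • s) := hF.comp_add_right (e • s)
    rw [h1, ← integral_sub (integrable_mul_unscale hFs μ _ s) (integrable_mul_unscale hF μ _ s)]
    have h2 : ∫ x, ‖F (x + e • s) - F x‖ < δ' := hball (e • s) (by
      rw [mem_ball_zero_iff, norm_smul, Real.norm_of_nonneg he0.le]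
      rw [lt_div_iff₀ hR0] at hn
      exact (mul_le_mul_of_nonneg_left (hR s hs) he0.le).trans_lt hn)
    calc |∫ x, (F (x + e • s) * μ (e⁻¹ • x + s) - F x * μ (e⁻¹ • x + s))|
        ≤ ∫ x, ‖μ‖ * ‖F (x + e • s) - F x‖ := by
          rw [← Real.norm_eq_abs]
          refine norm_integral_le_of_norm_le ((hFs.sub hF).norm.const_mul _)
            (Eventually.of_forall fun x => ?_)
          rw [← sub_mul, norm_mul, mul_comm]
          exact mul_le_mul_of_nonneg_right (μ.abs_apply_le _) (norm_nonneg _)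
      _ ≤ ‖μ‖ * δ' := by
          rw [integral_const_mul]
          gcongr
  have hprod : Integrable (fun q : E d × E d => F q.2 * μ (e⁻¹ • q.2 + q.1))
      ((volume.restrict (unitCell d)).prod volume) := by
    have h1 : Integrable (fun q : E d × E d => F q.2)
        ((volume.restrict (unitCell d)).prod volume) := hF.comp_snd _
    exact h1.mul_bdd (c := ‖μ‖) (μ.continuous.comp (by fun_prop)).aestronglyMeasurable
      (Eventually.of_forall fun x => μ.abs_apply_le _)
  have hswap : ∫ s in unitCell d, ∫ x, F x * μ (e⁻¹ • x + s) = cellMean μ * ∫ x, F x := by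
    rw [integral_integral_swap hprod, ← integral_const_mul]
    refine integral_congr_ae (Eventually.of_forall fun x => ?_)
    simp only
    rw [integral_const_mul, mul_comm, cellMean,
      ← integral_unitCell_add_right μ.periodic (e⁻¹ • x)]
    simp only [add_comm]
  have hInt : Integrable (fun s => ∫ x, F x * μ (e⁻¹ • x + s)) (volume.restrict (unitCell d)) :=
    hprod.integral_prod_left
  have hconst : ∫ _s in unitCell d, I = b * I := by
    rw [setIntegral_const, smul_eq_mul]
  have hdiff : |b * I - cellMean μ * ∫ x, F x| ≤ b * (‖μ‖ * δ') := by
    rw [← hconst, ← hswap, ← integral_sub (integrable_const I) hInt]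
    rw [← Real.norm_eq_abs]
    refine (norm_setIntegral_le_of_norm_le_const hfin fun s hs => hclose s hs).trans (le_of_eq ?_)
    rw [mul_comm]
  rw [Real.dist_eq]
  have e1 : I - cellMean μ / b * ∫ x, F x = b⁻¹ * (b * I - cellMean μ * ∫ x, F x) := by
    field_simp
  rw [e1, abs_mul, abs_of_pos (inv_pos.2 hb0)]
  calc b⁻¹ * |b * I - cellMean μ * ∫ x, F x| ≤ b⁻¹ * (b * (‖μ‖ * δ')) := by gcongr
    _ = ‖μ‖ * δ' := by field_simp
    _ < δ := hμδ

/-! ### The weak form of the resolvent equation -/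

/-- The elementary bound `|u| ≤ 1 + u²` takes the place of Cauchy–Schwarz and keeps the estimate
quadratic in the norm. -/
lemma abs_setIntegral_mul_sub_le {Ω : Set (E d)} (hΩ : volume Ω < ⊤) {u g h : E d → ℝ}
    (hu : MemLp u 2 (volume.restrict Ω)) {δ : ℝ} (hδ : 0 ≤ δ)
    (hg : Integrable (fun x => u x * g x) (volume.restrict Ω))
    (hh : Integrable (fun x => u x * h x) (volume.restrict Ω)) (hgh : ∀ x, |g x - h x| ≤ δ) :
    |(∫ x in Ω, u x * g x) - ∫ x in Ω, u x * h x|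
      ≤ δ * (volume.real Ω + ∫ x in Ω, u x ^ 2) := by
  have hfm : IsFiniteMeasure (volume.restrict Ω) := ⟨by rwa [Measure.restrict_apply_univ]⟩
  rw [← integral_sub hg hh]
  have e1 : δ * (volume.real Ω + ∫ x in Ω, u x ^ 2) = ∫ x in Ω, δ * (1 + u x ^ 2) := by
    rw [integral_const_mul, integral_add (integrable_const _) hu.integrable_sq,
      setIntegral_const, smul_eq_mul, mul_one]
  rw [e1, ← Real.norm_eq_abs]
  refine norm_integral_le_of_norm_le (((integrable_const 1).add hu.integrable_sq).const_mul δ)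
    (Eventually.of_forall fun x => ?_)
  rw [← mul_sub, norm_mul, mul_comm]
  refine mul_le_mul (hgh x) ?_ (norm_nonneg _) hδ
  rw [Real.norm_eq_abs, ← sq_abs (u x)]
  nlinarith [sq_nonneg (|u x| - 1), abs_nonneg (u x)]

section

variable {J : E d → ℝ} {κ : E d → E d → ℝ} {Φ : CT d} {Φ₁ : Fin d → CT d}
  {Φ₂ : Fin d → Fin d → CT d} {Ω : Set (E d)} {ψ : E d → ℝ} {a : CT d} {p : E d}
  {hκ : IsPositiveCoefficient κ} {hJ : IsDispersalKernel J}

/-- Division by `Φ(x/ε)` removes that factor from the kernel, and `x = y - εz` leaves the adjoint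
kernel acting on `G`, for which the expansion is available. -/
lemma integral_symKernel_mul (Φ φ : CT d) (hΦ : ∀ x, 0 < Φ x) {ε : ℝ} (hε : 0 < ε)
    (G : E d → ℝ) (y : E d) :
    ∫ x, symKernel J κ p Φ φ ε x y * (G x * (Φ (ε⁻¹ • x))⁻¹)
      = φ (ε⁻¹ • y) * (ε ^ d * ∫ z, adjKernel J κ p (ε⁻¹ • y) z * G (y - ε • z)) := by
  set F : E d → ℝ := fun x => symKernel J κ p Φ φ ε x y * (G x * (Φ (ε⁻¹ • x))⁻¹) with hF
  have h1 : ∫ x, F x = ε ^ d * ∫ z, F (y - ε • z) := by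
    have h2 := Measure.integral_comp_smul (volume : Measure (E d)) (fun x => F (y - x)) ε
    rw [finrank_euclideanSpace_fin, integral_sub_left_eq_self F volume y,
      abs_of_pos (by positivity), smul_eq_mul] at h2
    rw [h2, ← mul_assoc, mul_inv_cancel₀ (by positivity), one_mul]
  rw [h1, mul_left_comm, ← integral_const_mul (φ (ε⁻¹ • y))]
  congr 2
  ext z
  have e1 : ε⁻¹ • (y - ε • z) = ε⁻¹ • y - z := by
    rw [smul_sub, smul_smul, inv_mul_cancel₀ hε.ne', one_smul]
  have e2 : ε⁻¹ • y - z - ε⁻¹ • y = -z := by abel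
  have h3 := mul_inv_cancel₀ (hΦ (ε⁻¹ • y - z)).ne'
  simp only [hF, symKernel, adjKernel, e1, e2]
  rw [inner_neg_right, ← inner_neg_left]
  linear_combination (J (-z) * Real.exp (inner ℝ (-p) z) * κ (ε⁻¹ • y - z) (ε⁻¹ • y)
    * φ (ε⁻¹ • y) * G (y - ε • z)) * h3

/-- The operator of the limit equation applied to a test function. -/
def limitOp (A : Matrix (Fin d) (Fin d) ℝ) (ψ : E d → ℝ) (x : E d) : ℝ :=
  -(∑ i, ∑ j, A i j * secondPartial ψ i j x) + ψ x

lemma IsTestFunction.continuous_limitOp (hψ : IsTestFunction Ω ψ)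
    (A : Matrix (Fin d) (Fin d) ℝ) : Continuous (limitOp A ψ) := by
  have h0 := hψ.continuous
  have h2 := fun i j => (hψ.secondPartial i j).continuous
  exact (continuous_finsetSum _ fun i _ => continuous_finsetSum _ fun j _ =>
    continuous_const.mul (h2 i j)).neg.add h0

lemma limitOp_eq_zero {x : E d} (hx : x ∉ tsupport ψ) (A : Matrix (Fin d) (Fin d) ℝ) :
    limitOp A ψ x = 0 := by
  have h0 : ψ x = 0 := image_eq_zero_of_notMem_tsupport hx
  have h2 : ∀ i j, secondPartial ψ i j x = 0 := fun i j =>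
    image_eq_zero_of_notMem_tsupport fun h => hx (tsupport_partialDeriv_subset ψ i
      (tsupport_partialDeriv_subset (partialDeriv i ψ) j h))
  simp [limitOp, h0, h2]

lemma IsTestFunction.hasCompactSupport_limitOp (hψ : IsTestFunction Ω ψ)
    (A : Matrix (Fin d) (Fin d) ℝ) : HasCompactSupport (limitOp A ψ) :=
  HasCompactSupport.of_support_subset_isCompact hψ.2.1 fun x hx => by
    by_contra h
    exact hx (limitOp_eq_zero h A)

/-- Testing the resolvent equation with the oscillating test function. -/
lemma IsCorrector.exists_weak_form (h : IsCorrector hκ hJ a p Φ Φ₁ Φ₂) {φ : CT d}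
    (hφ : ∀ x, 0 < φ x)
    (hφeq : ∀ x, tiltOp hκ hJ.isWeight p φ x = (a x - hamiltonian J κ a p) * φ x)
    (hΩ : volume Ω < ⊤) (hψ : IsTestFunction Ω ψ) :
    ∃ C, 0 ≤ C ∧ ∀ (ε : ℝ) (f : Lp ℝ 2 (volume.restrict Ω)) (v : V d), 0 < ε → ε ≤ 1 →
      IsResolventSolution J κ p φ Ω ε f v →
      |(∫ x in Ω, v x * (CT.mul Φ φ (ε⁻¹ • x) * limitOp (effectiveMatrix J κ a p) ψ x))
        - ∫ x in Ω, f x * (CT.mul Φ φ (ε⁻¹ • x) * ψ x)|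
        ≤ C * ε * (1 + ‖v‖ ^ 2 + ‖f‖ ^ 2) := by
  set c : CT d := a - hamiltonian J κ a p • CT.one with hc
  have hcx : ∀ x, c x = a x - hamiltonian J κ a p := fun x => by
    simp [hc, CT.sub_apply, CT.smul_apply]
  have hpair : IsEigenPair hκ hJ p c Φ φ :=
    ⟨h.pos, hφ, fun x => by rw [hcx]; exact h.eq_zero x, fun x => by rw [hcx]; exact hφeq x⟩
  obtain ⟨C₁, hC₁, hexp⟩ := h.exists_expansion hψ
  obtain ⟨C₂, hC₂, hosc⟩ := hψ.exists_oscTest_sub_le (Φ := Φ) (Φ₁ := Φ₁) (Φ₂ := Φ₂)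
  set b := volume.real Ω with hb
  have hb0 : 0 ≤ b := ENNReal.toReal_nonneg
  refine ⟨2 * (‖φ‖ * (C₁ + C₂)) * (b + 1), by positivity, fun ε f v hε hε1 hv => ?_⟩
  obtain ⟨hv0, heq⟩ := (hpair.isResolventSolution_iff hε Ω f v).1 hv
  have hM := hpair.isBalancedKernel hε
  set s := ε⁻¹ with hs
  set M := symKernel J κ p Φ φ ε with hMdef
  set m : E d → ℝ := fun x => ε ^ d * (c (s • x) * (Φ (s • x) * φ (s • x))) with hm
  set G := oscTest Φ Φ₁ Φ₂ ψ ε with hG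
  set g : E d → ℝ := fun x => G x * (Φ (s • x))⁻¹ with hg
  set e := 1 / ε ^ (d + 2) with he
  have hμ : ∀ x, CT.mul Φ φ (s • x) = Φ (s • x) * φ (s • x) := fun x => CT.mul_apply _ _ _
  have hΦc := continuous_unscale s Φ
  have hφc := continuous_unscale s φ
  have hGc : Continuous G := hψ.continuous_oscTest ε
  have hgc : Continuous g := hGc.mul (hΦc.inv₀ fun x => (h.pos _).ne')
  have hG0 : ∀ x, x ∉ tsupport ψ → G x = 0 := fun x hx => oscTest_eq_zero hx ε
  have hg0 : ∀ x, x ∉ tsupport ψ → g x = 0 := fun x hx => by simp [hg, hG0 x hx]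
  have hgs : HasCompactSupport g := HasCompactSupport.of_support_subset_isCompact hψ.2.1
    fun x hx => by
      by_contra hx'
      exact hx (hg0 x hx')
  have hgm : MemLp g 2 volume := hgc.memLp_of_hasCompactSupport hgs
  have hvm : MemLp v 2 volume := Lp.memLp v
  have hgΦ : ∀ x, Φ (s • x) * g x = G x := fun x => by
    have := mul_inv_cancel₀ (h.pos (s • x)).ne'
    simp only [hg]
    linear_combination G x * this
  -- products of `L²` functions with continuous compactly supported ones
  have hcs : ∀ {w : E d → ℝ} {q : E d → ℝ} {ν : Measure (E d)} [IsFiniteMeasureOnCompacts ν],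
      MemLp w 2 ν → Continuous q → HasCompactSupport q → Integrable (fun x => w x * q x) ν :=
    fun hw hq hq' => hw.integrable_mul (q := 2) (hq.memLp_of_hasCompactSupport hq')
  have hN : ∀ y, ∫ x, M x y * g x = φ (s • y) * (ε ^ d *
      ∫ z, adjKernel J κ p (s • y) z * G (y - ε • z)) := fun y =>
    integral_symKernel_mul Φ φ h.pos hε G y
  -- The transposed resolvent operator applied to the test function `g`; balance allows the same
  -- mass `m` as in the original operator.
  set Θ : E d → ℝ := fun y => e * (m y * g y - ∫ x, M x y * g x) + Φ (s • y) * φ (s • y) * g y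
    with hΘ
  have hm0 : Integrable fun x => v x * (m x * g x) :=
    hcs hvm (hM.continuous_mass.mul hgc) hgs.mul_left
  have hμg : Integrable fun x => v x * (Φ (s • x) * φ (s • x) * g x) :=
    hcs hvm ((hΦc.mul hφc).mul hgc) hgs.mul_left
  have hNint : Integrable fun y => v y * ∫ x, M x y * g x := hM.swap.integrable_mul_integral hvm hgm
  have hTint : Integrable fun x => g x * ∫ y, M x y * v y := hM.integrable_mul_integral hgm hvm
  have hvΘ : Integrable fun y => v y * Θ y := by
    refine (((hm0.sub hNint).const_mul e).add hμg).congr (Eventually.of_forall fun x => ?_)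
    simp only [hΘ, Pi.add_apply, Pi.sub_apply]
    ring
  have hweak : ∫ x in Ω, v x * Θ x = ∫ x in Ω, f x * (Φ (s • x) * φ (s • x) * g x) := by
    have e1 : ∫ x in Ω, v x * Θ x = ∫ x, v x * Θ x :=
      setIntegral_eq_integral_of_ae_compl_eq_zero (by
        filter_upwards [hv0] with x hx hxΩ
        rw [hx hxΩ, zero_mul])
    have e2 : ∫ x, v x * Θ x
        = e * ((∫ x, v x * (m x * g x)) - ∫ y, v y * ∫ x, M x y * g x)
          + ∫ x, v x * (Φ (s • x) * φ (s • x) * g x) := by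
      have i1 : Integrable fun y => e * (v y * (m y * g y) - v y * ∫ x, M x y * g x) :=
        (hm0.sub hNint).const_mul e
      rw [← integral_sub hm0 hNint, ← integral_const_mul, ← integral_add i1 hμg]
      congr 1
      ext x
      simp only [hΘ]
      ring
    have e3 : ∫ y, v y * ∫ x, M x y * g x = ∫ x, g x * ∫ y, M x y * v y :=
      (hM.integral_mul' hgm hvm).symm
    have e4 : e * ((∫ x, v x * (m x * g x)) - ∫ x, g x * ∫ y, M x y * v y)
          + ∫ x, v x * (Φ (s • x) * φ (s • x) * g x)
        = ∫ x, (e * (m x * v x - ∫ y, M x y * v y) + Φ (s • x) * φ (s • x) * v x) * g x := by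
      have i1 : Integrable fun x => e * (v x * (m x * g x) - g x * ∫ y, M x y * v y) :=
        (hm0.sub hTint).const_mul e
      rw [← integral_sub hm0 hTint, ← integral_const_mul, ← integral_add i1 hμg]
      congr 1
      ext x
      ring
    have e5 : ∫ x, (e * (m x * v x - ∫ y, M x y * v y) + Φ (s • x) * φ (s • x) * v x) * g x
        = ∫ x in Ω, (e * (m x * v x - ∫ y, M x y * v y) + Φ (s • x) * φ (s • x) * v x) * g x := by
      symm
      refine setIntegral_eq_integral_of_forall_compl_eq_zero fun x hx => ?_
      rw [hg0 x fun h' => hx (hψ.2.2 h'), mul_zero]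
    rw [e1, e2, e3, e4, e5]
    refine integral_congr_ae ?_
    filter_upwards [heq] with x hx
    rw [hx]
    ring
  -- The expansion error `C₁ε³` is divided by `ε²`, and replacing `G` by its leading term in the
  -- zeroth-order part costs `C₂ε`.
  have hΘdiff : ∀ y, |Θ y - CT.mul Φ φ (s • y) * limitOp (effectiveMatrix J κ a p) ψ y|
      ≤ ‖φ‖ * (C₁ + C₂) * ε := by
    intro y
    have b1 := hexp ε hε y
    have b2 := hosc ε hε hε1 y
    rw [← hG, ← hs] at b1 b2
    set I := ∫ z, adjKernel J κ p (s • y) z * G (y - ε • z) with hI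
    set S := ∑ i, ∑ j, secondPartial (hamiltonian J κ a) i j p * secondPartial ψ i j y with hS
    have hlim : limitOp (effectiveMatrix J κ a p) ψ y = 1 / 2 * S + ψ y := by
      simp only [limitOp, effectiveMatrix, hS]
      rw [Finset.mul_sum, ← Finset.sum_neg_distrib]
      congr 1
      refine Finset.sum_congr rfl fun i _ => ?_
      rw [Finset.mul_sum, ← Finset.sum_neg_distrib]
      exact Finset.sum_congr rfl fun j _ => by ring
    have hee : e * ε ^ d = (ε ^ 2)⁻¹ := by
      rw [he, pow_add]
      field_simp
    have hΘy : Θ y = φ (s • y) * ((ε ^ 2)⁻¹ * (c (s • y) * G y - I) + G y) := by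
      simp only [hΘ, hN, hm]
      rw [← hee]
      have := hgΦ y
      linear_combination (φ (s • y) * (e * ε ^ d * c (s • y)) + φ (s • y)) * this
    have hdec : Θ y - CT.mul Φ φ (s • y) * limitOp (effectiveMatrix J κ a p) ψ y
        = φ (s • y) * (-((ε ^ 2)⁻¹ * (I - (c (s • y) * G y - ε ^ 2 / 2 * (Φ (s • y) * S))))
          + (G y - Φ (s • y) * ψ y)) := by
      rw [hΘy, hμ, hlim]
      field_simp
      ring
    rw [hdec, abs_mul]
    rw [← hcx] at b1
    have b3 : |(ε ^ 2)⁻¹ * (I - (c (s • y) * G y - ε ^ 2 / 2 * (Φ (s • y) * S)))| ≤ C₁ * ε := by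
      rw [abs_mul, abs_of_pos (by positivity), inv_mul_le_iff₀ (by positivity)]
      calc _ ≤ C₁ * ε ^ 3 := b1
        _ = ε ^ 2 * (C₁ * ε) := by ring
    have b4 : |-((ε ^ 2)⁻¹ * (I - (c (s • y) * G y - ε ^ 2 / 2 * (Φ (s • y) * S))))
          + (G y - Φ (s • y) * ψ y)| ≤ (C₁ + C₂) * ε := by
      refine (abs_add_le _ _).trans ?_
      rw [abs_neg]
      linarith
    calc _ ≤ ‖φ‖ * ((C₁ + C₂) * ε) :=
          mul_le_mul (φ.abs_apply_le _) b4 (abs_nonneg _) (norm_nonneg _)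
      _ = _ := by ring
  have hfdiff : ∀ x, |Φ (s • x) * φ (s • x) * g x - CT.mul Φ φ (s • x) * ψ x|
      ≤ ‖φ‖ * (C₁ + C₂) * ε := by
    intro x
    have b2 := hosc ε hε hε1 x
    rw [← hG, ← hs] at b2
    have e1 : Φ (s • x) * φ (s • x) * g x - CT.mul Φ φ (s • x) * ψ x
        = φ (s • x) * (G x - Φ (s • x) * ψ x) := by
      rw [hμ]
      linear_combination φ (s • x) * hgΦ x
    rw [e1, abs_mul]
    calc _ ≤ ‖φ‖ * (C₂ * ε) := mul_le_mul (φ.abs_apply_le _) b2 (abs_nonneg _) (norm_nonneg _)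
      _ ≤ ‖φ‖ * ((C₁ + C₂) * ε) := by
          gcongr
          linarith
      _ = _ := by ring
  have hμc : Continuous fun x => CT.mul Φ φ (s • x) := continuous_unscale s (CT.mul Φ φ)
  have hδ : 0 ≤ ‖φ‖ * (C₁ + C₂) * ε := by positivity
  have r1 := abs_setIntegral_mul_sub_le hΩ (u := v) (hvm.restrict Ω) hδ hvΘ.integrableOn
    (hcs (hvm.restrict Ω) (hμc.mul (hψ.continuous_limitOp (effectiveMatrix J κ a p)))
      (hψ.hasCompactSupport_limitOp _).mul_left) hΘdiff
  have r2 := abs_setIntegral_mul_sub_le hΩ (u := f) (Lp.memLp f) hδ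
    (hcs (Lp.memLp f) ((hΦc.mul hφc).mul hgc) hgs.mul_left)
    (hcs (Lp.memLp f) (hμc.mul hψ.continuous) hψ.2.1.mul_left) hfdiff
  rw [hweak] at r1
  rw [← Lp_norm_sq] at r2
  have r3 : ∫ x in Ω, v x ^ 2 ≤ ‖v‖ ^ 2 := by
    rw [Lp_norm_sq]
    exact setIntegral_le_integral hvm.integrable_sq (Eventually.of_forall fun x => sq_nonneg _)
  set X := ∫ x in Ω, v x * (CT.mul Φ φ (s • x) * limitOp (effectiveMatrix J κ a p) ψ x)
  set Y := ∫ x in Ω, f x * (CT.mul Φ φ (s • x) * ψ x)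
  set Z := ∫ x in Ω, f x * (Φ (s • x) * φ (s • x) * g x)
  have r4 : |X - Y| ≤ |Z - X| + |Z - Y| := by
    have := abs_sub (Z - Y) (Z - X)
    rw [show Z - Y - (Z - X) = X - Y by ring] at this
    linarith
  refine r4.trans ((add_le_add r1 r2).trans ?_)
  have r5 : 0 ≤ ‖v‖ ^ 2 := sq_nonneg _
  have r6 : 0 ≤ ‖f‖ ^ 2 := sq_nonneg _
  set L := ‖φ‖ * (C₁ + C₂) * ε
  calc L * (b + ∫ x in Ω, v x ^ 2) + L * (b + ‖f‖ ^ 2)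
      = L * ((b + ∫ x in Ω, v x ^ 2) + (b + ‖f‖ ^ 2)) := by ring
    _ ≤ L * (2 * ((b + 1) * (1 + ‖v‖ ^ 2 + ‖f‖ ^ 2))) := by
        refine mul_le_mul_of_nonneg_left ?_ hδ
        nlinarith [mul_nonneg hb0 r5, mul_nonneg hb0 r6]
    _ = _ := by ring

end

/-! ### Passage to the limit -/

lemma abs_integral_mul_le {α : Type*} [MeasurableSpace α] {ν : Measure α} {u q : α → ℝ}
    (hu : MemLp u 2 ν) (hq : MemLp q 2 ν) :
    |∫ x, u x * q x ∂ν| ≤ (eLpNorm u 2 ν).toReal * (eLpNorm q 2 ν).toReal := by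
  have h1 : ∫ x, u x * q x ∂ν = inner ℝ hu.toLp hq.toLp := by
    rw [L2.inner_def]
    refine integral_congr_ae ?_
    filter_upwards [hu.coeFn_toLp, hq.coeFn_toLp] with x h1 h2
    rw [h1, h2]
    simp [mul_comm]
  rw [h1, ← Lp.norm_toLp u hu, ← Lp.norm_toLp q hq]
  exact abs_real_inner_le_norm _ _

/-- Strong times weak convergence: `u n - u₀` is paired with a sequence bounded in `L²`, and the
rest is the oscillation lemma for the integrable function `u₀ q` on `Ω`. -/
lemma tendsto_setIntegral_mul_oscillating {Ω : Set (E d)} (hΩ : MeasurableSet Ω)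
    {u : ℕ → E d → ℝ} {u₀ q : E d → ℝ} (hu : ∀ n, MemLp (u n) 2 (volume.restrict Ω))
    (hu₀ : MemLp u₀ 2 (volume.restrict Ω))
    (hlim : Tendsto (fun n => eLpNorm (fun x => u n x - u₀ x) 2 (volume.restrict Ω)) atTop (𝓝 0))
    (hq : Continuous q) (hqs : HasCompactSupport q) (μ : CT d) {ε : ℕ → ℝ}
    (hε : ∀ n, 0 < ε n) (hε0 : Tendsto ε atTop (𝓝 0)) :
    Tendsto (fun n => ∫ x in Ω, u n x * (μ ((ε n)⁻¹ • x) * q x)) atTop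
      (𝓝 (cellMean μ / volume.real (unitCell d) * ∫ x in Ω, u₀ x * q x)) := by
  have hqm : MemLp q 2 (volume.restrict Ω) := hq.memLp_of_hasCompactSupport hqs
  have hμq : ∀ n, MemLp (fun x => μ ((ε n)⁻¹ • x) * q x) 2 (volume.restrict Ω) := fun n =>
    memLp_mul_of_bound (continuous_unscale _ μ).aestronglyMeasurable
      (fun x => μ.abs_apply_le _) hqm
  have hInt : IntegrableOn (fun x => u₀ x * q x) Ω := hu₀.integrable_mul (q := 2) hqm
  have h1 := tendsto_integral_mul_oscillating (hInt.integrable_indicator hΩ) μ hε hε0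
  rw [integral_indicator hΩ] at h1
  have h2 : ∀ n, ∫ x, Ω.indicator (fun x => u₀ x * q x) x * μ ((ε n)⁻¹ • x)
      = ∫ x in Ω, u₀ x * (μ ((ε n)⁻¹ • x) * q x) := by
    intro n
    rw [← integral_indicator hΩ]
    congr 1
    ext x
    by_cases hx : x ∈ Ω
    · simp only [Set.indicator_of_mem hx]
      ring
    · simp [Set.indicator_of_notMem hx]
  simp only [h2] at h1
  have h3 : Tendsto (fun n => ∫ x in Ω, (u n x - u₀ x) * (μ ((ε n)⁻¹ • x) * q x)) atTop
      (𝓝 0) := by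
    refine squeeze_zero_norm (a := fun n =>
      (eLpNorm (fun x => u n x - u₀ x) 2 (volume.restrict Ω)).toReal
        * (‖μ‖ * (eLpNorm q 2 (volume.restrict Ω)).toReal)) (fun n => ?_) ?_
    · refine (abs_integral_mul_le ((hu n).sub hu₀) (hμq n)).trans ?_
      refine mul_le_mul_of_nonneg_left ?_ ENNReal.toReal_nonneg
      have h4 : eLpNorm (fun x => μ ((ε n)⁻¹ • x) * q x) 2 (volume.restrict Ω)
          ≤ ENNReal.ofReal ‖μ‖ * eLpNorm q 2 (volume.restrict Ω) :=
        eLpNorm_le_mul_eLpNorm_of_ae_le_mul (Eventually.of_forall fun x => by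
          rw [norm_mul]
          exact mul_le_mul_of_nonneg_right (μ.abs_apply_le _) (norm_nonneg _)) 2
      have h5 := ENNReal.toReal_mono (ENNReal.mul_ne_top ENNReal.ofReal_ne_top hqm.2.ne) h4
      rwa [ENNReal.toReal_mul, ENNReal.toReal_ofReal (norm_nonneg _)] at h5
    · have h6 := (ENNReal.tendsto_toReal ENNReal.zero_ne_top).comp hlim
      have h7 := h6.mul_const (‖μ‖ * (eLpNorm q 2 (volume.restrict Ω)).toReal)
      simpa using h7
  have h8 := h3.add h1
  rw [zero_add] at h8
  refine h8.congr fun n => ?_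
  have i1 : Integrable (fun x => (u n x - u₀ x) * (μ ((ε n)⁻¹ • x) * q x)) (volume.restrict Ω) :=
    ((hu n).sub hu₀).integrable_mul (q := 2) (hμq n)
  have i2 : Integrable (fun x => u₀ x * (μ ((ε n)⁻¹ • x) * q x)) (volume.restrict Ω) :=
    hu₀.integrable_mul (q := 2) (hμq n)
  rw [← integral_add i1 i2]
  congr 1
  ext x
  ring

lemma ae_eq_zero_of_tendsto {Ω : Set (E d)} {v : ℕ → V d} {w : V d}
    (hv : Tendsto v atTop (𝓝 w)) (h0 : ∀ n, ∀ᵐ x, x ∉ Ω → v n x = 0) :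
    ∀ᵐ x, x ∉ Ω → w x = 0 := by
  obtain ⟨s, -, hs⟩ := (tendstoInMeasure_of_tendsto_Lp hv).exists_seq_tendsto_ae
  have h1 : ∀ᵐ x, ∀ n, x ∉ Ω → v n x = 0 := ae_all_iff.2 h0
  filter_upwards [hs, h1] with x h2 h3 hx
  simp only [h3 _ hx] at h2
  exact tendsto_nhds_unique h2 tendsto_const_nhds

/-! ### Limits and compactness of the solutions -/

section

variable {J : E d → ℝ} {κ : E d → E d → ℝ} {Φ : CT d} {Φ₁ : Fin d → CT d}
  {Φ₂ : Fin d → Fin d → CT d} {Ω : Set (E d)} {a : CT d} {p : E d}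
  {hκ : IsPositiveCoefficient κ} {hJ : IsDispersalKernel J}

lemma IsCorrector.isEigenPair (h : IsCorrector hκ hJ a p Φ Φ₁ Φ₂) {φ : CT d}
    (hφ : IsPrincipalEigenfunction J κ a p φ) :
    IsEigenPair hκ hJ p (a - hamiltonian J κ a p • CT.one) Φ φ := by
  obtain ⟨h1, h2⟩ := (isPrincipalEigenfunction_iff hκ hJ a p φ).1 hφ
  have hc : ∀ x, (a - hamiltonian J κ a p • CT.one : CT d) x = a x - hamiltonian J κ a p :=
    fun x => by simp [CT.sub_apply, CT.smul_apply]
  exact ⟨h.pos, h1, fun x => by rw [hc]; exact h.eq_zero x, fun x => by rw [hc]; exact h2 x⟩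

/-- Strong limits of solutions of the resolvent problems solve the limit problem. -/
lemma IsCorrector.isLimitSolution (h : IsCorrector hκ hJ a p Φ Φ₁ Φ₂) {φ : CT d}
    (hφ : IsPrincipalEigenfunction J κ a p φ) (hΩ : IsBoundedC1Domain Ω) {ε : ℕ → ℝ}
    {f : ℕ → Lp ℝ 2 (volume.restrict Ω)} {f₀ : Lp ℝ 2 (volume.restrict Ω)} {v : ℕ → V d}
    {w : V d} (hε : ∀ n, 0 < ε n) (hε0 : Tendsto ε atTop (𝓝 0)) (hf : Tendsto f atTop (𝓝 f₀))
    (hv : ∀ n, IsResolventSolution J κ p φ Ω (ε n) (f n) (v n)) (hw : Tendsto v atTop (𝓝 w)) :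
    IsLimitSolution (effectiveMatrix J κ a p) Ω f₀ w := by
  have hpair := h.isEigenPair hφ
  obtain ⟨hφpos, hφeq⟩ := (isPrincipalEigenfunction_iff hκ hJ a p φ).1 hφ
  have hw0 : ∀ᵐ x, x ∉ Ω → w x = 0 := ae_eq_zero_of_tendsto hw fun n => (hv n).2
  refine ⟨?_, hw0, fun ψ hψ => ?_⟩
  · obtain ⟨C, hC0, hC⟩ := hpair.exists_uniform_bound Ω
    -- The term with `ε` in the uniform modulus disappears in the limit, leaving a Lipschitz
    -- modulus.
    refine memH10_of_shiftNorm hΩ hw0 (K := C * ‖f₀‖) fun z => ?_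
    have h1 : Tendsto (fun n => shiftNorm (v n) z) atTop (𝓝 (shiftNorm w z)) :=
      ((continuous_shiftNorm_left z).tendsto w).comp hw
    have h2 : Tendsto (fun n => C * ‖f n‖ * ‖z‖ + C * ‖f n‖ * ε n) atTop
        (𝓝 (C * ‖f₀‖ * ‖z‖ + C * ‖f₀‖ * 0)) :=
      ((hf.norm.const_mul C).mul_const _).add ((hf.norm.const_mul C).mul hε0)
    rw [mul_zero, add_zero] at h2
    exact le_of_tendsto_of_tendsto' h1 h2 fun n => (hC (ε n) (f n) (v n) (hε n) (hv n)).2 z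
  · change ∫ x in Ω, w x * limitOp (effectiveMatrix J κ a p) ψ x = _
    obtain ⟨C, hC0, hC⟩ := h.exists_weak_form hφpos hφeq hΩ.isBounded.measure_lt_top hψ
    have hΩm := hΩ.isOpen.measurableSet
    set B := cellMean (CT.mul Φ φ) / volume.real (unitCell d) with hB
    have hB0 : B ≠ 0 := by
      have h1 : 0 < cellMean (CT.mul Φ φ) := cellMean_pos fun x => by
        rw [CT.mul_apply]
        exact mul_pos (h.pos x) (hφpos x)
      have h2 : 0 < volume.real (unitCell d) :=
        ENNReal.toReal_pos volume_unitCell_ne_zero isBounded_unitCell.measure_lt_top.ne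
      positivity
    have t1 := tendsto_setIntegral_mul_oscillating hΩm (u := fun n => v n) (u₀ := w)
      (fun n => (Lp.memLp (v n)).restrict Ω) ((Lp.memLp w).restrict Ω) (by
        have h1 := (Lp.tendsto_Lp_iff_tendsto_eLpNorm' v w).1 hw
        exact tendsto_of_tendsto_of_tendsto_of_le_of_le tendsto_const_nhds h1
          (fun n => zero_le) fun n => eLpNorm_mono_measure _ Measure.restrict_le_self)
      (hψ.continuous_limitOp (effectiveMatrix J κ a p)) (hψ.hasCompactSupport_limitOp _)
      (CT.mul Φ φ) hε hε0
    have t2 := tendsto_setIntegral_mul_oscillating hΩm (u := fun n => f n) (u₀ := f₀)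
      (fun n => Lp.memLp (f n)) (Lp.memLp f₀)
      ((Lp.tendsto_Lp_iff_tendsto_eLpNorm' f f₀).1 hf) hψ.continuous hψ.2.1
      (CT.mul Φ φ) hε hε0
    have t3 := t1.sub t2
    have t4 : Tendsto (fun n => C * ε n * (1 + ‖v n‖ ^ 2 + ‖f n‖ ^ 2)) atTop (𝓝 0) := by
      have := (hε0.const_mul C).mul ((tendsto_const_nhds (x := (1 : ℝ))).add (hw.norm.pow 2) |>.add
        (hf.norm.pow 2))
      simpa using this
    have hε1 : ∀ᶠ n in atTop, ε n ≤ 1 :=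
      (hε0.eventually (gt_mem_nhds one_pos)).mono fun n hn => hn.le
    have t5 : Tendsto (fun n => (∫ x in Ω, v n x
          * (CT.mul Φ φ ((ε n)⁻¹ • x) * limitOp (effectiveMatrix J κ a p) ψ x))
        - ∫ x in Ω, f n x * (CT.mul Φ φ ((ε n)⁻¹ • x) * ψ x)) atTop (𝓝 0) :=
      squeeze_zero_norm' (hε1.mono fun n hn => by
        rw [Real.norm_eq_abs]
        exact hC (ε n) (f n) (v n) (hε n) hn (hv n)) t4
    -- Both sides acquire the factor `B`, the mean of `Φφ`, which is positive and cancels.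
    have t6 := tendsto_nhds_unique t3 t5
    rw [← mul_sub] at t6
    exact sub_eq_zero.1 ((mul_eq_zero.1 t6).resolve_left hB0)

/-- Compactness of solutions. -/
lemma IsEigenPair.exists_subseq {c φ : CT d} (h : IsEigenPair hκ hJ p c Φ φ)
    (hΩ : Bornology.IsBounded Ω) {ε : ℕ → ℝ} {f : ℕ → Lp ℝ 2 (volume.restrict Ω)} {v : ℕ → V d}
    {C : ℝ} (hε : ∀ n, 0 < ε n) (hε0 : Tendsto ε atTop (𝓝 0)) (hf : ∀ n, ‖f n‖ ≤ C)
    (hv : ∀ n, IsResolventSolution J κ p φ Ω (ε n) (f n) (v n)) :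
    ∃ (w : V d) (s : ℕ → ℕ), StrictMono s ∧ Tendsto (fun n => v (s n)) atTop (𝓝 w) := by
  obtain ⟨D, hD0, hD⟩ := h.exists_uniform_bound Ω
  have hC0 : 0 ≤ C := (norm_nonneg _).trans (hf 0)
  have hfD : ∀ n, D * ‖f n‖ ≤ D * C := fun n => mul_le_mul_of_nonneg_left (hf n) hD0
  refine exists_convergent_subseq hΩ (C := D * C) (K := D * C) (ε := ε)
    (fun n => (hD (ε n) (f n) (v n) (hε n) (hv n)).1.trans (hfD n)) (by positivity) hε0
    (fun n => (hv n).2) fun n z => ?_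
  refine ((hD (ε n) (f n) (v n) (hε n) (hv n)).2 z).trans ?_
  exact add_le_add (mul_le_mul_of_nonneg_right (hfD n) (norm_nonneg _))
    (mul_le_mul_of_nonneg_right (hfD n) (hε n).le)

end

/-! ### Uniqueness for the limit problem -/

/-- Componentwise form in the Hilbert space `V d`, where inner products pass to the limit. -/
lemma MemH10.exists_seq {Ω : Set (E d)} {w : V d} (h : MemH10 Ω w) :
    ∃ (ψ : ℕ → E d → ℝ) (hψ : ∀ n, IsTestFunction Ω (ψ n)) (g : Fin d → V d),
      Tendsto (fun n => ((hψ n).memLp.toLp : V d)) atTop (𝓝 w) ∧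
      ∀ i, Tendsto (fun n => (((hψ n).partialDeriv i).memLp.toLp : V d)) atTop (𝓝 (g i)) := by
  obtain ⟨ψ, G, hψ, hG, h1, h2⟩ := h
  have hGi : ∀ i, MemLp (fun x => G x i) 2 volume := fun i =>
    hG.of_le_mul (c := 1) ((EuclideanSpace.proj i).continuous.comp_aestronglyMeasurable hG.1)
      (Eventually.of_forall fun x => by
        rw [one_mul]
        exact abs_coord_le (G x) i)
  refine ⟨ψ, hψ, fun i => (hGi i).toLp, ?_, fun i => ?_⟩
  · rw [Lp.tendsto_Lp_iff_tendsto_eLpNorm']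
    refine h1.congr fun n => eLpNorm_congr_ae ?_
    filter_upwards [(hψ n).memLp.coeFn_toLp] with x hx
    rw [Pi.sub_apply, hx]
  · rw [Lp.tendsto_Lp_iff_tendsto_eLpNorm']
    refine tendsto_of_tendsto_of_tendsto_of_le_of_le tendsto_const_nhds h2
      (fun n => zero_le) fun n => ?_
    refine (eLpNorm_congr_ae (g := fun x => partialDeriv i (ψ n) x - G x i) ?_).le.trans ?_
    · filter_upwards [((hψ n).partialDeriv i).memLp.coeFn_toLp, (hGi i).coeFn_toLp] with x h3 h4
      rw [Pi.sub_apply, h3, h4]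
    · refine eLpNorm_mono fun x => ?_
      have h3 : partialDeriv i (ψ n) x - G x i = (gradient (ψ n) x - G x) i := by
        rw [PiLp.sub_apply, gradient_apply]
        rfl
      rw [h3]
      exact abs_coord_le _ i

lemma IsTestFunction.integral_mul_secondPartial {Ω Ω' : Set (E d)} {ψ χ : E d → ℝ}
    (hψ : IsTestFunction Ω ψ) (hχ : IsTestFunction Ω' χ) (i j : Fin d) :
    ∫ x, ψ x * NonlocalHomogenization.secondPartial χ i j x
      = -∫ x, NonlocalHomogenization.partialDeriv j ψ x
        * NonlocalHomogenization.partialDeriv i χ x := by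
  have hi := hχ.partialDeriv i
  exact integral_mul_fderiv_eq_neg_fderiv_mul_of_integrable
    ((hψ.partialDeriv j).memLp.integrable_mul (q := 2) hi.memLp)
    (hψ.memLp.integrable_mul (q := 2) (hi.partialDeriv j).memLp)
    (hψ.memLp.integrable_mul (q := 2) hi.memLp)
    (fun x _ => hψ.1.differentiable (by simp) x) (fun x _ => hi.1.differentiable (by simp) x)

lemma inner_toLp_toLp {ψ χ : E d → ℝ} (hψ : MemLp ψ 2 volume) (hχ : MemLp χ 2 volume) :
    inner ℝ (hψ.toLp : V d) hχ.toLp = ∫ x, ψ x * χ x := by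
  rw [L2.inner_def]
  refine integral_congr_ae ?_
  filter_upwards [hψ.coeFn_toLp, hχ.coeFn_toLp] with x h1 h2
  rw [h1, h2]
  simp [mul_comm]

lemma inner_toLp_right (w : V d) {χ : E d → ℝ} (hχ : MemLp χ 2 volume) :
    inner ℝ w hχ.toLp = ∫ x, w x * χ x := by
  rw [L2.inner_def]
  refine integral_congr_ae ?_
  filter_upwards [hχ.coeFn_toLp] with x h2
  rw [h2]
  simp [mul_comm]

/-- The variational form of the limit equation. -/
lemma IsLimitSolution.variational {A : Matrix (Fin d) (Fin d) ℝ} {Ω : Set (E d)}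
    {f : Lp ℝ 2 (volume.restrict Ω)} {w : V d} (h : IsLimitSolution A Ω f w)
    {ψ : ℕ → E d → ℝ} {hψ : ∀ n, IsTestFunction Ω (ψ n)} {g : Fin d → V d}
    (h1 : Tendsto (fun n => ((hψ n).memLp.toLp : V d)) atTop (𝓝 w))
    (h2 : ∀ i, Tendsto (fun n => (((hψ n).partialDeriv i).memLp.toLp : V d)) atTop (𝓝 (g i)))
    {χ : E d → ℝ} (hχ : IsTestFunction Ω χ) :
    (∑ i, ∑ j, A i j * inner ℝ (g j) ((hχ.partialDeriv i).memLp.toLp : V d))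
      + inner ℝ w (hχ.memLp.toLp : V d) = ∫ x in Ω, f x * χ x := by
  have hL : MemLp (limitOp A χ) 2 volume :=
    (hχ.continuous_limitOp A).memLp_of_hasCompactSupport (hχ.hasCompactSupport_limitOp A)
  have e1 : inner ℝ w hL.toLp = ∫ x in Ω, f x * χ x := by
    rw [inner_toLp_right, ← h.2.2 χ hχ]
    refine (setIntegral_eq_integral_of_ae_compl_eq_zero ?_).symm
    filter_upwards [h.2.1] with x hx hxΩ
    rw [hx hxΩ, zero_mul]
  rw [← e1]
  have t1 : Tendsto (fun n => inner ℝ ((hψ n).memLp.toLp : V d) hL.toLp) atTop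
      (𝓝 (inner ℝ w hL.toLp)) := h1.inner tendsto_const_nhds
  have t2 : Tendsto (fun n => (∑ i, ∑ j, A i j * inner ℝ
        (((hψ n).partialDeriv j).memLp.toLp : V d) ((hχ.partialDeriv i).memLp.toLp : V d))
      + inner ℝ ((hψ n).memLp.toLp : V d) (hχ.memLp.toLp : V d)) atTop
      (𝓝 ((∑ i, ∑ j, A i j * inner ℝ (g j) ((hχ.partialDeriv i).memLp.toLp : V d))
      + inner ℝ w (hχ.memLp.toLp : V d))) :=
    (tendsto_finsetSum _ fun i _ => tendsto_finsetSum _ fun j _ =>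
      ((h2 j).inner tendsto_const_nhds).const_mul _).add (h1.inner tendsto_const_nhds)
  -- For the approximating test functions one integration by parts in each term identifies the two
  -- expressions; only then does `n` tend to infinity.
  refine tendsto_nhds_unique t2 (t1.congr fun n => ?_)
  have hn := hψ n
  have hInt : ∀ i j, Integrable fun x => ψ n x * (A i j * secondPartial χ i j x) := fun i j =>
    hn.memLp.integrable_mul (q := 2) ((hχ.secondPartial i j).memLp.const_mul (A i j))
  simp only [inner_toLp_toLp]
  have e2 : ∀ x, ψ n x * limitOp A χ x
      = -(∑ i, ∑ j, ψ n x * (A i j * secondPartial χ i j x)) + ψ n x * χ x := fun x => by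
    simp only [limitOp, mul_add, mul_neg, Finset.mul_sum]
  simp only [e2]
  have i1 : Integrable fun x => ∑ i, ∑ j, ψ n x * (A i j * secondPartial χ i j x) :=
    integrable_finsetSum _ fun i _ => integrable_finsetSum _ fun j _ => hInt i j
  have i2 : Integrable fun x => -(∑ i, ∑ j, ψ n x * (A i j * secondPartial χ i j x)) := i1.neg
  have i3 : Integrable fun x => ψ n x * χ x := hn.memLp.integrable_mul (q := 2) hχ.memLp
  rw [integral_add i2 i3, integral_neg,
    integral_finsetSum _ fun i _ => integrable_finsetSum _ fun j _ => hInt i j,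
    ← Finset.sum_neg_distrib]
  congr 1
  refine Finset.sum_congr rfl fun i _ => ?_
  rw [integral_finsetSum _ fun j _ => hInt i j, ← Finset.sum_neg_distrib]
  refine Finset.sum_congr rfl fun j _ => ?_
  have e3 : ∀ x, ψ n x * (A i j * secondPartial χ i j x)
      = A i j * (ψ n x * secondPartial χ i j x) := fun x => by ring
  simp only [e3]
  rw [integral_const_mul, hn.integral_mul_secondPartial hχ, mul_neg, neg_neg]

/-- The quadratic form is applied pointwise to `(g i x)` and integrated. -/
lemma sum_inner_nonneg {A : Matrix (Fin d) (Fin d) ℝ}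
    (hA : ∀ x : Fin d → ℝ, 0 ≤ ∑ i, ∑ j, A i j * (x i * x j)) (g : Fin d → V d) :
    0 ≤ ∑ i, ∑ j, A i j * inner ℝ (g j) (g i) := by
  have hInt : ∀ i j, Integrable fun x => A i j * (g i x * g j x) := fun i j =>
    ((Lp.memLp (g i)).integrable_mul (q := 2) (Lp.memLp (g j))).const_mul _
  have h1 : ∑ i, ∑ j, A i j * inner ℝ (g j) (g i)
      = ∫ x, ∑ i, ∑ j, A i j * (g i x * g j x) := by
    rw [integral_finsetSum _ fun i _ => integrable_finsetSum _ fun j _ => hInt i j]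
    refine Finset.sum_congr rfl fun i _ => ?_
    rw [integral_finsetSum _ fun j _ => hInt i j]
    refine Finset.sum_congr rfl fun j _ => ?_
    rw [integral_const_mul, L2.inner_def]
    simp
  rw [h1]
  exact integral_nonneg fun x => hA fun i => g i x

/-- Uniqueness for the limit problem. -/
lemma IsLimitSolution.unique {A : Matrix (Fin d) (Fin d) ℝ}
    (hA : ∀ x : Fin d → ℝ, 0 ≤ ∑ i, ∑ j, A i j * (x i * x j)) {Ω : Set (E d)}
    {f : Lp ℝ 2 (volume.restrict Ω)} {w w' : V d} (h : IsLimitSolution A Ω f w)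
    (h' : IsLimitSolution A Ω f w') : w = w' := by
  obtain ⟨ψ, hψ, g, h1, h2⟩ := h.1.exists_seq
  obtain ⟨ψ', hψ', g', h1', h2'⟩ := h'.1.exists_seq
  have key : ∀ χ (hχ : IsTestFunction Ω χ),
      (∑ i, ∑ j, A i j * inner ℝ (g j - g' j) ((hχ.partialDeriv i).memLp.toLp : V d))
        + inner ℝ (w - w') (hχ.memLp.toLp : V d) = 0 := by
    intro χ hχ
    have e1 := h.variational (hψ := hψ) h1 h2 hχ
    have e2 := h'.variational (hψ := hψ') h1' h2' hχ
    simp only [inner_sub_left, mul_sub, Finset.sum_sub_distrib]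
    linarith
  -- The identity for the difference extends by density to both solutions, so it can be tested with
  -- `w - w'`. The gradient form is nonnegative, and the zeroth-order term forces `w = w'`.
  have lim : ∀ {ψ : ℕ → E d → ℝ} {hψ : ∀ n, IsTestFunction Ω (ψ n)} {q : Fin d → V d} {u : V d},
      Tendsto (fun n => ((hψ n).memLp.toLp : V d)) atTop (𝓝 u) →
      (∀ i, Tendsto (fun n => (((hψ n).partialDeriv i).memLp.toLp : V d)) atTop (𝓝 (q i))) →
      (∑ i, ∑ j, A i j * inner ℝ (g j - g' j) (q i)) + inner ℝ (w - w') u = 0 := by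
    intro ψ hψ q u t1 t2
    have t3 : Tendsto (fun n => (∑ i, ∑ j, A i j * inner ℝ (g j - g' j)
        (((hψ n).partialDeriv i).memLp.toLp : V d))
        + inner ℝ (w - w') ((hψ n).memLp.toLp : V d)) atTop
        (𝓝 ((∑ i, ∑ j, A i j * inner ℝ (g j - g' j) (q i)) + inner ℝ (w - w') u)) :=
      (tendsto_finsetSum _ fun i _ => tendsto_finsetSum _ fun j _ =>
        (tendsto_const_nhds.inner (t2 i)).const_mul _).add (tendsto_const_nhds.inner t1)
    exact tendsto_nhds_unique (t3.congr fun n => key (ψ n) (hψ n)) tendsto_const_nhds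
  have e1 := lim (hψ := hψ) h1 h2
  have e2 := lim (hψ := hψ') h1' h2'
  have e3 : (∑ i, ∑ j, A i j * inner ℝ (g j - g' j) (g i - g' i))
      + inner ℝ (w - w') (w - w') = 0 := by
    have e4 : ∀ i j, A i j * inner ℝ (g j - g' j) (g i - g' i)
        = A i j * inner ℝ (g j - g' j) (g i) - A i j * inner ℝ (g j - g' j) (g' i) := fun i j => by
      rw [inner_sub_right, mul_sub]
    simp only [e4, Finset.sum_sub_distrib]
    rw [inner_sub_right (w - w')]
    linarith
  have e5 := sum_inner_nonneg hA fun i => g i - g' i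
  rw [real_inner_self_eq_norm_sq] at e3
  have e6 : ‖w - w'‖ ^ 2 = 0 := le_antisymm (by linarith) (sq_nonneg _)
  exact sub_eq_zero.1 (norm_eq_zero.1 (pow_eq_zero_iff two_ne_zero |>.1 e6))

/-! ### Second derivatives at a maximum -/

/-- The double sum is the second derivative of `F` along the line through `p` in direction `x`. -/
lemma sum_secondPartial_nonpos {F : E d → ℝ} {p : E d} (hF : ContDiffAt ℝ 2 F p)
    (hmax : ∀ q, F q ≤ F p) (x : Fin d → ℝ) :
    ∑ i, ∑ j, secondPartial F i j p * (x i * x j) ≤ 0 := by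
  set e : E d := WithLp.toLp 2 x with he
  have hex : ∀ i, e i = x i := fun i => rfl
  let h : ℝ → ℝ := fun t => F (p + t • e)
  have hline : ∀ t, HasDerivAt (fun t : ℝ => p + t • e) e t := fun t => by
    simpa using ((hasDerivAt_id t).smul_const e).const_add p
  have hp0 : p + (0 : ℝ) • e = p := by simp
  have htend : Tendsto (fun t : ℝ => p + t • e) (𝓝 0) (𝓝 p) := by
    have : Continuous fun t : ℝ => p + t • e := by fun_prop
    simpa using this.tendsto 0
  have hev : ∀ᶠ q in 𝓝 p, DifferentiableAt ℝ F q :=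
    (hF.eventually (by simp)).mono fun q hq => hq.differentiableAt (by simp)
  have hder : ∀ᶠ t in 𝓝 (0 : ℝ), deriv h t = ∑ i, x i * partialDeriv i F (p + t • e) := by
    filter_upwards [htend.eventually hev] with t ht
    have h2 : HasDerivAt h (fderiv ℝ F (p + t • e) e) t :=
      ht.hasFDerivAt.comp_hasDerivAt t (hline t)
    rw [h2.deriv, fderiv_eq_sum]
  have hdd : deriv (deriv h) 0 = ∑ i, ∑ j, secondPartial F i j p * (x i * x j) := by
    rw [EventuallyEq.deriv_eq hder]
    have h1 : ∀ i, HasDerivAt (fun t : ℝ => partialDeriv i F (p + t • e))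
        (∑ j, x j * partialDeriv j (partialDeriv i F) p) 0 := fun i => by
      have hd : DifferentiableAt ℝ (partialDeriv i F) (p + (0 : ℝ) • e) := by
        rw [hp0]
        exact (contDiffAt_partialDeriv hF i).differentiableAt (by simp)
      have h2 := hd.hasFDerivAt.comp_hasDerivAt 0 (hline 0)
      rw [hp0, fderiv_eq_sum] at h2
      exact h2
    have h3 := HasDerivAt.fun_sum (u := Finset.univ) fun i _ => (h1 i).const_mul (x i)
    rw [h3.deriv]
    refine Finset.sum_congr rfl fun i _ => ?_
    rw [Finset.mul_sum]
    refine Finset.sum_congr rfl fun j _ => ?_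
    rw [secondPartial_eq]
    ring
  by_contra! hpos
  rw [← hdd] at hpos
  have hh0 : ∀ t, h t ≤ h 0 := fun t => by
    simp only [h, hp0]
    exact hmax _
  have hlm : IsLocalMax h 0 := Eventually.of_forall hh0
  have hcont : ContinuousAt h 0 := by
    have : ContinuousAt F (p + (0 : ℝ) • e) := by
      rw [hp0]
      exact hF.continuousAt
    exact ContinuousAt.comp (f := fun t : ℝ => p + t • e) this (hline 0).continuousAt
  -- A positive second derivative would make `0` a local minimum as well as a maximum; `h` would be
  -- locally constant, with vanishing second derivative.
  have hmin := isLocalMin_of_deriv_deriv_pos hpos hlm.deriv_eq_zero hcont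
  have hconst : h =ᶠ[𝓝 0] fun _ => h 0 := by
    filter_upwards [hmin] with t ht
    exact le_antisymm (hh0 t) ht
  have : deriv (deriv h) 0 = 0 := by
    rw [EventuallyEq.deriv_eq hconst.deriv]
    simp
  linarith

lemma effectiveMatrix_nonneg {J : E d → ℝ} {κ : E d → E d → ℝ} {a : E d → ℝ} {p : E d}
    (hF : ContDiffAt ℝ 2 (hamiltonian J κ a) p)
    (hmax : ∀ q, hamiltonian J κ a q ≤ hamiltonian J κ a p) (x : Fin d → ℝ) :
    0 ≤ ∑ i, ∑ j, effectiveMatrix J κ a p i j * (x i * x j) := by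
  have h1 := sum_secondPartial_nonpos hF hmax x
  have h2 : ∑ i, ∑ j, effectiveMatrix J κ a p i j * (x i * x j)
      = -(1 / 2) * ∑ i, ∑ j, secondPartial (hamiltonian J κ a) i j p * (x i * x j) := by
    simp only [effectiveMatrix, Finset.mul_sum]
    exact Finset.sum_congr rfl fun i _ => Finset.sum_congr rfl fun j _ => by ring
  rw [h2]
  linarith

end

end NonlocalHomogenization

/-! ### The homogenization theorem -/

open NonlocalHomogenization

theorem mainTheorem4 {d : ℕ} (hd : 0 < d)
    (Ω : Set (NonlocalHomogenization.E d)) (hΩ : NonlocalHomogenization.IsBoundedC1Domain Ω)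
    (J : NonlocalHomogenization.E d → ℝ) (hJ : NonlocalHomogenization.IsDispersalKernel J)
    (κ : NonlocalHomogenization.E d → NonlocalHomogenization.E d → ℝ)
    (hκ : NonlocalHomogenization.IsPositiveCoefficient κ)
    (a : NonlocalHomogenization.E d → ℝ) (ha : Continuous a)
    (ha' : NonlocalHomogenization.IsPeriodic a)
    (p₀ : NonlocalHomogenization.E d)
    (hp₀ : ∀ p, NonlocalHomogenization.hamiltonian J κ a p
      ≤ NonlocalHomogenization.hamiltonian J κ a p₀)
    (hH : NonlocalHomogenization.hamiltonian J κ a p₀ < ⨅ ξ, a ξ) :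
    -- the objects entering the problem are well defined
    ContDiffAt ℝ 2 (NonlocalHomogenization.hamiltonian J κ a) p₀ ∧
    (∃ φ, NonlocalHomogenization.IsPrincipalEigenfunction J κ a p₀ φ) ∧
    ∀ φ, NonlocalHomogenization.IsPrincipalEigenfunction J κ a p₀ φ →
      -- existence and uniqueness for every `ε > 0`
      (∀ ε : ℝ, 0 < ε → ∀ f : Lp ℝ 2 (volume.restrict Ω),
        ∃! v, NonlocalHomogenization.IsResolventSolution J κ p₀ φ Ω ε f v) ∧
      -- compactness
      (∀ (ε : ℕ → ℝ) (f : ℕ → Lp ℝ 2 (volume.restrict Ω))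
          (v : ℕ → Lp ℝ 2 (volume : Measure (NonlocalHomogenization.E d))) (C : ℝ),
        (∀ n, 0 < ε n) → Tendsto ε atTop (𝓝 0) → (∀ n, ‖f n‖ ≤ C) →
        (∀ n, NonlocalHomogenization.IsResolventSolution J κ p₀ φ Ω (ε n) (f n) (v n)) →
        ∃ (w : Lp ℝ 2 (volume : Measure (NonlocalHomogenization.E d))) (s : ℕ → ℕ),
          StrictMono s ∧ Tendsto (fun n => v (s n)) atTop (𝓝 w)) ∧
      -- well-posedness of the limit problem and convergence of the whole sequence
      (∀ f : Lp ℝ 2 (volume.restrict Ω),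
        ∃ w, NonlocalHomogenization.IsLimitSolution
            (NonlocalHomogenization.effectiveMatrix J κ a p₀) Ω f w ∧
          (∀ w', NonlocalHomogenization.IsLimitSolution
            (NonlocalHomogenization.effectiveMatrix J κ a p₀) Ω f w' → w' = w) ∧
          ∀ (ε : ℕ → ℝ) (fε : ℕ → Lp ℝ 2 (volume.restrict Ω))
            (v : ℕ → Lp ℝ 2 (volume : Measure (NonlocalHomogenization.E d))),
            (∀ n, 0 < ε n) → Tendsto ε atTop (𝓝 0) → Tendsto fε atTop (𝓝 f) →
            (∀ n, NonlocalHomogenization.IsResolventSolution J κ p₀ φ Ω (ε n) (fε n) (v n)) →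
            Tendsto v atTop (𝓝 w)) := by
  obtain ⟨A, rfl⟩ : ∃ A : CT d, ⇑A = a := ⟨CT.mk a ha ha', rfl⟩
  obtain ⟨x₀, hx₀⟩ := A.exists_forall_le
  have hlt : ∀ x, hamiltonian J κ A p₀ < A x := fun x =>
    hH.trans_le (ciInf_le ⟨A x₀, by rintro _ ⟨y, rfl⟩; exact hx₀ y⟩ x)
  obtain ⟨hC2, Φ, Φ₁, Φ₂, hcor⟩ := exists_corrector hκ hJ hlt hp₀
  have hA := effectiveMatrix_nonneg hC2 hp₀
  refine ⟨hC2, ?_, fun φ hφ => ?_⟩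
  · have hT := isPosOp_tiltOp hκ hJ p₀
    have hH' := hamiltonian_eq hκ hJ A p₀
    obtain ⟨φ, hφ, hφe⟩ := hT.exists_eigenfunction (a := A) fun x => by
      rw [← hH']
      exact hlt x
    exact ⟨φ, (isPrincipalEigenfunction_iff hκ hJ A p₀ φ).2 ⟨hφ, fun x => by rw [hH', hφe x]⟩⟩
  obtain ⟨φ, rfl⟩ : ∃ ϕ : CT d, ⇑ϕ = φ := ⟨hφ.1.toCT, rfl⟩
  have hpair := hcor.isEigenPair hφ
  have hsol : ∀ ε : ℝ, 0 < ε → ∀ f : Lp ℝ 2 (volume.restrict Ω),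
      ∃! v, IsResolventSolution J κ p₀ φ Ω ε f v := fun ε hε f =>
    hpair.existsUnique hΩ.isOpen hΩ.isBounded hε f
  refine ⟨hsol, fun ε f v C hε hε0 hf hv => hpair.exists_subseq hΩ.isBounded hε hε0 hf hv,
    fun f => ?_⟩
  -- Existence comes from the approximation itself, with `ε = 1/(n+1)` and fixed `f`: the matrix is
  -- only known to be nonnegative, so Lax–Milgram in `H¹₀` is not at hand.
  obtain ⟨w, hw⟩ : ∃ w, IsLimitSolution (effectiveMatrix J κ A p₀) Ω f w := by
    have hε : ∀ n : ℕ, (0 : ℝ) < 1 / ((n : ℝ) + 1) := fun n => by positivity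
    choose v hv _ using fun n : ℕ => hsol (1 / ((n : ℝ) + 1)) (hε n) f
    obtain ⟨w, s, hs, hw⟩ := hpair.exists_subseq hΩ.isBounded hε
      tendsto_one_div_add_atTop_nhds_zero_nat (f := fun _ => f) (fun _ => le_rfl) hv
    exact ⟨w, hcor.isLimitSolution hφ hΩ (fun n => hε (s n))
      (tendsto_one_div_add_atTop_nhds_zero_nat.comp hs.tendsto_atTop) tendsto_const_nhds
      (fun n => hv (s n)) hw⟩
  refine ⟨w, hw, fun w' hw' => hw'.unique hA hw, fun ε fε v hε hε0 hf hv => ?_⟩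
  -- Every subsequence has a further one converging to a solution of the limit problem, and
  -- uniqueness makes that solution `w`.
  refine tendsto_of_subseq_tendsto fun ns hns => ?_
  obtain ⟨C, hC⟩ := hf.norm.bddAbove_range
  obtain ⟨w', s, hs, hlim⟩ := hpair.exists_subseq hΩ.isBounded (ε := fun n => ε (ns n))
    (f := fun n => fε (ns n)) (v := fun n => v (ns n)) (C := C) (fun n => hε (ns n))
    (hε0.comp hns) (fun n => hC ⟨ns n, rfl⟩) (fun n => hv (ns n))
  have hns' := hns.comp hs.tendsto_atTop
  have hw' := hcor.isLimitSolution hφ hΩ (ε := fun n => ε (ns (s n)))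
    (f := fun n => fε (ns (s n))) (fun n => hε _) (hε0.comp hns') (hf.comp hns')
    (fun n => hv (ns (s n))) hlim
  rw [hw'.unique hA hw] at hlim
  exact ⟨s, hlim⟩
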